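/- Let $n\ge 1$, $d=2n+1$, and let $G$ be $\mathrm{Spin}(d,1)$ or $\mathrm{SO}^0(d,1)$, $K$ its maximal compact subgroup ($\mathrm{Spin}(d)$, resp. $\mathrm{SO}(d)$), so that $G/K=\mathbb H^d$ (with curvature $-1$). Let $\mathfrak g=\mathfrak k\oplus\mathfrak p$ be the Cartan decomposition and $\mathfrak a=\mathbb R H\subset\mathfrak p$ a maximal abelian subalgebra, with $H$ normalized by $\alpha(H)=1$ for the unique positive root $\alpha$ of $(\mathfrak g,\mathfrak a)$; let $A=\exp\mathfrak a$, let $M$ be the centralizer of $A$ in $K$, let $\mathfrak n$, $\overline{\mathfrak n}$ be the sums of the positive, resp. negative, root spaces, and $\rho=\frac12\dim\mathfrak n$ (identify $\mathfrak a_{\mathbb C}^*\cong\mathbb C$ by $\alpha\leftrightarrow 1$). Let $\Gamma\subset G$ be a discrete, torsion-free, cocompact subgroup, $\chi\colon\Gamma\to\mathrm{GL}(V_\chi)$ a finite-dimensional complex representation, and $\sigma\in\widehat M$ an irreducible unitary representation of $M$. For $\gamma\in\Gamma\setminus\{e\}$ let $l(\gamma)=\inf_{x\in\mathbb H^d}d(x,\gamma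 x)$, and let $m_\gamma\in M$ be such that $\gamma$ is conjugate in $G$ to $m_\gamma a_\gamma$, $a_\gamma=\exp(l(\gamma)H)$. The class $[\gamma]\ne e$ is prime if $\gamma$ is not of the form $\gamma_0^k$ with $k>1$, $\gamma_0\in\Gamma$. For $\operatorname{Re}s$ large, put $$Z(s;\tau,\chi)=\prod_{[\gamma]\ \mathrm{prime}}\ \prod_{k\ge0}\det\big(\mathrm{Id}-(\chi(\gamma)\otimes\tau(m_\gamma)\otimes S^k(\mathrm{Ad}(m_\gamma a_\gamma)|_{\overline{\mathfrak n}}))e^{-(s+\rho)l(\gamma)}\big)$$ for a finite-dimensional unitary representation $\tau$ of $M$, and $$R(s;\sigma,\chi)=\prod_{[\gamma]\ \mathrm{prime}}\det\big(\mathrm{Id}-\chi(\gamma)\otimes\sigma(m_\gamma)e^{-sl(\gamma)}\big)^{(-1)^{d-1}}.$$ For $p=0,\dots,d-1$ the $MA$-module $\Lambda^p\mathfrak n_{\mathbb C}$ (exterior power of the adjoint action) has a finite decomposition $\Lambda^p\mathfrak n_{\mathbb C}\cong\bigoplus_{(\psi_p,\lambda)\in J_p}V_{\psi_p}\otimes\mathbb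 C_\lambda$ with $\psi_p\in\widehat M$, $\lambda\in\mathbb C$, where $\exp(tH)$ acts on $\mathbb C_\lambda$ by $e^{\lambda t}$. For any such decompositions put $$Z_p(s;\sigma,\chi)=\prod_{(\psi_p,\lambda)\in J_p}Z(s+\rho-\lambda;\psi_p\otimes\sigma,\chi).$$ Then there is a real number $c$ such that for all $s\in\mathbb C$ with $\operatorname{Re}s>c$ the infinite products defining $R(s;\sigma,\chi)$ and all the $Z(s+\rho-\lambda;\psi_p\otimes\sigma,\chi)$ converge absolutely, the latter are non-zero, and $$R(s;\sigma,\chi)=\prod_{p=0}^{d-1}Z_p(s;\sigma,\chi)^{(-1)^p}.$$ Moreover, the same identity holds between meromorphic functions on $\mathbb C$ whenever $R(\cdot\,;\sigma,\chi)$ and the functions $Z(\cdot\,;\psi_p\otimes\sigma,\chi)$ are replaced by meromorphic continuations to $\mathbb C$. -/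

import Mathlib

open scoped TensorProduct Matrix

universe u v w

noncomputable section

namespace Hyp

/-! ### Minkowski space and hyperbolic space of dimension `d = 2n+1` -/

/-- The coordinates of `ℝ^{d+1}`, `d = 2n+1`. The coordinate `0` is the time coordinate. -/
abbrev Idx (n : ℕ) : Type := Fin (2 * n + 1 + 1)

/-- The last space coordinate. -/
abbrev Idx.top (n : ℕ) : Idx n := Fin.last (2 * n + 1)

/-- The signs `(+, -, …, -)` of the form `x₀² - x₁² - ⋯ - x_d²`. -/
def sgn (n : ℕ) (i : Idx n) : ℝ := if i = 0 then 1 else -1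

/-- The Gram matrix of the form `x₀² - x₁² - ⋯ - x_d²`. -/
def eta (n : ℕ) : Matrix (Idx n) (Idx n) ℝ := Matrix.diagonal (sgn n)

/-- The bilinear form `x₀ y₀ - x₁ y₁ - ⋯ - x_d y_d`. -/
def form (n : ℕ) (x y : Idx n → ℝ) : ℝ := x ⬝ᵥ (eta n *ᵥ y)

/-- The quadratic form `x₀² - x₁² - ⋯ - x_d²`. -/
def quad (n : ℕ) : QuadraticForm ℝ (Idx n → ℝ) := QuadraticMap.weightedSumSquares ℝ (sgn n)

/-- Hyperbolic space `ℍ^d`, as the upper sheet of the hyperboloid. -/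
def hyperboloid (n : ℕ) : Set (Idx n → ℝ) := {x | form n x x = 1 ∧ 0 < x 0}

/-- The hyperbolic distance (curvature `-1`) on the hyperboloid: `cosh d(x, y) = ⟨x, y⟩`. -/
def hdist (n : ℕ) (x y : Idx n → ℝ) : ℝ := Real.arcosh (form n x y)

/-- The base point `(1, 0, …, 0)` of `ℍ^d`. -/
def basePt (n : ℕ) : Idx n → ℝ := Pi.single 0 1

/-! ### The Lie algebra `𝔤 = 𝔰𝔬(d,1)`, the element `H`, the root spaces -/

/-- `𝔰𝔬(d,1)`. -/
def so (n : ℕ) : Submodule ℝ (Matrix (Idx n) (Idx n) ℝ) where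
  carrier := {X | Xᵀ * eta n + eta n * X = 0}
  add_mem' := by
    intro X Y hX hY
    simp only [Set.mem_ofPred_eq] at *
    rw [Matrix.transpose_add, add_mul, mul_add, ← add_zero (0 : Matrix (Idx n) (Idx n) ℝ)]
    nth_rewrite 1 [← hX]
    rw [← hY]; abel
  zero_mem' := by simp
  smul_mem' := by
    intro c X hX
    simp only [Set.mem_ofPred_eq] at *
    rw [Matrix.transpose_smul, smul_mul_assoc, mul_smul_comm, ← smul_add, hX, smul_zero]

/-- The generator `H` of `𝔞 = ℝ H`, normalized by `α(H) = 1` for the positive root `α`. -/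
def H (n : ℕ) : Matrix (Idx n) (Idx n) ℝ :=
  Matrix.single 0 (Idx.top n) 1 + Matrix.single (Idx.top n) 0 1

/-- The matrix `exp (t H)` (note `H ^ 3 = H`). -/
def boost (n : ℕ) (t : ℝ) : Matrix (Idx n) (Idx n) ℝ :=
  1 + Real.sinh t • H n + (Real.cosh t - 1) • (H n * H n)

/-- The root space `{X ∈ 𝔤 : [H, X] = c X}`. -/
def rootSpace (n : ℕ) (c : ℝ) : Submodule ℝ (Matrix (Idx n) (Idx n) ℝ) where
  carrier := {X | X ∈ so n ∧ H n * X - X * H n = c • X}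
  add_mem' := by
    rintro X Y ⟨hX, hX'⟩ ⟨hY, hY'⟩
    refine ⟨add_mem hX hY, ?_⟩
    rw [smul_add, ← hX', ← hY', mul_add, add_mul]; abel
  zero_mem' := ⟨zero_mem _, by simp⟩
  smul_mem' := by
    rintro a X ⟨hX, hX'⟩
    refine ⟨Submodule.smul_mem _ _ hX, ?_⟩
    rw [mul_smul_comm, smul_mul_assoc, ← smul_sub, hX', smul_comm]

/-- `𝔫`, the sum of the positive root spaces of `(𝔤, 𝔞)` (there is one positive root `α`). -/
abbrev nPos (n : ℕ) := rootSpace n 1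

/-- `𝔫̄`, the sum of the negative root spaces of `(𝔤, 𝔞)`. -/
abbrev nNeg (n : ℕ) := rootSpace n (-1)

/-- `ρ = ½ dim(𝔤_α) α`, as a number through `α ↔ 1`. -/
def rho (n : ℕ) : ℝ := (Module.finrank ℝ (nPos n) : ℝ) / 2

/-! ### Elementary facts on these matrices -/

theorem top_ne_zero (n : ℕ) : (Idx.top n) ≠ 0 := by
  intro h
  have := congrArg Fin.val h
  simp at this

theorem eta_transpose (n : ℕ) : (eta n)ᵀ = eta n := Matrix.diagonal_transpose _

theorem eta_mul_eta (n : ℕ) : eta n * eta n = 1 := by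
  rw [eta, Matrix.diagonal_mul_diagonal, ← Matrix.diagonal_one]
  congr 1
  funext i
  by_cases h : i = 0 <;> simp [sgn, h]

theorem H_transpose (n : ℕ) : (H n)ᵀ = H n := by
  simp [H, Matrix.transpose_single, add_comm]

theorem H_mul_H (n : ℕ) :
    H n * H n = Matrix.single 0 0 1 + Matrix.single (Idx.top n) (Idx.top n) 1 := by
  have h := top_ne_zero n
  simp [H, add_mul, mul_add, h, h.symm, add_comm]

theorem H_cube (n : ℕ) : H n * (H n * H n) = H n := by
  have h := top_ne_zero n
  rw [H_mul_H]
  simp [H, add_mul, mul_add, h, h.symm, add_comm]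

theorem H_mul_eta (n : ℕ) : H n * eta n = - (eta n * H n) := by
  have h := top_ne_zero n
  ext i j
  simp only [H, eta, Matrix.mul_diagonal, Matrix.diagonal_mul, Matrix.neg_apply, Matrix.add_apply,
    Matrix.single_apply, sgn]
  by_cases hi : i = 0 <;> by_cases hj : j = 0 <;> by_cases hi' : i = Idx.top n <;>
    by_cases hj' : j = Idx.top n <;> simp_all [eq_comm]

theorem boost_isometry (n : ℕ) (t : ℝ) : (boost n t)ᵀ * eta n * boost n t = eta n := by
  have h1 := H_mul_eta n
  have h2 : (H n * H n) * eta n = eta n * (H n * H n) := by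
    rw [mul_assoc, h1, mul_neg, ← mul_assoc, h1, neg_mul, neg_neg, mul_assoc]
  have h3 := H_cube n
  have h3' : (H n * H n) * H n = H n := by rw [mul_assoc, h3]
  have h4 : (H n * H n) * (H n * H n) = H n * H n := by
    rw [mul_assoc, h3]
  have hT : (boost n t)ᵀ = boost n t := by
    simp [boost, Matrix.transpose_add, Matrix.transpose_smul, Matrix.transpose_mul, H_transpose]
  have hL : boost n t * eta n =
      eta n * (1 - Real.sinh t • H n + (Real.cosh t - 1) • (H n * H n)) := by
    rw [boost, add_mul, add_mul, mul_add, mul_sub, smul_mul_assoc, smul_mul_assoc, h1, h2,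
      mul_smul_comm, mul_smul_comm]
    simp [sub_eq_add_neg]
  rw [hT, hL, mul_assoc]
  have key : (1 - Real.sinh t • H n + (Real.cosh t - 1) • (H n * H n)) * boost n t = 1 := by
    rw [boost]
    simp only [add_mul, sub_mul, mul_add, one_mul, mul_one, smul_mul_assoc, mul_smul_comm, h3, h3',
      h4]
    have hs := Real.cosh_sq t
    have : Real.sinh t * Real.sinh t = Real.cosh t * Real.cosh t - 1 := by nlinarith
    have e : Real.sinh t • Real.sinh t • (H n * H n)
        = (Real.cosh t * Real.cosh t - 1) • (H n * H n) := by rw [smul_smul, this]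
    rw [smul_add, smul_sub, e]
    module
  rw [key, mul_one]

theorem boost_apply_mulVec (n : ℕ) (t : ℝ) (v : Idx n → ℝ) :
    boost n t *ᵥ v = v
      + (Real.sinh t * v (Idx.top n) + (Real.cosh t - 1) * v 0) • Pi.single 0 1
      + (Real.sinh t * v 0 + (Real.cosh t - 1) * v (Idx.top n)) • Pi.single (Idx.top n) 1 := by
  rw [boost, H_mul_H, H]
  simp only [Matrix.add_mulVec, Matrix.smul_mulVec, Matrix.one_mulVec]
  have hs : ∀ (a b : Idx n), (Matrix.single a b (1 : ℝ)) *ᵥ v = v b • Pi.single a 1 := by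
    intro a b
    ext i
    simp [Matrix.single_mulVec, Pi.single_apply, Function.update_apply]
  simp only [hs]
  module

theorem form_mulVec_mulVec {n : ℕ} {g : Matrix (Idx n) (Idx n) ℝ}
    (hg : gᵀ * eta n * g = eta n) (x y : Idx n → ℝ) :
    form n (g *ᵥ x) (g *ᵥ y) = form n x y := by
  unfold form
  conv_rhs => rw [← hg]
  rw [← Matrix.mulVec_mulVec, ← Matrix.mulVec_mulVec, Matrix.dotProduct_mulVec x gᵀ,
    Matrix.vecMul_transpose]

/-! ### The groups `G` -/

/-- The data attached to a connected group `G` covering `SO⁰(d,1)`, `d = 2n+1`, that are used below: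
its topology, the covering homomorphism onto `SO⁰(d,1)`, as matrices, and the one-parameter
subgroup `t ↦ exp (t H)` of `G`. Only the two instances `soGroup n` and `spinGrp n` occur. -/
structure HypGroup (n : ℕ) where
  G : Type
  [grp : Group G]
  [top : TopologicalSpace G]
  cov : G →* Matrix (Idx n) (Idx n) ℝ
  cov_isometry : ∀ g, (cov g)ᵀ * eta n * cov g = eta n
  flow : ℝ → G
  cov_flow : ∀ t, cov (flow t) = boost n t

attribute [instance] HypGroup.grp HypGroup.top

/-! ### `G = SO⁰(d,1)` -/

/-- `SO⁰(d,1)`: the isometries of the form of determinant one that preserve the upper sheet of the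
hyperboloid, with the topology of `SL(d+1, ℝ)`. -/
def SO0 (n : ℕ) : Subgroup (Matrix.SpecialLinearGroup (Idx n) ℝ) where
  carrier := {g | (g.1)ᵀ * eta n * g.1 = eta n ∧ ∀ x ∈ hyperboloid n, g.1 *ᵥ x ∈ hyperboloid n}
  mul_mem' := by
    rintro a b ⟨ha, ha'⟩ ⟨hb, hb'⟩
    refine ⟨?_, fun x hx => ?_⟩
    · rw [Matrix.SpecialLinearGroup.coe_mul, Matrix.transpose_mul]
      calc (b.1)ᵀ * (a.1)ᵀ * eta n * (a.1 * b.1)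
          = (b.1)ᵀ * ((a.1)ᵀ * eta n * a.1) * b.1 := by simp only [mul_assoc]
        _ = eta n := by rw [ha, hb]
    · rw [Matrix.SpecialLinearGroup.coe_mul, ← Matrix.mulVec_mulVec]
      exact ha' _ (hb' _ hx)
  one_mem' := by
    refine ⟨by simp, fun x hx => by simpa using hx⟩
  inv_mem' := by
    rintro a ⟨ha, ha'⟩
    have h1 : a.1 * (a⁻¹).1 = 1 := by
      rw [← Matrix.SpecialLinearGroup.coe_mul, mul_inv_cancel, Matrix.SpecialLinearGroup.coe_one]
    have h2 : ((a⁻¹).1)ᵀ * eta n * (a⁻¹).1 = eta n := by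
      have h1' : ((a⁻¹).1)ᵀ * (a.1)ᵀ = 1 := by
        rw [← Matrix.transpose_mul, h1, Matrix.transpose_one]
      calc ((a⁻¹).1)ᵀ * eta n * (a⁻¹).1
          = ((a⁻¹).1)ᵀ * ((a.1)ᵀ * eta n * a.1) * (a⁻¹).1 := by rw [ha]
        _ = (((a⁻¹).1)ᵀ * (a.1)ᵀ) * eta n * (a.1 * (a⁻¹).1) := by simp only [mul_assoc]
        _ = eta n := by rw [h1, h1', one_mul, mul_one]
    refine ⟨h2, fun x hx => ?_⟩
    have hx1 : form n ((a⁻¹).1 *ᵥ x) ((a⁻¹).1 *ᵥ x) = 1 := by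
      rw [form_mulVec_mulVec h2]; exact hx.1
    refine ⟨hx1, ?_⟩
    by_contra hneg
    have hne : ((a⁻¹).1 *ᵥ x) 0 ≠ 0 := by
      intro h0
      have : form n ((a⁻¹).1 *ᵥ x) ((a⁻¹).1 *ᵥ x) ≤ 0 := by
        simp only [form, dotProduct, eta, Matrix.mulVec_diagonal]
        refine Finset.sum_nonpos fun i _ => ?_
        by_cases hi : i = 0
        · subst hi; rw [h0]; simp
        · simp only [sgn, hi, if_false]; nlinarith [mul_self_nonneg (((a⁻¹).1 *ᵥ x) i)]
      linarith
    have hmem : -((a⁻¹).1 *ᵥ x) ∈ hyperboloid n := by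
      refine ⟨?_, ?_⟩
      · refine Eq.trans ?_ hx1
        simp [form, Matrix.mulVec_neg]
      · have : ((a⁻¹).1 *ᵥ x) 0 < 0 := lt_of_le_of_ne (not_lt.mp hneg) hne
        simpa using this
    have h3 := (ha' _ hmem).2
    rw [Matrix.mulVec_neg, Matrix.mulVec_mulVec, h1, Matrix.one_mulVec] at h3
    have h4 := hx.2
    simp only [Pi.neg_apply] at h3
    linarith

theorem boost_mem_hyperboloid (n : ℕ) (t : ℝ) (x : Idx n → ℝ) (hx : x ∈ hyperboloid n) :
    boost n t *ᵥ x ∈ hyperboloid n := by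
  refine ⟨by rw [form_mulVec_mulVec (boost_isometry n t)]; exact hx.1, ?_⟩
  have h := top_ne_zero n
  have hx1 : x (Idx.top n) ^ 2 < x 0 ^ 2 := by
    have h1 := hx.1
    simp only [form, dotProduct, eta, Matrix.mulVec_diagonal] at h1
    rw [← Finset.add_sum_erase _ _ (Finset.mem_univ (0 : Idx n)),
      ← Finset.add_sum_erase _ _ (Finset.mem_erase.mpr ⟨h, Finset.mem_univ (Idx.top n)⟩)] at h1
    have h2 : ∑ i ∈ (Finset.univ.erase (0 : Idx n)).erase (Idx.top n), x i * (sgn n i * x i) ≤ 0 := by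
      refine Finset.sum_nonpos fun i hi => ?_
      have hi0 : i ≠ 0 := by
        simp only [Finset.mem_erase] at hi
        exact hi.2.1
      simp only [sgn, hi0, if_false]; nlinarith [mul_self_nonneg (x i)]
    simp only [sgn, if_true, h, if_false] at h1 h2
    nlinarith
  have hx2 : |x (Idx.top n)| < x 0 := abs_lt_of_sq_lt_sq hx1 hx.2.le
  have e : (boost n t *ᵥ x) 0 = Real.cosh t * x 0 + Real.sinh t * x (Idx.top n) := by
    rw [boost_apply_mulVec]
    simp [h.symm]
    ring
  rw [e]
  have hx3 := abs_lt.mp hx2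
  rw [Real.cosh_eq, Real.sinh_eq]
  have p1 := Real.exp_pos t
  have p2 := Real.exp_pos (-t)
  nlinarith [mul_pos p1 (show 0 < x 0 + x (Idx.top n) by linarith),
    mul_pos p2 (show 0 < x 0 - x (Idx.top n) by linarith)]

theorem boost_add (n : ℕ) (s t : ℝ) : boost n (s + t) = boost n s * boost n t := by
  have h3 := H_cube n
  have h3' : (H n * H n) * H n = H n := by rw [mul_assoc, h3]
  have h4 : (H n * H n) * (H n * H n) = H n * H n := by rw [mul_assoc, h3]
  simp only [boost, add_mul, mul_add, one_mul, mul_one, smul_mul_assoc, mul_smul_comm, h3, h3', h4,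
    Real.cosh_add, Real.sinh_add]
  module

theorem boost_det (n : ℕ) (t : ℝ) : (boost n t).det = 1 := by
  have h1 : ∀ s, (boost n s).det ^ 2 = 1 := by
    intro s
    have h := congrArg Matrix.det (boost_isometry n s)
    have he : (eta n).det * (eta n).det = 1 := by
      rw [← Matrix.det_mul, eta_mul_eta, Matrix.det_one]
    rw [Matrix.det_mul, Matrix.det_mul, Matrix.det_transpose] at h
    calc (boost n s).det ^ 2 = (boost n s).det * (eta n).det * (boost n s).det * (eta n).det := by
          linear_combination (-(boost n s).det ^ 2) * he
      _ = 1 := by rw [h, he]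
  have h2 : boost n t = boost n (t / 2) * boost n (t / 2) := by
    rw [← boost_add]; congr 1; ring
  rw [h2, Matrix.det_mul, ← sq, h1]

/-- The group `SO⁰(d,1)`, with its tautological representation and `exp (t H)`. -/
def soGroup (n : ℕ) : HypGroup n where
  G := SO0 n
  cov := { toFun := fun g => g.1.1, map_one' := rfl, map_mul' := fun _ _ => rfl }
  cov_isometry g := g.2.1
  flow t := ⟨⟨boost n t, boost_det n t⟩, boost_isometry n t, boost_mem_hyperboloid n t⟩
  cov_flow _ := rfl

/-! ### `G = Spin(d,1)` -/

/-- The Clifford algebra of the form `x₀² - x₁² - ⋯ - x_d²`. -/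
abbrev Cl (n : ℕ) : Type := CliffordAlgebra (quad n)

/-- The inclusion of the vectors into the Clifford algebra. -/
abbrev vec (n : ℕ) : (Idx n → ℝ) →ₗ[ℝ] Cl n := CliffordAlgebra.ι (quad n)

theorem vec_injective (n : ℕ) : Function.Injective (vec n) := by
  intro x y h
  have h' := congrArg (CliffordAlgebra.equivExterior (quad n)) h
  simpa [CliffordAlgebra.equivExterior, CliffordAlgebra.changeFormEquiv] using h'

/-- The identification of the vectors in the Clifford algebra with `ℝ^{d+1}`. -/
def vecEquiv (n : ℕ) : (Idx n → ℝ) ≃ₗ[ℝ] LinearMap.range (vec n) :=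
  LinearEquiv.ofInjective (vec n) (vec_injective n)

theorem spin_conj_mem (n : ℕ) (x : spinGroup (quad n)) (y : Cl n)
    (hy : y ∈ LinearMap.range (vec n)) :
    (x : Cl n) * y * ((x⁻¹ : spinGroup (quad n)) : Cl n) ∈ LinearMap.range (vec n) := by
  obtain ⟨v, rfl⟩ := hy
  have h : ((spinGroup.toUnits x : (Cl n)ˣ) : Cl n) ∈ spinGroup (quad n) := x.2
  have h2 := spinGroup.conjAct_smul_ι_mem_range_ι h v
  rw [ConjAct.units_smul_def, ConjAct.ofConjAct_toConjAct] at h2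
  exact h2

/-- The action of `x ∈ Spin(d,1)` on the vectors, `v ↦ x v x⁻¹`. -/
def spinAct (n : ℕ) (x : spinGroup (quad n)) : (Idx n → ℝ) →ₗ[ℝ] (Idx n → ℝ) :=
  (vecEquiv n).symm.toLinearMap ∘ₗ
    (((LinearMap.mulRight ℝ ((x⁻¹ : spinGroup (quad n)) : Cl n)) ∘ₗ
      (LinearMap.mulLeft ℝ (x : Cl n))).restrict (spin_conj_mem n x)) ∘ₗ
    (vecEquiv n).toLinearMap

theorem vec_spinAct (n : ℕ) (x : spinGroup (quad n)) (v : Idx n → ℝ) :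
    vec n (spinAct n x v) = (x : Cl n) * vec n v * ((x⁻¹ : spinGroup (quad n)) : Cl n) := by
  have h : ∀ w : LinearMap.range (vec n), vec n ((vecEquiv n).symm w) = w := fun w =>
    congrArg Subtype.val ((vecEquiv n).apply_symm_apply w)
  simp only [spinAct, LinearMap.comp_apply, LinearEquiv.coe_coe, h]
  rfl

theorem spinAct_eq (n : ℕ) (x : spinGroup (quad n)) (v w : Idx n → ℝ)
    (h : (x : Cl n) * vec n v = vec n w * (x : Cl n)) : spinAct n x v = w := by
  apply vec_injective n
  rw [vec_spinAct, h, mul_assoc]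
  have : (x : Cl n) * ((x⁻¹ : spinGroup (quad n)) : Cl n) = 1 := spinGroup.coe_mul_star_self x
  rw [this, mul_one]

/-- The covering homomorphism `Spin(d,1) → SO⁰(d,1)`, as matrices. -/
def spinCov (n : ℕ) : spinGroup (quad n) →* Matrix (Idx n) (Idx n) ℝ where
  toFun x := LinearMap.toMatrix' (spinAct n x)
  map_one' := by
    have : spinAct n 1 = LinearMap.id :=
      LinearMap.ext fun v => spinAct_eq n 1 v v (by simp)
    rw [this, LinearMap.toMatrix'_id]
  map_mul' x y := by
    have : spinAct n (x * y) = spinAct n x ∘ₗ spinAct n y := by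
      apply LinearMap.ext
      intro v
      apply vec_injective n
      rw [LinearMap.comp_apply, vec_spinAct, vec_spinAct, vec_spinAct, mul_inv_rev]
      simp only [Submonoid.coe_mul, mul_assoc]
    rw [this, LinearMap.toMatrix'_comp]

theorem spinCov_mulVec (n : ℕ) (x : spinGroup (quad n)) (v : Idx n → ℝ) :
    spinCov n x *ᵥ v = spinAct n x v := by
  change LinearMap.toMatrix' (spinAct n x) *ᵥ v = _
  rw [← Matrix.toLin'_apply, Matrix.toLin'_toMatrix']

theorem quad_eq_form (n : ℕ) (v : Idx n → ℝ) : quad n v = form n v v := by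
  simp only [quad, QuadraticMap.weightedSumSquares_apply, form, dotProduct, eta,
    Matrix.mulVec_diagonal, smul_eq_mul]
  exact Finset.sum_congr rfl fun i _ => by ring

theorem form_add_self (n : ℕ) (v w : Idx n → ℝ) :
    form n (v + w) (v + w) = form n v v + 2 * form n v w + form n w w := by
  have hc : form n w v = form n v w := by
    simp only [form, dotProduct, eta, Matrix.mulVec_diagonal]
    exact Finset.sum_congr rfl fun i _ => by ring
  have : form n (v + w) (v + w) = form n v v + form n v w + (form n w v + form n w w) := by
    simp only [form, Matrix.mulVec_add, add_dotProduct, dotProduct_add]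
    ring
  rw [this, hc]; ring

theorem quad_spinAct (n : ℕ) (x : spinGroup (quad n)) (v : Idx n → ℝ) :
    quad n (spinAct n x v) = quad n v := by
  have : Nontrivial (Cl n) := inferInstance
  apply (algebraMap ℝ (Cl n)).injective
  rw [← CliffordAlgebra.ι_sq_scalar, ← CliffordAlgebra.ι_sq_scalar]
  change vec n _ * vec n _ = vec n _ * vec n _
  rw [vec_spinAct]
  have h1 : ((x⁻¹ : spinGroup (quad n)) : Cl n) * (x : Cl n) = 1 := spinGroup.coe_star_mul_self x
  have h2 : (x : Cl n) * ((x⁻¹ : spinGroup (quad n)) : Cl n) = 1 := spinGroup.coe_mul_star_self x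
  have h3 : vec n v * vec n v = algebraMap ℝ (Cl n) (quad n v) := CliffordAlgebra.ι_sq_scalar _ _
  calc (x : Cl n) * vec n v * ((x⁻¹ : spinGroup (quad n)) : Cl n) *
        ((x : Cl n) * vec n v * ((x⁻¹ : spinGroup (quad n)) : Cl n))
      = (x : Cl n) * vec n v * (((x⁻¹ : spinGroup (quad n)) : Cl n) * (x : Cl n)) * vec n v
          * ((x⁻¹ : spinGroup (quad n)) : Cl n) := by simp only [mul_assoc]
    _ = (x : Cl n) * (vec n v * vec n v) * ((x⁻¹ : spinGroup (quad n)) : Cl n) := by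
        rw [h1, mul_one]; simp only [mul_assoc]
    _ = vec n v * vec n v := by
        rw [h3, ← Algebra.commutes, mul_assoc, h2, mul_one]

theorem spinCov_isometry (n : ℕ) (x : spinGroup (quad n)) :
    (spinCov n x)ᵀ * eta n * spinCov n x = eta n := by
  have h1 : ∀ v, form n (spinCov n x *ᵥ v) (spinCov n x *ᵥ v) = form n v v := by
    intro v
    rw [spinCov_mulVec, ← quad_eq_form, quad_spinAct, quad_eq_form]
  have h2 : ∀ v w, form n (spinCov n x *ᵥ v) (spinCov n x *ᵥ w) = form n v w := by
    intro v w
    have := h1 (v + w)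
    rw [Matrix.mulVec_add, form_add_self, form_add_self, h1, h1] at this
    linarith
  have h3 : ∀ v w, v ⬝ᵥ (((spinCov n x)ᵀ * eta n * spinCov n x) *ᵥ w) = v ⬝ᵥ (eta n *ᵥ w) := by
    intro v w
    have := h2 v w
    unfold form at this
    rw [← this, ← Matrix.mulVec_mulVec, ← Matrix.mulVec_mulVec,
      Matrix.dotProduct_mulVec v, Matrix.vecMul_transpose]
  ext i j
  have := h3 (Pi.single i 1) (Pi.single j 1)
  simpa using this

/-- `exp (t H) = cosh (t/2) + sinh (t/2) e_d e_0` in `Spin(d,1)`. -/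
def spinFlowVal (n : ℕ) (t : ℝ) : Cl n :=
  algebraMap ℝ (Cl n) (Real.cosh (t / 2)) +
    Real.sinh (t / 2) • (vec n (Pi.single (Idx.top n) 1) * vec n (Pi.single 0 1))

theorem quad_single_top (n : ℕ) : quad n (Pi.single (Idx.top n) 1) = -1 := by
  rw [quad_eq_form]
  simp [form, eta, sgn]

theorem quad_single_zero (n : ℕ) : quad n (Pi.single 0 1) = 1 := by
  rw [quad_eq_form]
  simp [form, eta, sgn]

theorem quad_flow (n : ℕ) (a b : ℝ) :
    quad n (a • Pi.single (Idx.top n) 1 + b • Pi.single 0 1) = b ^ 2 - a ^ 2 := by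
  rw [quad_eq_form, form_add_self, ← quad_eq_form, ← quad_eq_form, QuadraticMap.map_smul,
    QuadraticMap.map_smul, quad_single_top, quad_single_zero]
  simp [form, eta, sgn, Matrix.mulVec_smul]
  ring

theorem spinFlowVal_eq (n : ℕ) (t : ℝ) : spinFlowVal n t = vec n (Pi.single (Idx.top n) 1) *
    vec n ((-Real.cosh (t / 2)) • Pi.single (Idx.top n) 1 + Real.sinh (t / 2) • Pi.single 0 1) := by
  rw [map_add, map_smul, map_smul, mul_add, mul_smul_comm, mul_smul_comm,
    CliffordAlgebra.ι_sq_scalar, quad_single_top, spinFlowVal, Algebra.algebraMap_eq_smul_one,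
    Algebra.algebraMap_eq_smul_one, smul_smul]
  simp

theorem vec_mem_lipschitz (n : ℕ) (v : Idx n → ℝ) (hv : quad n v = -1) :
    ∃ u ∈ lipschitzGroup (quad n), (u : Cl n) = vec n v := by
  have h : vec n v * vec n v = -1 := by
    rw [CliffordAlgebra.ι_sq_scalar, hv, map_neg, map_one]
  refine ⟨⟨vec n v, -vec n v, by rw [mul_neg, h, neg_neg], by rw [neg_mul, h, neg_neg]⟩, ?_, rfl⟩
  exact Subgroup.subset_closure ⟨v, rfl⟩

theorem spinFlowVal_mem (n : ℕ) (t : ℝ) : spinFlowVal n t ∈ spinGroup (quad n) := by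
  set w : Idx n → ℝ :=
    (-Real.cosh (t / 2)) • Pi.single (Idx.top n) 1 + Real.sinh (t / 2) • Pi.single 0 1 with hw
  have hqw : quad n w = -1 := by
    rw [hw, quad_flow]
    have := Real.cosh_sq (t / 2)
    linarith
  have hqe := quad_single_top n
  rw [spinFlowVal_eq, ← hw]
  set e : Idx n → ℝ := Pi.single (Idx.top n) 1
  obtain ⟨u1, hu1, h1⟩ := vec_mem_lipschitz n e hqe
  obtain ⟨u2, hu2, h2⟩ := vec_mem_lipschitz n w hqw
  have he2 : vec n e * vec n e = -1 := by
    rw [CliffordAlgebra.ι_sq_scalar, hqe, map_neg, map_one]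
  have hw2 : vec n w * vec n w = -1 := by
    rw [CliffordAlgebra.ι_sq_scalar, hqw, map_neg, map_one]
  have hstar : star (vec n e * vec n w) = vec n w * vec n e := by
    simp [CliffordAlgebra.star_def]
  refine ⟨⟨⟨u1 * u2, mul_mem hu1 hu2, ?_⟩, ?_⟩, ?_⟩
  · simp [h1, h2]
  · refine ⟨?_, ?_⟩
    · rw [hstar]
      calc vec n w * vec n e * (vec n e * vec n w)
          = vec n w * (vec n e * vec n e) * vec n w := by simp only [mul_assoc]
        _ = 1 := by rw [he2, mul_neg, mul_one, neg_mul, hw2, neg_neg]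
    · rw [hstar]
      calc vec n e * vec n w * (vec n w * vec n e)
          = vec n e * (vec n w * vec n w) * vec n e := by simp only [mul_assoc]
        _ = 1 := by rw [hw2, mul_neg, mul_one, neg_mul, he2, neg_neg]
  · exact CliffordAlgebra.ι_mul_ι_mem_evenOdd_zero (quad n) e w

theorem spinFlow_cov (n : ℕ) (t : ℝ) :
    spinCov n ⟨spinFlowVal n t, spinFlowVal_mem n t⟩ = boost n t := by
  have key : ∀ v, spinCov n ⟨spinFlowVal n t, spinFlowVal_mem n t⟩ *ᵥ v = boost n t *ᵥ v := by
    intro v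
    rw [spinCov_mulVec]
    apply spinAct_eq
    change spinFlowVal n t * vec n v = vec n (boost n t *ᵥ v) * spinFlowVal n t
    rw [boost_apply_mulVec, spinFlowVal, map_add, map_add, map_smul, map_smul]
    set e := vec n (Pi.single (Idx.top n) 1) with he
    set f := vec n (Pi.single 0 1) with hf
    set x := vec n v
    have he2 : e * e = -1 := by
      rw [he, CliffordAlgebra.ι_sq_scalar, quad_single_top, map_neg, map_one]
    have hf2 : f * f = 1 := by
      rw [hf, CliffordAlgebra.ι_sq_scalar, quad_single_zero, map_one]
    have hpol : ∀ w : Idx n → ℝ, QuadraticMap.polar (quad n) v w = 2 * form n v w := by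
      intro w
      rw [QuadraticMap.polar, quad_eq_form, quad_eq_form, quad_eq_form, form_add_self]; ring
    have hxe : x * e = -(e * x) + (-2 * v (Idx.top n)) • (1 : Cl n) := by
      have := CliffordAlgebra.ι_mul_ι_add_swap (Q := quad n) v (Pi.single (Idx.top n) 1)
      rw [hpol, Algebra.algebraMap_eq_smul_one] at this
      have h2 : 2 * form n v (Pi.single (Idx.top n) 1) = -2 * v (Idx.top n) := by
        simp [form, eta, sgn]
      rw [h2] at this
      rw [← this]; abel
    have hxf : x * f = -(f * x) + (2 * v 0) • (1 : Cl n) := by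
      have := CliffordAlgebra.ι_mul_ι_add_swap (Q := quad n) v (Pi.single 0 1)
      rw [hpol, Algebra.algebraMap_eq_smul_one] at this
      have h2 : 2 * form n v (Pi.single 0 1) = 2 * v 0 := by
        simp [form, eta, sgn]
      rw [h2] at this
      rw [← this]; abel
    have hef : f * e = -(e * f) := by
      have := CliffordAlgebra.ι_mul_ι_add_swap (Q := quad n) (Pi.single 0 1) (Pi.single (Idx.top n) 1)
      rw [QuadraticMap.polar, quad_eq_form, quad_eq_form, quad_eq_form, form_add_self] at this
      have h2 : form n (Pi.single 0 1) (Pi.single (Idx.top n) 1) = 0 := by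
        simp [form, eta, sgn]
      rw [h2] at this
      simp only [mul_zero, add_zero, add_sub_cancel_left, sub_self, map_zero] at this
      exact eq_neg_of_add_eq_zero_left this
    have hxef : x * (e * f) = e * f * x - (2 * v (Idx.top n)) • f - (2 * v 0) • e := by
      rw [← mul_assoc, hxe, add_mul, neg_mul, mul_assoc, hxf, mul_add, mul_neg, smul_mul_assoc,
        one_mul, mul_smul_comm, mul_one, mul_assoc]
      module
    have hfef : f * (e * f) = -e := by
      rw [← mul_assoc, hef, neg_mul, mul_assoc, hf2, mul_one]
    have heef : e * (e * f) = -f := by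
      rw [← mul_assoc, he2, neg_mul, one_mul]
    have hS : Real.sinh t = 2 * Real.sinh (t / 2) * Real.cosh (t / 2) := by
      rw [← Real.sinh_two_mul]; congr 1; ring
    have hC : Real.cosh t - 1 = 2 * Real.sinh (t / 2) ^ 2 := by
      have h1 := Real.cosh_two_mul (t / 2)
      have h2 := Real.cosh_sq (t / 2)
      rw [show 2 * (t / 2) = t by ring] at h1
      linarith
    have hCS := Real.cosh_sq (t / 2)
    rw [hS, hC, Algebra.algebraMap_eq_smul_one]
    generalize Real.sinh (t / 2) = s at *
    generalize Real.cosh (t / 2) = c at *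
    simp only [add_mul, mul_add, smul_mul_assoc, mul_smul_comm, one_mul, mul_one, hxef, hfef, heef]
    match_scalars <;>
      first
      | ring1
      | linear_combination (-2 * s * v (Idx.top n)) * hCS
      | linear_combination (-2 * s * v 0) * hCS
  ext i j
  have := congrFun (key (Pi.single j 1)) i
  simpa using this

/-- The group `Spin(d,1)`, the universal covering group of `SO⁰(d,1)`, with the topology of a
subset of the finite-dimensional real vector space underlying the Clifford algebra. -/
def spinGrp (n : ℕ) : HypGroup n where
  G := spinGroup (quad n)
  top := TopologicalSpace.induced Subtype.val (moduleTopology ℝ (Cl n))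
  cov := spinCov n
  cov_isometry := spinCov_isometry n
  flow t := ⟨spinFlowVal n t, spinFlowVal_mem n t⟩
  cov_flow := spinFlow_cov n

/-! ### The subgroups `K`, `M`, `A` of `G` and the adjoint action of `MA` -/

namespace HypGroup

variable {n : ℕ} (L : HypGroup n)

/-- The maximal compact subgroup `K` (`SO(d)` or `Spin(d)`): the stabilizer of the base point of
`G / K = ℍ^d`. -/
def K : Subgroup L.G where
  carrier := {g | L.cov g *ᵥ basePt n = basePt n}
  mul_mem' := by
    intro a b ha hb
    simp only [Set.mem_ofPred_eq] at *
    rw [map_mul, ← Matrix.mulVec_mulVec, hb, ha]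
  one_mem' := by simp
  inv_mem' := by
    intro a ha
    simp only [Set.mem_ofPred_eq] at *
    conv_lhs => rw [← ha]
    rw [Matrix.mulVec_mulVec, ← map_mul, inv_mul_cancel, map_one, Matrix.one_mulVec]

/-- The centralizer `M` of `A = {exp (t H)}` in `K`. -/
def M : Subgroup L.G := L.K ⊓ Subgroup.centralizer (Set.range L.flow)

theorem commute_flow (t : ℝ) : Commute (L.cov (L.flow t)) (H n) := by
  have h3 : (H n * H n) * H n = H n * (H n * H n) := mul_assoc _ _ _
  rw [L.cov_flow]
  change boost n t * H n = H n * boost n t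
  simp only [boost, add_mul, mul_add, one_mul, mul_one, smul_mul_assoc, mul_smul_comm, h3]

theorem commute_of_mem_M (m : L.M) : Commute (L.cov m) (H n) := by
  have h1 : ∀ t, L.cov m * boost n t = boost n t * L.cov m := by
    intro t
    have h := (Subgroup.mem_centralizer_iff.mp m.2.2) (L.flow t) ⟨t, rfl⟩
    rw [← L.cov_flow, ← map_mul, ← map_mul, h]
  have h2 : boost n 1 - boost n (-1) = (2 * Real.sinh 1) • H n := by
    simp only [boost, Real.sinh_neg, Real.cosh_neg]
    module
  have h3 : L.cov m * ((2 * Real.sinh 1) • H n) = ((2 * Real.sinh 1) • H n) * L.cov m := by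
    rw [← h2, mul_sub, sub_mul, h1, h1]
  rw [mul_smul_comm, smul_mul_assoc] at h3
  have h4 : (2 * Real.sinh 1) ≠ 0 := by
    have := Real.sinh_pos_iff.mpr one_pos
    positivity
  exact smul_right_injective _ h4 h3

theorem commute_MA (m : L.M) (t : ℝ) : Commute (L.cov (m * L.flow t)) (H n) := by
  rw [map_mul]
  exact (L.commute_of_mem_M m).mul_left (L.commute_flow t)

theorem cov_mul_inv (g : L.G) : L.cov g * L.cov g⁻¹ = 1 := by
  rw [← map_mul, mul_inv_cancel, map_one]

theorem cov_inv_mul (g : L.G) : L.cov g⁻¹ * L.cov g = 1 := by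
  rw [← map_mul, inv_mul_cancel, map_one]

theorem Ad_mem (g : L.G) (hg : Commute (L.cov g) (H n)) (c : ℝ)
    (X : Matrix (Idx n) (Idx n) ℝ) (hX : X ∈ rootSpace n c) :
    L.cov g * X * L.cov g⁻¹ ∈ rootSpace n c := by
  have h1 := L.cov_mul_inv g
  have h2 := L.cov_inv_mul g
  have hi : L.cov g⁻¹ * H n = H n * L.cov g⁻¹ := by
    calc L.cov g⁻¹ * H n = L.cov g⁻¹ * (H n * L.cov g) * L.cov g⁻¹ := by
          rw [mul_assoc, mul_assoc, h1, mul_one]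
      _ = (L.cov g⁻¹ * L.cov g) * H n * L.cov g⁻¹ := by rw [← hg.eq]; simp only [mul_assoc]
      _ = H n * L.cov g⁻¹ := by rw [h2, one_mul]
  refine ⟨?_, ?_⟩
  · have e1 : (L.cov g)ᵀ * eta n = eta n * L.cov g⁻¹ := by
      rw [← L.cov_isometry g, mul_assoc _ (L.cov g), h1, mul_one, L.cov_isometry g]
    have e2 : eta n * L.cov g = (L.cov g⁻¹)ᵀ * eta n := by
      have := congrArg Matrix.transpose e1
      simpa [Matrix.transpose_mul, eta_transpose] using this
    have hX1 : Xᵀ * eta n + eta n * X = 0 := hX.1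
    change (L.cov g * X * L.cov g⁻¹)ᵀ * eta n + eta n * (L.cov g * X * L.cov g⁻¹) = 0
    calc (L.cov g * X * L.cov g⁻¹)ᵀ * eta n + eta n * (L.cov g * X * L.cov g⁻¹)
        = (L.cov g⁻¹)ᵀ * Xᵀ * ((L.cov g)ᵀ * eta n) + (eta n * L.cov g) * X * L.cov g⁻¹ := by
          simp only [Matrix.transpose_mul, mul_assoc]
      _ = (L.cov g⁻¹)ᵀ * (Xᵀ * eta n + eta n * X) * L.cov g⁻¹ := by
          rw [e1, e2]; simp only [mul_add, add_mul, mul_assoc]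
      _ = 0 := by rw [hX1, mul_zero, zero_mul]
  · have hX2 : H n * X - X * H n = c • X := hX.2
    calc H n * (L.cov g * X * L.cov g⁻¹) - (L.cov g * X * L.cov g⁻¹) * H n
        = (H n * L.cov g) * X * L.cov g⁻¹ - L.cov g * X * (L.cov g⁻¹ * H n) := by
          simp only [mul_assoc]
      _ = L.cov g * (H n * X - X * H n) * L.cov g⁻¹ := by
          rw [← hg.eq, hi]; simp only [mul_sub, sub_mul, mul_assoc]
      _ = c • (L.cov g * X * L.cov g⁻¹) := by
          rw [hX2, mul_smul_comm, smul_mul_assoc]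

/-- The adjoint action `Ad(m exp(tH))` of an element of `MA` on a root space. The Lie algebra of
`G` is identified with `𝔰𝔬(d,1)` through the covering. -/
def Ad (m : L.M) (t : ℝ) (c : ℝ) : rootSpace n c →ₗ[ℝ] rootSpace n c :=
  (LinearMap.mulRight ℝ (L.cov (m * L.flow t)⁻¹) ∘ₗ
    LinearMap.mulLeft ℝ (L.cov (m * L.flow t))).restrict
      (fun X hX => L.Ad_mem _ (L.commute_MA m t) c X hX)

/-- The complexification of `Ad(m exp(tH))` on a root space. -/
def AdC (m : L.M) (t : ℝ) (c : ℝ) : Module.End ℂ (ℂ ⊗[ℝ] rootSpace n c) :=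
  (L.Ad m t c).baseChange ℂ

/-- `ν_p(m exp(tH)) = Λ^p Ad(m exp(tH))` on `Λ^p 𝔫_ℂ`. -/
def nu (p : ℕ) (m : L.M) (t : ℝ) : Module.End ℂ (⋀[ℂ]^p (ℂ ⊗[ℝ] nPos n)) :=
  exteriorPower.map p (L.AdC m t 1)

/-- The translation length `l(g) = inf {d(x, g x) : x ∈ ℍ^d}`. -/
def length (g : L.G) : ℝ := ⨅ x : hyperboloid n, hdist n x.1 (L.cov g *ᵥ x.1)

open Classical in
/-- An element `m_g ∈ M` such that `g` is conjugate in `G` to `m_g a_g`, `a_g = exp (l(g) H)`. It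
is unique up to conjugation in `M` when `g` is hyperbolic. (The value is `1` if there is no such
element; it exists for the hyperbolic elements `g`.) -/
def mPart (g : L.G) : L.M :=
  if h : ∃ m : L.M, ∃ x : L.G, x⁻¹ * g * x = m * L.flow (L.length g) then h.choose else 1

end HypGroup

/-! ### Symmetric powers -/

/-- The `k`-th symmetric power of `V`, as the part of degree `k` of the symmetric algebra. -/
def symPow (k : ℕ) (V : Type) [AddCommGroup V] [Module ℂ V] : Submodule ℂ (SymmetricAlgebra ℂ V) :=
  LinearMap.range (SymmetricAlgebra.ι ℂ V) ^ k

theorem symPow_le (k : ℕ) {V : Type} [AddCommGroup V] [Module ℂ V] (f : Module.End ℂ V)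
    (x : SymmetricAlgebra ℂ V) (hx : x ∈ symPow k V) :
    (SymmetricAlgebra.lift (SymmetricAlgebra.ι ℂ V ∘ₗ f)).toLinearMap x ∈ symPow k V := by
  have h : (symPow k V).map (SymmetricAlgebra.lift (SymmetricAlgebra.ι ℂ V ∘ₗ f)).toLinearMap
      ≤ symPow k V := by
    unfold symPow
    rw [Submodule.map_pow]
    refine pow_le_pow_left' ?_ k
    rintro _ ⟨_, ⟨v, rfl⟩, rfl⟩
    exact ⟨f v, by simp⟩
  exact h ⟨x, hx, rfl⟩

/-- The `k`-th symmetric power of an endomorphism. -/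
def symPowMap (k : ℕ) {V : Type} [AddCommGroup V] [Module ℂ V] (f : Module.End ℂ V) :
    Module.End ℂ (symPow k V) :=
  (SymmetricAlgebra.lift (SymmetricAlgebra.ι ℂ V ∘ₗ f)).toLinearMap.restrict (symPow_le k f)

/-! ### Unitary irreducible representations, decomposition of `Λ^p 𝔫_ℂ` -/

/-- An irreducible unitary (finite-dimensional) representation of the compact group `M`, a
representative of an element of `M̂`. -/
structure UnitaryIrrep (M : Type) [Group M] [TopologicalSpace M] where
  V : Type u
  [normed : NormedAddCommGroup V]
  [inner : InnerProductSpace ℂ V]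
  [findim : FiniteDimensional ℂ V]
  rep : Representation ℂ M V
  continuous_rep : ∀ v, Continuous fun m => rep m v
  norm_rep : ∀ m v, ‖rep m v‖ = ‖v‖
  irreducible : rep.IsIrreducible

attribute [instance] UnitaryIrrep.normed UnitaryIrrep.inner UnitaryIrrep.findim

/-- A family `J_p` of pairs `(ψ, λ)`, with `ψ` a unitary irreducible representation of `M` and `λ` a
one-dimensional representation `exp(tH) ↦ e^{λ t}` of `A`, together with an isomorphism of
`MA`-modules `Λ^p 𝔫_ℂ ≅ ⨁ V_ψ ⊗ ℂ_λ`. -/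
structure MADecomp {n : ℕ} (L : HypGroup n) (p : ℕ) where
  J : Type
  [fin : Fintype J]
  psi : J → UnitaryIrrep.{u} L.M
  lam : J → ℂ
  iso : (⋀[ℂ]^p (ℂ ⊗[ℝ] nPos n)) ≃ₗ[ℂ] (∀ j, (psi j).V)
  equivariant : ∀ (m : L.M) (t : ℝ) (x : ⋀[ℂ]^p (ℂ ⊗[ℝ] nPos n)) (j : J),
    iso (L.nu p m t x) j = Complex.exp (lam j * t) • (psi j).rep m (iso x j)

attribute [instance] MADecomp.fin

/-! ### The zeta functions -/

/-- The prime conjugacy classes `[γ] ≠ e` of a group `Γ`: the class of `γ` is prime if `γ` is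
not of the form `γ₀ ^ k` with `k > 1`. -/
def PrimeClass (Γ : Type) [Group Γ] : Type :=
  {c : ConjClasses Γ // c ≠ 1 ∧
    ∀ γ : Γ, ConjClasses.mk γ = c → ¬ ∃ (k : ℕ) (γ₀ : Γ), 1 < k ∧ γ = γ₀ ^ k}

/-- A representative of a prime conjugacy class. -/
def PrimeClass.elt {Γ : Type} [Group Γ] (c : PrimeClass Γ) : Γ :=
  (ConjClasses.exists_rep c.1).choose

/-- An infinite product `∏ f i` of complex numbers converges absolutely: `∑ |f i - 1| < ∞`. -/
def AbsConvProd {ι : Type} (f : ι → ℂ) : Prop := Summable fun i => ‖f i - 1‖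

section Zeta

variable {n : ℕ} {L : HypGroup n} {Γ : Subgroup L.G}
  {V : Type u} [AddCommGroup V] [Module ℂ V] {W : Type v} [AddCommGroup W] [Module ℂ W]

/-- The factor
`det(Id - (χ(γ) ⊗ σ(m_γ) ⊗ S^k(Ad(m_γ a_γ)|_𝔫̄)) e^{-(s+ρ) l(γ)})` of the Selberg zeta function. -/
def selbergFactor (χ : Representation ℂ Γ V) (σ : Representation ℂ L.M W) (s : ℂ)
    (c : PrimeClass Γ) (k : ℕ) : ℂ :=
  LinearMap.det (LinearMap.id - Complex.exp (-(s + rho n) * L.length c.elt) •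
    TensorProduct.map (TensorProduct.map (χ c.elt) (σ (L.mPart c.elt)))
      (symPowMap k (L.AdC (L.mPart c.elt) (L.length c.elt) (-1))))

/-- The twisted Selberg zeta function `Z(s; σ, χ)`, an infinite product over the prime classes and
`k ≥ 0`; `σ` is a finite-dimensional representation of `M`. -/
def selbergZ (χ : Representation ℂ Γ V) (σ : Representation ℂ L.M W) (s : ℂ) : ℂ :=
  ∏' c : PrimeClass Γ, ∏' k : ℕ, selbergFactor χ σ s c k

/-- The factor `det(Id - χ(γ) ⊗ σ(m_γ) e^{-s l(γ)})^{(-1)^{d-1}}` of the Ruelle zeta function. -/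
def ruelleFactor (χ : Representation ℂ Γ V) (σ : Representation ℂ L.M W) (s : ℂ)
    (c : PrimeClass Γ) : ℂ :=
  LinearMap.det (LinearMap.id - Complex.exp (-s * L.length c.elt) •
    TensorProduct.map (χ c.elt) (σ (L.mPart c.elt))) ^ ((-1 : ℤ) ^ (2 * n + 1 - 1))

/-- The twisted Ruelle zeta function `R(s; σ, χ)`. -/
def ruelleR (χ : Representation ℂ Γ V) (σ : Representation ℂ L.M W) (s : ℂ) : ℂ :=
  ∏' c : PrimeClass Γ, ruelleFactor χ σ s c

/-- `Z_p(s; σ, χ) = ∏_{(ψ, λ) ∈ J_p} Z(s + ρ - λ; ψ ⊗ σ, χ)`. -/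
def zetaP (χ : Representation ℂ Γ V) (σ : Representation ℂ L.M W) {p : ℕ} (D : MADecomp L p)
    (s : ℂ) : ℂ :=
  ∏ j : D.J, selbergZ χ ((D.psi j).rep.tprod σ) (s + rho n - D.lam j)

end Zeta

end Hyp

end

noncomputable section

namespace Hyp

open Module

/-! ### Endomorphisms with a basis of eigenvectors -/

/-! The identity is local: it holds for each prime class separately and is then multiplied out. Fix
γ of length l and let b_i be the 2n eigenvalues of Ad(m_γ a_γ) on 𝔫̄_ℂ. They have modulus e^{-l},
the eigenvalues on 𝔫_ℂ are their inverses, and ∏ b_i = e^{-2ρl} because M acts on the 2n middle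
coordinates with determinant one. Put g(x) = det(1 - xχ(γ)). The local factor of R is a product of
values g(y), with y running over e^{-sl} times the eigenvalues of σ(m_γ); the local factor of a
Selberg function is a product of values g(y b^α) over all multi-indices α. The eigenvalues on Λ^p 𝔫
are ∏_{i∈I} b_i⁻¹ with |I| = p. The shift by ρ - λ, together with the ρ in the definition of Z,
turns them into ∏_{i∉I} b_i, and |I|, |Iᶜ| have the same parity since 2n is even. What remains is
∏_I (∏_α g(y b^I b^α))^{(-1)^{|I|}} = g(y), the multiplicative form of ∏(1 - b_i) · ∑ b^α = 1; this
is `prod_fullProd`. It needs neither that χ(γ) is diagonalizable nor anything about m_γ beyond m_γ ∈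
M.

Convergence has to be obtained for a χ that is not unitary. A Švarc–Milnor argument
(`exists_conj_word`) writes a conjugate of γ as a word of length at most l(γ) + B in a finite set.
Hence the number of classes, and the entries of χ at suitable representatives, grow at most
exponentially in l (`exists_summable_length`, `exists_det_bound`). With a positive lower bound for
the lengths (`exists_le_length`) this yields the constants of `ZetaBound`, which give absolute
convergence and non-vanishing for Re s large.

The two groups enter through `IsProper` only. For Spin(d,1) this rests on writing elements as
products of reflections (`exists_isLipschitz`) and on a positive definite form on the Clifford
algebra that makes the covering proper (`exists_invariant_form`).

The decompositions exist because M acts on Λ^p 𝔫 by unitary matrices. The identity passes to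
continuations by the identity theorem for meromorphic functions, and holds off a discrete set
because the values assigned at poles are arbitrary. -/

/-- The endomorphism `f` is diagonal with entries `δ` in some basis. -/
def HasEigenbasis {ι : Type*} {V : Type*} [AddCommGroup V] [Module ℂ V] (f : Module.End ℂ V)
    (δ : ι → ℂ) : Prop :=
  ∃ b : Basis ι ℂ V, ∀ i, f (b i) = δ i • b i

section Eigenbasis

variable {ι κ : Type*} {V W : Type*} [AddCommGroup V] [Module ℂ V] [AddCommGroup W] [Module ℂ W]
  {f : Module.End ℂ V} {g : Module.End ℂ W} {δ : ι → ℂ} {ε : κ → ℂ}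

theorem HasEigenbasis.tensor (hf : HasEigenbasis f δ) (hg : HasEigenbasis g ε) :
    HasEigenbasis (TensorProduct.map f g) (fun p : ι × κ => δ p.1 * ε p.2) := by
  obtain ⟨b, hb⟩ := hf
  obtain ⟨c, hc⟩ := hg
  refine ⟨b.tensorProduct c, fun p => ?_⟩
  rw [Basis.tensorProduct_apply', TensorProduct.map_tmul, hb, hc, TensorProduct.smul_tmul_smul]

theorem HasEigenbasis.conj (hf : HasEigenbasis f δ) (e : V ≃ₗ[ℂ] W)
    (h : ∀ v, e (f v) = g (e v)) : HasEigenbasis g δ := by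
  obtain ⟨b, hb⟩ := hf
  refine ⟨b.map e, fun i => ?_⟩
  rw [Basis.map_apply, ← h, hb, map_smul]

theorem HasEigenbasis.smul (hf : HasEigenbasis f δ) (c : ℂ) :
    HasEigenbasis (c • f) (fun i => c * δ i) := by
  obtain ⟨b, hb⟩ := hf
  exact ⟨b, fun i => by rw [LinearMap.smul_apply, hb, smul_smul]⟩

theorem HasEigenbasis.reindex (hf : HasEigenbasis f δ) (e : ι ≃ κ) :
    HasEigenbasis f (fun k => δ (e.symm k)) := by
  obtain ⟨b, hb⟩ := hf
  exact ⟨b.reindex e, fun i => by rw [Basis.reindex_apply, hb]⟩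

theorem HasEigenbasis.pi {J : Type*} [Fintype J] {ι : J → Type*} {V : J → Type*}
    [∀ j, AddCommGroup (V j)] [∀ j, Module ℂ (V j)] {f : ∀ j, Module.End ℂ (V j)}
    {δ : ∀ j, ι j → ℂ} (h : ∀ j, HasEigenbasis (f j) (δ j)) :
    HasEigenbasis (LinearMap.pi fun j => f j ∘ₗ LinearMap.proj j)
      (fun p : Σ j, ι j => δ p.1 p.2) := by
  classical
  choose b hb using h
  refine ⟨Pi.basis b, fun p => ?_⟩
  ext j
  rw [Pi.basis_apply]
  by_cases hj : j = p.1
  · subst hj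
    simp [hb]
  · simp [hj]

theorem HasEigenbasis.charpoly [FiniteDimensional ℂ V] [Fintype ι] (hf : HasEigenbasis f δ) :
    f.charpoly = ∏ i, (Polynomial.X - Polynomial.C (δ i)) := by
  classical
  obtain ⟨b, hb⟩ := hf
  have h : LinearMap.toMatrix b b f = Matrix.diagonal δ := by
    ext i j
    rw [LinearMap.toMatrix_apply, hb, map_smul, Basis.repr_self, Matrix.diagonal_apply]
    by_cases hij : i = j
    · subst hij; simp
    · simp [hij]
  rw [← LinearMap.charpoly_toMatrix f b, h, Matrix.charpoly_diagonal]

/-- The eigenvalues, with multiplicities, do not depend on the eigenbasis. -/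
theorem HasEigenbasis.prod_eq [Fintype ι] [Fintype κ] {ε : κ → ℂ} (hf : HasEigenbasis f δ)
    (hf' : HasEigenbasis f ε) {A : Type*} [CommMonoid A] (Q : ℂ → A) :
    ∏ i, Q (δ i) = ∏ k, Q (ε k) := by
  have : FiniteDimensional ℂ V := by
    obtain ⟨b, -⟩ := hf
    exact Module.Finite.of_basis b
  -- The multiset of eigenvalues is the multiset of roots of the characteristic polynomial.
  have h := hf.charpoly.symm.trans hf'.charpoly
  have h2 := congrArg Polynomial.roots h
  have e : ∀ {ι : Type _} [Fintype ι] (δ : ι → ℂ),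
      (∏ i, (Polynomial.X - Polynomial.C (δ i))).roots = Finset.univ.val.map δ := by
    intro ι _ δ
    rw [← Polynomial.roots_multiset_prod_X_sub_C (Finset.univ.val.map δ), Multiset.map_map]
    rfl
  -- `e` and `e'` serve the two index types, which may live in different universes.
  have e' : ∀ {ι : Type _} [Fintype ι] (δ : ι → ℂ),
      (∏ i, (Polynomial.X - Polynomial.C (δ i))).roots = Finset.univ.val.map δ := by
    intro ι _ δ
    rw [← Polynomial.roots_multiset_prod_X_sub_C (Finset.univ.val.map δ), Multiset.map_map]
    rfl
  rw [e, e'] at h2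
  have h3 := congrArg (fun s => (s.map Q).prod) h2
  simpa [Multiset.map_map] using h3

theorem HasEigenbasis.det_eq [Fintype ι] (hf : HasEigenbasis f δ) :
    LinearMap.det f = ∏ i, δ i := by
  classical
  obtain ⟨b, hb⟩ := hf
  have h : LinearMap.toMatrix b b f = Matrix.diagonal δ := by
    ext i j
    rw [LinearMap.toMatrix_apply, hb, map_smul, Basis.repr_self, Matrix.diagonal_apply]
    by_cases hij : i = j
    · subst hij; simp
    · simp [hij]
  rw [← LinearMap.det_toMatrix b, h, Matrix.det_diagonal]

/-- In the basis of tensors with the eigenvectors of g the operator is block diagonal, one block for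
each eigenvector. Only g has to be diagonalizable, so this applies to f = χ(γ) for arbitrary χ. -/
theorem det_id_sub_smul_map [FiniteDimensional ℂ V] [Fintype κ] (f : Module.End ℂ V)
    (hg : HasEigenbasis g ε) (z : ℂ) :
    LinearMap.det (LinearMap.id - z • TensorProduct.map f g) =
      ∏ k, LinearMap.det (LinearMap.id - (z * ε k) • f) := by
  classical
  obtain ⟨c, hc⟩ := hg
  set b := Module.finBasis ℂ V
  rw [← LinearMap.det_toMatrix (b.tensorProduct c)]
  have h : LinearMap.toMatrix (b.tensorProduct c) (b.tensorProduct c)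
      (LinearMap.id - z • TensorProduct.map f g) =
      Matrix.blockDiagonal fun k => LinearMap.toMatrix b b (LinearMap.id - (z * ε k) • f) := by
    ext ⟨i, k⟩ ⟨j, l⟩
    rw [LinearMap.toMatrix_apply, Matrix.blockDiagonal_apply, LinearMap.toMatrix_apply]
    simp only [LinearMap.sub_apply, LinearMap.smul_apply, LinearMap.id_apply,
      Basis.tensorProduct_apply', TensorProduct.map_tmul, hc, map_sub, map_smul,
      Finsupp.sub_apply, Finsupp.smul_apply, Basis.tensorProduct_repr_tmul_apply,
      TensorProduct.tmul_smul, Basis.repr_self, smul_eq_mul]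
    by_cases hkl : k = l
    · subst hkl
      simp; ring
    · simp [Finsupp.single_apply, hkl]
  rw [h, Matrix.det_blockDiagonal]
  exact Finset.prod_congr rfl fun k _ => LinearMap.det_toMatrix b _

/-- By multilinearity, a wedge product of eigenvectors is an eigenvector for the product of the
eigenvalues. -/
theorem HasEigenbasis.exteriorPower [LinearOrder ι] (hf : HasEigenbasis f δ) (p : ℕ) :
    HasEigenbasis (exteriorPower.map p f)
      (fun I : Set.powersetCard ι p => ∏ i ∈ (I : Finset ι), δ i) := by
  obtain ⟨b, hb⟩ := hf
  refine ⟨b.exteriorPower p, fun I => ?_⟩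
  rw [exteriorPower.basis_apply, exteriorPower.map_apply_ιMulti_family]
  have : (f ∘ b) = fun i => δ i • b i := funext hb
  rw [this]
  unfold exteriorPower.ιMulti_family
  have h2 := AlternatingMap.map_smul_univ (exteriorPower.ιMulti ℂ p (M := V))
    (δ ∘ Set.powersetCard.ofFinEmbEquiv.symm I) (b ∘ Set.powersetCard.ofFinEmbEquiv.symm I)
  refine Eq.trans h2 ?_
  congr 1
  simp only [Function.comp_apply, Set.powersetCard.ofFinEmbEquiv_symm_apply]
  rw [← Finset.prod_coe_sort (I : Finset ι)]
  exact Fintype.prod_equiv (Finset.orderIsoOfFin I.1 I.2).toEquiv _ _ fun i => rfl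

theorem symmetricAlgebra_basis_apply (b : Basis ι ℂ V) (α : ι →₀ ℕ) :
    b.symmetricAlgebra α = α.prod fun i k => SymmetricAlgebra.ι ℂ V (b i) ^ k := by
  rw [Basis.symmetricAlgebra, Basis.map_apply, MvPolynomial.coe_basisMonomials]
  change (SymmetricAlgebra.equivMvPolynomial b).symm (MvPolynomial.monomial α 1) = _
  rw [MvPolynomial.monomial_eq, Finsupp.prod]
  simp only [Finsupp.prod, map_prod, map_pow, SymmetricAlgebra.equivMvPolynomial_symm_X,
    map_one, one_mul]

theorem symPow_basis_mem (b : Basis ι ℂ V) (α : ι →₀ ℕ) :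
    α.prod (fun i k => SymmetricAlgebra.ι ℂ V (b i) ^ k) ∈
      LinearMap.range (SymmetricAlgebra.ι ℂ V) ^ α.degree := by
  rw [Finsupp.prod, Finsupp.degree_apply]
  generalize α.support = s
  classical
  induction s using Finset.induction_on with
  | empty => simp
  | insert a s ha ih =>
    rw [Finset.prod_insert ha, Finset.sum_insert ha, pow_add]
    exact Submodule.mul_mem_mul (Submodule.pow_mem_pow _ (LinearMap.mem_range_self _ (b a)) _) ih

end Eigenbasis

/-! ### Symmetric powers: monomial bases and eigenvalues -/

section SymPow

variable {ι : Type*} {V : Type} [AddCommGroup V] [Module ℂ V] {f : Module.End ℂ V} {δ : ι → ℂ}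

/-- The isomorphism with the polynomial ring sends V to linear forms, hence the k-th power of V into
the homogeneous polynomials of degree k. This is what makes the monomials of degree k span S^k V. -/
theorem symPow_repr_eq_zero (b : Basis ι ℂ V) (k : ℕ) (x : SymmetricAlgebra ℂ V)
    (hx : x ∈ symPow k V) (α : ι →₀ ℕ) (hα : α.degree ≠ k) : b.symmetricAlgebra.repr x α = 0 := by
  have h1 : (symPow k V).map (SymmetricAlgebra.equivMvPolynomial b).toLinearMap ≤
      MvPolynomial.homogeneousSubmodule ι ℂ k := by
    have : (SymmetricAlgebra.equivMvPolynomial b).toLinearMap =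
      ((SymmetricAlgebra.equivMvPolynomial b : _ →ₐ[ℂ] _) : _ →ₐ[ℂ] _).toLinearMap := rfl
    unfold symPow
    rw [this, Submodule.map_pow, ← MvPolynomial.homogeneousSubmodule_one_pow]
    refine pow_le_pow_left' ?_ k
    rw [MvPolynomial.homogeneousSubmodule_one_eq_span_X, ← LinearMap.range_comp,
      LinearMap.range_eq_map, ← b.span_eq, Submodule.map_span, Submodule.span_le]
    rintro _ ⟨_, ⟨i, rfl⟩, rfl⟩
    refine Submodule.subset_span ⟨i, ?_⟩
    simp
  have h2 := h1 ⟨x, hx, rfl⟩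
  rw [MvPolynomial.mem_homogeneousSubmodule] at h2
  exact h2.coeff_eq_zero hα

/-- The basis of `S^k V` of the monomials in the vectors of a basis of `V`. -/
def symPowBasis (b : Basis ι ℂ V) (k : ℕ) : Basis {α : ι →₀ ℕ // α.degree = k} ℂ (symPow k V) :=
  Basis.mk (v := fun α => ⟨b.symmetricAlgebra α.1, by
      rw [symmetricAlgebra_basis_apply, symPow]
      have := symPow_basis_mem b α.1
      rwa [α.2] at this⟩)
    (by
      refine LinearIndependent.of_comp (symPow k V).subtype ?_
      exact b.symmetricAlgebra.linearIndependent.comp _ Subtype.val_injective)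
    (by
      rintro y -
      refine (Submodule.map_le_map_iff_of_injective (symPow k V).injective_subtype ⊤ _).mp ?_
        (Submodule.mem_top)
      rintro _ ⟨⟨x, hx⟩, -, rfl⟩
      rw [Submodule.map_span]
      change x ∈ _
      rw [← b.symmetricAlgebra.linearCombination_repr x, Finsupp.linearCombination_apply]
      refine Submodule.sum_mem _ fun α hα => Submodule.smul_mem _ _ (Submodule.subset_span ?_)
      have : α.degree = k := by
        by_contra h
        exact (Finsupp.mem_support_iff.mp hα) (symPow_repr_eq_zero b k x hx α h)
      exact ⟨_, ⟨⟨α, this⟩, rfl⟩, rfl⟩)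

theorem HasEigenbasis.symPow (hf : HasEigenbasis f δ) (k : ℕ) :
    HasEigenbasis (symPowMap k f)
      (fun α : {α : ι →₀ ℕ // α.degree = k} => α.1.prod fun i m => δ i ^ m) := by
  obtain ⟨b, hb⟩ := hf
  refine ⟨symPowBasis b k, fun α => Subtype.ext ?_⟩
  rw [symPowBasis, Basis.mk_apply]
  change SymmetricAlgebra.lift (SymmetricAlgebra.ι ℂ V ∘ₗ f) (b.symmetricAlgebra α.1) =
    _ • b.symmetricAlgebra α.1
  rw [symmetricAlgebra_basis_apply]
  simp only [Finsupp.prod, map_prod, map_pow, SymmetricAlgebra.lift_ι_apply, LinearMap.comp_apply,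
    hb, map_smul]
  simp only [smul_pow, Finset.prod_smul]

end SymPow

/-! ### Isometries -/

section Isometry

variable {V : Type*} [NormedAddCommGroup V] [InnerProductSpace ℂ V] [FiniteDimensional ℂ V]

/-- The orthogonal complement of an invariant subspace p is a stable complement: by injectivity and
dimension f maps p onto p, so a vector of p has the form f v' with v' in p, and f preserves inner
products. -/
theorem isSemisimple_of_isometry (f : Module.End ℂ V) (hf : ∀ v, ‖f v‖ = ‖v‖) :
    f.IsSemisimple := by
  have hin : ∀ v w, inner ℂ (f v) (f w) = inner ℂ v w :=
    (LinearMap.norm_map_iff_inner_map_map f).mp hf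
  rw [Module.End.isSemisimple_iff]
  intro p hp
  refine ⟨pᗮ, ?_, Submodule.isCompl_orthogonal p⟩
  have hinj : Function.Injective f := by
    rw [← LinearMap.ker_eq_bot, LinearMap.ker_eq_bot']
    intro v hv
    rw [← norm_eq_zero, ← hf, hv, norm_zero]
  have hmap : p.map f = p := by
    refine Submodule.eq_of_le_of_finrank_eq (Submodule.map_le_iff_le_comap.mpr hp) ?_
    exact (Submodule.equivMapOfInjective f hinj p).finrank_eq.symm
  intro w hw
  rw [Submodule.mem_comap, Submodule.mem_orthogonal]
  intro v hv
  rw [← hmap] at hv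
  obtain ⟨v', hv', rfl⟩ := hv
  rw [hin]
  exact (Submodule.mem_orthogonal _ _).mp hw v' hv'

/-- For a semisimple operator over ℂ the generalized eigenspaces are eigenspaces, so the
eigenvectors span and a basis can be extracted from them. -/
theorem exists_eigenbasis_of_isometry (f : Module.End ℂ V) (hf : ∀ v, ‖f v‖ = ‖v‖) :
    ∃ δ : Fin (finrank ℂ V) → ℂ, HasEigenbasis f δ ∧ ∀ i, ‖δ i‖ = 1 := by
  have hs := isSemisimple_of_isometry f hf
  have htop : ⨆ μ, f.eigenspace μ = ⊤ := by
    have := Module.End.iSup_maxGenEigenspace_eq_top f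
    rwa [hs.iSup_maxGenEigenspace_eq_top_iff] at this
  have hspan : ⊤ ≤ Submodule.span ℂ {v | ∃ μ : ℂ, f v = μ • v} := by
    rw [← htop, iSup_le_iff]
    intro μ v hv
    exact Submodule.subset_span ⟨μ, Module.End.mem_eigenspace_iff.mp hv⟩
  let b := Basis.ofSpan hspan
  have hb : ∀ i, ∃ μ : ℂ, f (b i) = μ • b i := fun i => Basis.ofSpan_subset hspan ⟨i, rfl⟩
  let b' := b.reindex (b.indexEquiv (Module.finBasis ℂ V))
  have hb' : ∀ i, ∃ μ : ℂ, f (b' i) = μ • b' i := fun i => by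
    simp only [b', Basis.reindex_apply]; exact hb _
  choose δ hδ using hb'
  refine ⟨δ, ⟨b', hδ⟩, fun i => ?_⟩
  have h := hf (b' i)
  rw [hδ, norm_smul] at h
  have h0 : ‖b' i‖ ≠ 0 := norm_ne_zero_iff.mpr (b'.ne_zero i)
  exact mul_right_cancel₀ h0 (by rw [h, one_mul])

end Isometry

/-! ### The root spaces in coordinates -/

/-- The coordinates orthogonal to the plane of the one-parameter group `exp (t H)`. -/
abbrev Mid (n : ℕ) : Type := {i : Idx n // i ≠ 0 ∧ i ≠ Idx.top n}

theorem card_Mid (n : ℕ) : Fintype.card (Mid n) = 2 * n := by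
  have h := top_ne_zero n
  rw [Fintype.card_subtype]
  have : (Finset.univ.filter fun i : Idx n => i ≠ 0 ∧ i ≠ Idx.top n) =
      (Finset.univ.erase 0).erase (Idx.top n) := by
    ext i; simp [and_comm]
  rw [this, Finset.card_erase_of_mem (by simp [h]), Finset.card_erase_of_mem (by simp)]
  simp

theorem so_entry {n : ℕ} {X : Matrix (Idx n) (Idx n) ℝ} (hX : X ∈ so n) (i j : Idx n) :
    sgn n j * X j i + sgn n i * X i j = 0 := by
  have h : Xᵀ * eta n + eta n * X = 0 := hX
  have := congrFun (congrFun h i) j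
  rw [eta, Matrix.add_apply, Matrix.mul_diagonal, Matrix.diagonal_mul, Matrix.transpose_apply] at this
  simpa [mul_comm] using this

theorem H_mul_apply (n : ℕ) (X : Matrix (Idx n) (Idx n) ℝ) (i j : Idx n) :
    (H n * X) i j = (if i = 0 then X (Idx.top n) j else 0) + (if i = Idx.top n then X 0 j else 0) := by
  rw [H, add_mul, Matrix.add_apply]
  by_cases h1 : i = 0 <;> by_cases h2 : i = Idx.top n <;> simp [h1, h2, (top_ne_zero n).symm,
    Matrix.single_mul_apply_of_ne, top_ne_zero n]

theorem mul_H_apply (n : ℕ) (X : Matrix (Idx n) (Idx n) ℝ) (i j : Idx n) :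
    (X * H n) i j = (if j = 0 then X i (Idx.top n) else 0) + (if j = Idx.top n then X i 0 else 0) := by
  have := congrFun (congrFun (congrArg Matrix.transpose (Matrix.transpose_mul X (H n))) i) j
  rw [Matrix.transpose_transpose, H_transpose, Matrix.transpose_apply, H_mul_apply] at this
  exact this

theorem rootSpace_entry {n : ℕ} {c : ℝ} {X : Matrix (Idx n) (Idx n) ℝ} (hX : X ∈ rootSpace n c)
    (i j : Idx n) :
    (if i = 0 then X (Idx.top n) j else 0) + (if i = Idx.top n then X 0 j else 0) -
      ((if j = 0 then X i (Idx.top n) else 0) + (if j = Idx.top n then X i 0 else 0)) = c * X i j := by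
  have := congrFun (congrFun hX.2 i) j
  rwa [Matrix.sub_apply, H_mul_apply, mul_H_apply, Matrix.smul_apply, smul_eq_mul] at this

/-- Extension by zero of a vector in the middle coordinates. -/
def extMid {n : ℕ} (v : Mid n → ℝ) (i : Idx n) : ℝ :=
  if h : i ≠ 0 ∧ i ≠ Idx.top n then v ⟨i, h⟩ else 0

/-- The element of a root space with given first column. -/
def rootMat {n : ℕ} (c : ℝ) (v : Mid n → ℝ) : Matrix (Idx n) (Idx n) ℝ := fun i j =>
  (if j = 0 then extMid v i else 0) - (if j = Idx.top n then c * extMid v i else 0) +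
    (if i = 0 then extMid v j else 0) + (if i = Idx.top n then c * extMid v j else 0)

@[simp] theorem extMid_zero {n : ℕ} (v : Mid n → ℝ) : extMid v 0 = 0 := by simp [extMid]

@[simp] theorem extMid_top {n : ℕ} (v : Mid n → ℝ) : extMid v (Idx.top n) = 0 := by simp [extMid]

@[simp] theorem extMid_mid {n : ℕ} (v : Mid n → ℝ) (i : Mid n) : extMid v i = v i := by
  simp [extMid, i.2]

theorem idx_cases {n : ℕ} (i : Idx n) : i = 0 ∨ i = Idx.top n ∨ (i ≠ 0 ∧ i ≠ Idx.top n) := by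
  tauto

theorem rootMat_mem {n : ℕ} {c : ℝ} (hc : c * c = 1) (v : Mid n → ℝ) :
    rootMat c v ∈ rootSpace n c := by
  have h := top_ne_zero n
  refine ⟨?_, ?_⟩
  · change (rootMat c v)ᵀ * eta n + eta n * rootMat c v = 0
    ext i j
    rw [eta, Matrix.add_apply, Matrix.mul_diagonal, Matrix.diagonal_mul, Matrix.transpose_apply]
    rcases idx_cases i with rfl | rfl | hi <;> rcases idx_cases j with rfl | rfl | hj <;>
      simp [rootMat, sgn, h.symm, *]
  · ext i j
    rw [Matrix.sub_apply, H_mul_apply, mul_H_apply, Matrix.smul_apply, smul_eq_mul]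
    rcases idx_cases i with rfl | rfl | hi <;> rcases idx_cases j with rfl | rfl | hj <;>
      simp [rootMat, h.symm, *] <;> rw [← mul_assoc, hc, one_mul]

/-- Skewness kills the diagonal. The relation [H, X] = cX with c ≠ 0 kills the middle block and the
(d,0) entry, and expresses the last column by the first; skewness then gives the two remaining rows.
The condition c² = 1 treats 𝔫 and 𝔫̄ together. -/
theorem eq_rootMat {n : ℕ} {c : ℝ} (hc : c * c = 1) {X : Matrix (Idx n) (Idx n) ℝ}
    (hX : X ∈ rootSpace n c) : X = rootMat c fun i => X i 0 := by
  have h := top_ne_zero n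
  have hc0 : c ≠ 0 := by rintro rfl; simp at hc
  have hso := so_entry hX.1
  have hr := rootSpace_entry hX
  have hdiag : ∀ i, X i i = 0 := by
    intro i
    have := hso i i
    have hs : sgn n i ≠ 0 := by unfold sgn; split_ifs <;> norm_num
    have h2 : sgn n i * X i i = 0 := by linarith
    exact (mul_eq_zero.mp h2).resolve_left hs
  have ht0 : X (Idx.top n) 0 = 0 := by
    have := hr (Idx.top n) 0
    simp [h, h.symm, hdiag] at this
    tauto
  have h0t : X 0 (Idx.top n) = 0 := by
    have := hso 0 (Idx.top n)
    simp [sgn, h, ht0] at this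
    exact this
  have key : ∀ i, i ≠ 0 ∧ i ≠ Idx.top n → X i (Idx.top n) = -(c * X i 0) ∧ X 0 i = X i 0 ∧
      X (Idx.top n) i = c * X i 0 := by
    intro i hi
    have h1 := hr i 0
    have h2 := hso i 0
    have h3 := hso i (Idx.top n)
    simp [sgn, h, h.symm, hi.1, hi.2] at h1 h2 h3
    refine ⟨by linarith, by linarith, by linarith⟩
  have hmm : ∀ i, i ≠ 0 ∧ i ≠ Idx.top n → ∀ j, j ≠ 0 ∧ j ≠ Idx.top n → X i j = 0 := by
    intro i hi j hj
    have := hr i j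
    simp [hi.1, hi.2, hj.1, hj.2] at this
    tauto
  ext i j
  rcases idx_cases i with rfl | rfl | hi <;> rcases idx_cases j with rfl | rfl | hj
  · simp [rootMat, hdiag, h.symm]
  · simp [rootMat, h0t, h, h.symm]
  · simp [rootMat, extMid, h.symm, hj, key j hj]
  · simp [rootMat, ht0, h, h.symm]
  · simp [rootMat, hdiag, h]
  · simp [rootMat, extMid, h, hj, key j hj]
  · simp [rootMat, extMid, h.symm, hi]
  · simp [rootMat, extMid, h, hi, key i hi]
  · simp [rootMat, hmm i hi j hj, hi, hj]

/-- A root space is parametrized by the first columns of its elements. -/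
def rootEquiv (n : ℕ) {c : ℝ} (hc : c * c = 1) : rootSpace n c ≃ₗ[ℝ] (Mid n → ℝ) where
  toFun X i := X.1 i 0
  map_add' _ _ := rfl
  map_smul' _ _ := rfl
  invFun v := ⟨rootMat c v, rootMat_mem hc v⟩
  left_inv X := Subtype.ext (eq_rootMat hc X.2).symm
  right_inv v := by
    ext i
    simp [rootMat, (top_ne_zero n).symm, i.2]

theorem finrank_nPos (n : ℕ) : Module.finrank ℝ (nPos n) = 2 * n := by
  rw [(rootEquiv n (c := 1) (by norm_num)).finrank_eq, Module.finrank_fintype_fun_eq_card, card_Mid]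

theorem rho_eq (n : ℕ) : rho n = n := by
  rw [rho, finrank_nPos]; push_cast; ring

/-! ### The action of `MA` on the root spaces in coordinates -/

namespace HypGroup

variable {n : ℕ} (L : HypGroup n)

/-- The action of an element of `M` on the middle coordinates. -/
def mid (m : L.M) : Matrix (Mid n) (Mid n) ℝ := (L.cov m).submatrix Subtype.val Subtype.val

theorem cov_M_mulVec_zero (m : L.M) : L.cov m *ᵥ Pi.single 0 1 = Pi.single 0 1 := m.2.1

theorem H_mulVec_zero : H n *ᵥ Pi.single 0 1 = Pi.single (Idx.top n) 1 := by
  ext i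
  simp [H, Matrix.single_apply, Pi.single_apply, top_ne_zero n, eq_comm]

/-- An element of M fixes e_0 and commutes with H, hence fixes e_d = H e_0. With the isometry
relation this leaves only an orthogonal block on the middle coordinates. -/
theorem cov_M_mulVec_top (m : L.M) :
    L.cov m *ᵥ Pi.single (Idx.top n) 1 = Pi.single (Idx.top n) 1 := by
  rw [← H_mulVec_zero, Matrix.mulVec_mulVec, L.commute_of_mem_M m, ← Matrix.mulVec_mulVec,
    cov_M_mulVec_zero]

theorem cov_M_col_zero (m : L.M) (i : Idx n) : L.cov m i 0 = if i = 0 then 1 else 0 := by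
  have := congrFun (L.cov_M_mulVec_zero m) i
  simpa [Pi.single_apply] using this

theorem cov_M_col_top (m : L.M) (i : Idx n) :
    L.cov m i (Idx.top n) = if i = Idx.top n then 1 else 0 := by
  have := congrFun (L.cov_M_mulVec_top m) i
  simpa [Pi.single_apply] using this

theorem isometry_entry (g : L.G) (i j : Idx n) :
    ∑ k, sgn n k * L.cov g k i * L.cov g k j = if i = j then sgn n i else 0 := by
  have := congrFun (congrFun (L.cov_isometry g) i) j
  rw [Matrix.mul_apply] at this
  rw [eta] at this
  simp only [Matrix.mul_diagonal, Matrix.transpose_apply, Matrix.diagonal_apply] at this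
  rw [← this]
  exact Finset.sum_congr rfl fun k _ => by ring

theorem cov_M_row_zero (m : L.M) (j : Idx n) : L.cov m 0 j = if j = 0 then 1 else 0 := by
  have := L.isometry_entry m 0 j
  simp only [cov_M_col_zero] at this
  simpa [sgn, eq_comm] using this

theorem cov_M_row_top (m : L.M) (j : Idx n) :
    L.cov m (Idx.top n) j = if j = Idx.top n then 1 else 0 := by
  have := L.isometry_entry m (Idx.top n) j
  simp only [cov_M_col_top] at this
  simp [sgn, eq_comm] at this
  split_ifs at this ⊢ <;> linarith

theorem sum_idx (f : Idx n → ℝ) :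
    ∑ k, f k = f 0 + f (Idx.top n) + ∑ k : Mid n, f k := by
  have h := top_ne_zero n
  rw [← Finset.add_sum_erase _ _ (Finset.mem_univ (0 : Idx n)),
    ← Finset.add_sum_erase _ _ (Finset.mem_erase.mpr ⟨h, Finset.mem_univ (Idx.top n)⟩), ← add_assoc]
  congr 1
  refine (Finset.sum_subtype _ (fun i => ?_) f)
  simp [and_comm]

theorem mid_transpose_mul (m : L.M) : (L.mid m)ᵀ * L.mid m = 1 := by
  ext i j
  have := L.isometry_entry m i j
  rw [sum_idx] at this
  simp only [cov_M_row_zero, cov_M_row_top, i.2.1, i.2.2, if_false, mul_zero, zero_mul,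
    zero_add] at this
  rw [Matrix.mul_apply, Matrix.one_apply]
  have e : ∀ k : Mid n, sgn n k = -1 := fun k => by simp [sgn, k.2.1]
  simp only [e] at this
  simp only [mid, Matrix.transpose_apply, Matrix.submatrix_apply]
  have h2 : ∑ k : Mid n, L.cov m k i * L.cov m k j = - ∑ k : Mid n, -1 * L.cov m k i * L.cov m k j := by
    rw [← Finset.sum_neg_distrib]
    exact Finset.sum_congr rfl fun k _ => by ring
  rw [h2, this]
  by_cases hij : i = j
  · subst hij; simp
  · have : (i : Idx n) ≠ j := fun h => hij (Subtype.ext h)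
    simp [hij, this]

theorem det_mid (m : L.M) : (L.mid m).det = (L.cov m).det := by
  have h := top_ne_zero n
  rw [(L.cov m).twoBlockTriangular_det (fun i => i ≠ 0 ∧ i ≠ Idx.top n)]
  · have h1 : ((L.cov m).toSquareBlockProp fun i => ¬(i ≠ 0 ∧ i ≠ Idx.top n)) = 1 := by
      ext i j
      rw [Matrix.one_apply]
      obtain ⟨i, hi⟩ := i
      obtain ⟨j, hj⟩ := j
      have hi' : i = 0 ∨ i = Idx.top n := by tauto
      simp only [Matrix.toSquareBlockProp_def, Matrix.of_apply, Subtype.mk.injEq]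
      rcases hi' with rfl | rfl
      · rw [cov_M_row_zero]; simp [eq_comm]
      · rw [cov_M_row_top]; simp [eq_comm]
    rw [h1, Matrix.det_one, mul_one]
    rfl
  · intro i hi j hj
    have hi' : i = 0 ∨ i = Idx.top n := by tauto
    rcases hi' with rfl | rfl
    · rw [cov_M_row_zero, if_neg hj.1]
    · rw [cov_M_row_top, if_neg hj.2]

theorem cov_inv_MA (m : L.M) (t : ℝ) :
    L.cov (m * L.flow t)⁻¹ = boost n (-t) * L.cov ((m⁻¹ : L.M) : L.G) := by
  have h1 : L.cov (m * L.flow t) * (boost n (-t) * L.cov ((m⁻¹ : L.M) : L.G)) = 1 := by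
    rw [map_mul, L.cov_flow, mul_assoc, ← mul_assoc (boost n t), ← boost_add, add_neg_cancel]
    have : boost n 0 = 1 := by simp [boost]
    rw [this, one_mul, ← map_mul, Subgroup.coe_inv, mul_inv_cancel, map_one]
  have h2 := L.cov_inv_mul (m * L.flow t)
  calc _ = L.cov (m * L.flow t)⁻¹ * (L.cov (m * L.flow t) * (boost n (-t) * L.cov ((m⁻¹ : L.M) : L.G))) := by
        rw [h1, mul_one]
    _ = _ := by rw [← mul_assoc, h2, one_mul]

/-- Since an element of the root space is determined by its value at e_0, it suffices to evaluate
there. m⁻¹ fixes e_0, exp(-tH) e_0 = cosh t e_0 - sinh t e_d, and X e_d = -c X e_0; the scalar is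
therefore cosh t + c sinh t = e^{ct}. The vector X e_0 lies in the middle coordinates, where exp(tH)
is trivial and m acts by its block. -/
theorem rootEquiv_Ad {c : ℝ} (hc : c = 1 ∨ c = -1) (hc' : c * c = 1) (m : L.M) (t : ℝ)
    (X : rootSpace n c) :
    rootEquiv n hc' (L.Ad m t c X) = Real.exp (c * t) • (L.mid m *ᵥ rootEquiv n hc' X) := by
  have h := top_ne_zero n
  set v := rootEquiv n hc' X with hv
  have hX : X.1 = rootMat c v := eq_rootMat hc' X.2
  have hX0 : X.1 *ᵥ Pi.single 0 1 = extMid v := by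
    ext i
    rw [hX]
    rcases idx_cases i with rfl | rfl | hi <;> simp [rootMat, h.symm, *]
  have hXt : X.1 *ᵥ Pi.single (Idx.top n) 1 = -c • extMid v := by
    ext i
    rw [hX]
    rcases idx_cases i with rfl | rfl | hi <;> simp [rootMat, h.symm, *]
  have hexp : Real.cosh t + c * Real.sinh t = Real.exp (c * t) := by
    rcases hc with rfl | rfl
    · simp
    · rw [neg_one_mul, neg_one_mul, ← sub_eq_add_neg, Real.cosh_sub_sinh]
  have hcol : (L.Ad m t c X).1 *ᵥ Pi.single 0 1 = Real.exp (c * t) • (L.cov m *ᵥ extMid v) := by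
    change (L.cov (m * L.flow t) * X.1 * L.cov (m * L.flow t)⁻¹) *ᵥ Pi.single 0 1 = _
    have hboost : boost n (-t) *ᵥ Pi.single 0 1 =
        Real.cosh t • Pi.single 0 1 + -Real.sinh t • Pi.single (Idx.top n) 1 := by
      rw [boost_apply_mulVec]
      simp only [Pi.single_eq_same, Pi.single_eq_of_ne h, Real.sinh_neg, Real.cosh_neg]
      module
    have hfix : boost n t *ᵥ extMid v = extMid v := by
      rw [boost_apply_mulVec]
      simp
    rw [cov_inv_MA, map_mul, L.cov_flow]
    simp only [← Matrix.mulVec_mulVec]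
    rw [cov_M_mulVec_zero, hboost, Matrix.mulVec_add, Matrix.mulVec_smul, Matrix.mulVec_smul, hX0,
      hXt, smul_smul, ← add_smul, neg_mul_neg, mul_comm (Real.sinh t) c, hexp, Matrix.mulVec_smul,
      hfix, Matrix.mulVec_smul]
  ext i
  have h1 := congrFun hcol i
  rw [Matrix.mulVec_single_one] at h1
  refine Eq.trans h1 ?_
  simp only [Pi.smul_apply, Matrix.mulVec, dotProduct, sum_idx, extMid_zero, extMid_top, extMid_mid,
    mul_zero, zero_add]
  rfl

/-- The basis of a complexified root space given by the middle coordinates. -/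
def rootBasisC (n : ℕ) {c : ℝ} (hc : c * c = 1) : Basis (Mid n) ℂ (ℂ ⊗[ℝ] rootSpace n c) :=
  Algebra.TensorProduct.basis ℂ (Basis.ofEquivFun (rootEquiv n hc))

theorem toMatrix_AdC {c : ℝ} (hc : c = 1 ∨ c = -1) (hc' : c * c = 1) (m : L.M) (t : ℝ) :
    LinearMap.toMatrix (rootBasisC n hc') (rootBasisC n hc') (L.AdC m t c) =
      (Real.exp (c * t) : ℂ) • (L.mid m).map Complex.ofReal := by
  rw [rootBasisC, AdC, LinearMap.toMatrix_baseChange]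
  ext i j
  rw [Matrix.map_apply, LinearMap.toMatrix_apply, Basis.ofEquivFun_repr_apply, L.rootEquiv_Ad hc hc']
  have : rootEquiv n hc' (Basis.ofEquivFun (rootEquiv n hc') j) = Pi.single j 1 := by
    rw [Basis.coe_ofEquivFun, LinearEquiv.apply_symm_apply]
  rw [this]
  simp

end HypGroup

/-! ### Eigenvalues of orthogonal matrices -/

section Orthogonal

variable {κ : Type*} [Fintype κ] [DecidableEq κ]

theorem norm_toEuclideanLin {A : Matrix κ κ ℂ} (hA : Aᴴ * A = 1) (v : EuclideanSpace ℂ κ) :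
    ‖Matrix.toEuclideanLin A v‖ = ‖v‖ := by
  revert v
  refine (LinearMap.norm_map_iff_inner_map_map _).mpr fun v w => ?_
  rw [← LinearMap.adjoint_inner_right, ← Matrix.toEuclideanLin_conjTranspose_eq_adjoint,
    Matrix.toLpLin_apply, Matrix.toLpLin_apply, Matrix.mulVec_mulVec, hA, Matrix.one_mulVec]

theorem exists_eigenbasis_of_conjTranspose_mul (A : Matrix κ κ ℂ) (hA : Aᴴ * A = 1) :
    ∃ δ : κ → ℂ, HasEigenbasis (Matrix.toLin' A) δ ∧ ∀ i, ‖δ i‖ = 1 := by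
  obtain ⟨δ, hδ, hn⟩ := exists_eigenbasis_of_isometry _ (norm_toEuclideanLin hA)
  have e : Fin (finrank ℂ (EuclideanSpace ℂ κ)) ≃ κ :=
    Fintype.equivOfCardEq (by rw [Fintype.card_fin, finrank_euclideanSpace])
  refine ⟨fun k => δ (e.symm k), ?_, fun i => hn _⟩
  exact (hδ.reindex e).conj (WithLp.linearEquiv 2 ℂ (κ → ℂ)) fun v => rfl

/-- Complex conjugation is a semilinear bijection commuting with a real matrix, so the conjugates of
the eigenvectors form an eigenbasis again. -/
theorem HasEigenbasis.conj_of_real {A : Matrix κ κ ℝ} {δ : κ → ℂ}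
    (h : HasEigenbasis (Matrix.toLin' (A.map Complex.ofReal)) δ) :
    HasEigenbasis (Matrix.toLin' (A.map Complex.ofReal)) fun i => starRingEnd ℂ (δ i) := by
  obtain ⟨b, hb⟩ := h
  have hli : LinearIndependent ℂ fun i => (star (b i) : κ → ℂ) := by
    have := b.linearIndependent.map_of_injective_injective (R' := ℂ) (M' := κ → ℂ) (starRingEnd ℂ)
      (starAddEquiv (R := κ → ℂ)).toAddMonoidHom
      (fun r hr => by simpa using hr) (fun r hr => by simpa using hr) (fun r m => by
        change star (star r • m) = r • star m
        rw [star_smul, star_star])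
    exact this
  let c := basisOfLinearIndependentOfCardEqFinrank' _ hli (by simp)
  refine ⟨c, fun i => ?_⟩
  simp only [c, coe_basisOfLinearIndependentOfCardEqFinrank']
  have h1 := congrArg star (hb i)
  rw [star_smul] at h1
  refine Eq.trans ?_ h1
  rw [Matrix.toLin'_apply, Matrix.toLin'_apply, Matrix.star_mulVec, ← Matrix.mulVec_transpose]
  congr 1
  ext i j
  simp

end Orthogonal

theorem HasEigenbasis.of_toMatrix {κ V : Type*} [Fintype κ] [DecidableEq κ] [AddCommGroup V]
    [Module ℂ V] {f : Module.End ℂ V} (b : Basis κ ℂ V) {δ : κ → ℂ}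
    (h : HasEigenbasis (Matrix.toLin' (LinearMap.toMatrix b b f)) δ) : HasEigenbasis f δ := by
  refine h.conj b.equivFun.symm fun v => ?_
  apply b.equivFun.injective
  rw [LinearEquiv.apply_symm_apply, Matrix.toLin'_apply]
  have := LinearMap.toMatrix_mulVec_repr b b f (b.equivFun.symm v)
  rw [Basis.equivFun_apply, ← this, ← Basis.equivFun_apply, LinearEquiv.apply_symm_apply]

/-! ### Eigenvalues of MA on the two root spaces -/

namespace HypGroup

variable {n : ℕ} (L : HypGroup n)

/-- The eigenvalues of `Ad(m exp(tH))` on the root spaces. -/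
theorem exists_eigenvalues_AdC (m : L.M) (t : ℝ) (hdet : (L.cov m).det = 1) :
    ∃ ω : Mid n → ℂ, (∀ i, ‖ω i‖ = 1) ∧ ∏ i, ω i = 1 ∧
      HasEigenbasis (L.AdC m t (-1)) (fun i => Real.exp (-t) * ω i) ∧
      HasEigenbasis (L.AdC m t 1) (fun i => (Real.exp (-t) * ω i)⁻¹) := by
  have hA : ((L.mid m).map Complex.ofReal)ᴴ * (L.mid m).map Complex.ofReal = 1 := by
    have h1 : ((L.mid m).map Complex.ofReal)ᴴ = ((L.mid m)ᵀ).map Complex.ofReal := by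
      ext i j; simp
    have h2 := congrArg (fun B : Matrix (Mid n) (Mid n) ℝ => B.map Complex.ofRealHom)
      (L.mid_transpose_mul m)
    simp only [Matrix.map_mul] at h2
    rw [h1]
    refine Eq.trans h2 ?_
    ext i j; simp [Matrix.one_apply]
  obtain ⟨ω, hω, hn⟩ := exists_eigenbasis_of_conjTranspose_mul _ hA
  have hs : ∀ c : ℂ, Matrix.toLin' (c • (L.mid m).map Complex.ofReal) =
    c • Matrix.toLin' ((L.mid m).map Complex.ofReal) := fun c => map_smul _ _ _
  refine ⟨ω, hn, ?_, ?_, ?_⟩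
  · rw [← hω.det_eq, LinearMap.det_toLin']
    have := RingHom.map_det Complex.ofRealHom (L.mid m)
    rw [det_mid, hdet, map_one] at this
    exact this.symm
  · refine HasEigenbasis.of_toMatrix (rootBasisC n (c := -1) (by norm_num)) ?_
    rw [L.toMatrix_AdC (Or.inr rfl), hs, neg_one_mul]
    exact hω.smul _
  · refine HasEigenbasis.of_toMatrix (rootBasisC n (c := 1) (by norm_num)) ?_
    rw [L.toMatrix_AdC (Or.inl rfl), hs, one_mul]
    -- On 𝔫 the conjugate eigenbasis is used: |ω i| = 1 makes the conjugate of ω i its inverse, so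
    -- with the same index set the eigenvalues on 𝔫 are the inverses of those on 𝔫̄.
    have h2 : (fun i => ((Real.exp (-t) : ℂ) * ω i)⁻¹) =
        fun i => (Real.exp t : ℂ) * starRingEnd ℂ (ω i) := by
      funext i
      rw [mul_inv, ← Complex.inv_eq_conj (hn i), Real.exp_neg]
      simp
    rw [h2]
    exact hω.conj_of_real.smul _

end HypGroup

/-! ### Discrete subgroups of groups of units of a topological ring -/

/-- If S were infinite, the pairs (γ, γ⁻¹) would accumulate at some (a, b) of the compact set K × K,
with ba = 1. Two distinct γ, γ' with pairs close to (a, b) then have γ⁻¹γ' close to 1, against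
discreteness. The inverses are bounded separately because the ambient 𝒜 is only a monoid. -/
theorem finite_of_discrete_of_isCompact {𝒜 : Type*} [Monoid 𝒜] [TopologicalSpace 𝒜]
    [ContinuousMul 𝒜] [T1Space 𝒜] {G : Type*} [Group G] [TopologicalSpace G] (j : G →* 𝒜)
    (hj : Topology.IsInducing j) (Γ : Subgroup G) [DiscreteTopology Γ] (K : Set 𝒜)
    (hK : IsCompact K) (S : Set Γ) (hS : ∀ γ ∈ S, j γ ∈ K ∧ j (γ : G)⁻¹ ∈ K) : S.Finite := by
  by_contra hinf
  have hne : (Filter.cofinite ⊓ Filter.principal S).NeBot := by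
    rw [Filter.cofinite_inf_principal_neBot_iff]
    exact hinf
  let Φ : Γ → 𝒜 × 𝒜 := fun γ => (j γ, j (γ : G)⁻¹)
  have hle : Filter.map Φ (Filter.cofinite ⊓ Filter.principal S) ≤ Filter.principal (K ×ˢ K) := by
    rw [Filter.le_principal_iff, Filter.mem_map]
    exact Filter.mem_inf_of_right fun γ hγ => hS γ hγ
  obtain ⟨⟨a, b⟩, -, hab⟩ := (hK.prod hK).exists_clusterPt hle
  have hfreq : ∀ N ∈ nhds (a, b), ∃ᶠ γ in Filter.cofinite ⊓ Filter.principal S, Φ γ ∈ N :=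
    fun N hN => Filter.frequently_map.mp (hab.frequently hN)
  have hba : b * a = 1 := by
    have hcl : IsClosed {p : 𝒜 × 𝒜 | p.2 * p.1 = 1} :=
      isClosed_singleton.preimage (continuous_snd.mul continuous_fst)
    have := isClosed_iff_clusterPt.mp hcl (a, b) (hab.mono ?_)
    · exact this
    · rw [Filter.le_principal_iff, Filter.mem_map]
      refine Filter.univ_mem' fun γ => ?_
      change j (γ : G)⁻¹ * j γ = 1
      rw [← map_mul, inv_mul_cancel, map_one]
  obtain ⟨U, hU, hU1⟩ : ∃ U ∈ nhds (1 : 𝒜), ∀ γ : Γ, j γ ∈ U → γ = 1 := by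
    have h1 : IsOpen ({1} : Set Γ) := isOpen_discrete _
    rw [isOpen_induced_iff] at h1
    obtain ⟨V, hV, hV1⟩ := h1
    rw [hj.isOpen_iff] at hV
    obtain ⟨U, hU, rfl⟩ := hV
    refine ⟨U, hU.mem_nhds ?_, fun γ hγ => ?_⟩
    · have : (1 : Γ) ∈ Subtype.val ⁻¹' (j ⁻¹' U) := by rw [hV1]; rfl
      simpa using this
    · have : γ ∈ Subtype.val ⁻¹' (j ⁻¹' U) := hγ
      rw [hV1] at this
      exact this
  have hcont : Filter.Tendsto (fun p : 𝒜 × 𝒜 => p.1 * p.2) (nhds b ×ˢ nhds a) (nhds 1) := by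
    rw [← nhds_prod_eq, ← hba]
    exact continuous_mul.tendsto (b, a)
  obtain ⟨Nb, hNb, Na, hNa, hN⟩ := Filter.mem_prod_iff.mp (hcont hU)
  have hfr := hfreq (Na ×ˢ Nb) (prod_mem_nhds hNa hNb)
  obtain ⟨γ, hγ⟩ := hfr.exists
  have hco : ∀ᶠ γ' in Filter.cofinite ⊓ Filter.principal S, γ' ≠ γ := by
    refine Filter.Eventually.filter_mono inf_le_left ?_
    exact (Set.finite_singleton γ).compl_mem_cofinite
  obtain ⟨γ', h1, h2⟩ := (hfr.and_eventually hco).exists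
  have h3 : j ((γ : G)⁻¹ * γ') ∈ U := by
    rw [map_mul]
    exact hN (Set.mk_mem_prod hγ.2 h1.1)
  have h4 := hU1 (γ⁻¹ * γ') h3
  exact h2 (by rw [inv_mul_eq_one] at h4; exact h4.symm)

/-! ### The properties of `G` that are used -/

/-- The properties of the groups `Spin(d,1)` and `SO⁰(d,1)` on which the zeta functions depend. -/
structure HypGroup.IsProper {n : ℕ} (L : HypGroup n) : Prop where
  det_cov : ∀ g, (L.cov g).det = 1
  mulVec_mem : ∀ g, ∀ x ∈ hyperboloid n, L.cov g *ᵥ x ∈ hyperboloid n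
  transitive : ∀ x ∈ hyperboloid n, ∃ g, L.cov g *ᵥ basePt n = x
  continuous_cov : Continuous L.cov
  finite : ∀ Γ : Subgroup L.G, DiscreteTopology Γ → ∀ C : ℝ, {γ : Γ | L.cov γ 0 0 ≤ C}.Finite

theorem form_eq (n : ℕ) (x y : Idx n → ℝ) :
    form n x y = x 0 * y 0 - ∑ i ∈ Finset.univ.erase 0, x i * y i := by
  simp only [form, dotProduct, eta, Matrix.mulVec_diagonal]
  rw [← Finset.add_sum_erase _ _ (Finset.mem_univ (0 : Idx n)), sub_eq_add_neg,
    ← Finset.sum_neg_distrib]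
  congr 1
  · simp [sgn]
  · refine Finset.sum_congr rfl fun i hi => ?_
    simp [sgn, Finset.ne_of_mem_erase hi]

theorem form_comm (n : ℕ) (x y : Idx n → ℝ) : form n x y = form n y x := by
  simp only [form_eq, mul_comm]

theorem form_add_left (n : ℕ) (x y z : Idx n → ℝ) :
    form n (x + y) z = form n x z + form n y z := add_dotProduct _ _ _

theorem form_smul_left (n : ℕ) (c : ℝ) (x z : Idx n → ℝ) :
    form n (c • x) z = c * form n x z := smul_dotProduct _ _ _

theorem form_add_right (n : ℕ) (x y z : Idx n → ℝ) :
    form n z (x + y) = form n z x + form n z y := by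
  rw [form_comm, form_add_left, form_comm n z, form_comm n z]

theorem form_smul_right (n : ℕ) (c : ℝ) (x z : Idx n → ℝ) :
    form n z (c • x) = c * form n z x := by
  rw [form_comm, form_smul_left, form_comm n z]

theorem form_basePt_left (n : ℕ) (x : Idx n → ℝ) : form n (basePt n) x = x 0 := by
  rw [form_eq, basePt, Finset.sum_eq_zero]
  · simp
  · intro i hi
    simp [Finset.ne_of_mem_erase hi]

theorem basePt_mem (n : ℕ) : basePt n ∈ hyperboloid n :=
  ⟨by rw [form_basePt_left]; simp [basePt], by simp [basePt]⟩

theorem isometry_row {n : ℕ} {g : Matrix (Idx n) (Idx n) ℝ} (hg : gᵀ * eta n * g = eta n) :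
    g * eta n * gᵀ = eta n := by
  have h1 : (eta n * gᵀ * eta n) * g = 1 := by
    rw [mul_assoc, mul_assoc, ← mul_assoc gᵀ, hg, eta_mul_eta]
  have h2 := mul_eq_one_comm.mp h1
  calc g * eta n * gᵀ = g * (eta n * gᵀ * eta n) * eta n := by
        simp only [mul_assoc, eta_mul_eta, mul_one]
    _ = eta n := by rw [h2, one_mul]

/-- The top row of an isometry has form value one, so its entries are at most g₀₀ in absolute value;
each column has form value ±1, so g_ij² ≤ 1 + g_0j². Thus g₀₀, the hyperbolic cosine of the
displacement of the base point, controls the whole matrix. -/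
theorem isometry_entry_le {n : ℕ} {g : Matrix (Idx n) (Idx n) ℝ} (hg : gᵀ * eta n * g = eta n)
    (h0 : 0 ≤ g 0 0) (i j : Idx n) : |g i j| ≤ 1 + g 0 0 := by
  have hcol : ∀ j, ∑ k, sgn n k * (g k j) ^ 2 = sgn n j := by
    intro j
    have := congrFun (congrFun hg j) j
    rw [Matrix.mul_apply, eta] at this
    simp only [Matrix.mul_diagonal, Matrix.transpose_apply, Matrix.diagonal_apply_eq] at this
    rw [← this]
    exact Finset.sum_congr rfl fun k _ => by ring
  have hrow : ∑ k, sgn n k * (g 0 k) ^ 2 = sgn n 0 := by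
    have := congrFun (congrFun (isometry_row hg) 0) 0
    rw [Matrix.mul_apply, eta] at this
    simp only [Matrix.mul_diagonal, Matrix.transpose_apply, Matrix.diagonal_apply_eq] at this
    rw [← this]
    exact Finset.sum_congr rfl fun k _ => by ring
  have aux : ∀ (f : Idx n → ℝ) (c : ℝ), c ≤ 1 → -1 ≤ c → ∑ k, sgn n k * f k ^ 2 = c →
      (∀ i, f i ^ 2 ≤ 1 + f 0 ^ 2) ∧ (c = 1 → ∀ i, f i ^ 2 ≤ f 0 ^ 2) := by
    intro f c hc hc' h
    rw [← Finset.add_sum_erase _ _ (Finset.mem_univ (0 : Idx n))] at h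
    have h2 : ∀ i, i ≠ 0 → f i ^ 2 ≤ f 0 ^ 2 - c := by
      intro i hi
      have h3 : ∑ k ∈ Finset.univ.erase 0, sgn n k * f k ^ 2 =
          - ∑ k ∈ Finset.univ.erase 0, f k ^ 2 := by
        rw [← Finset.sum_neg_distrib]
        exact Finset.sum_congr rfl fun k hk => by simp [sgn, Finset.ne_of_mem_erase hk]
      have h4 := Finset.single_le_sum (f := fun k => f k ^ 2) (fun k _ => sq_nonneg _)
        (Finset.mem_erase.mpr ⟨hi, Finset.mem_univ i⟩)
      simp only [sgn, if_true, one_mul] at h h3 h4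
      linarith
    constructor
    · intro i
      by_cases hi : i = 0
      · subst hi; linarith
      · linarith [h2 i hi]
    · intro hc1 i
      by_cases hi : i = 0
      · subst hi; linarith
      · linarith [h2 i hi]
  have hs : sgn n j ≤ 1 ∧ -1 ≤ sgn n j := by
    unfold sgn; split_ifs <;> norm_num
  have h1 : g i j ^ 2 ≤ 1 + g 0 j ^ 2 := (aux (fun k => g k j) _ hs.1 hs.2 (hcol j)).1 i
  have h2 : g 0 j ^ 2 ≤ g 0 0 ^ 2 := (aux (fun k => g 0 k) (sgn n 0) (by simp [sgn]) (by simp [sgn]) hrow).2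
    (by simp [sgn]) j
  refine abs_le_of_sq_le_sq ?_ (by linarith)
  nlinarith

theorem HypGroup.cov_inv_zero_zero {n : ℕ} (L : HypGroup n) (g : L.G) :
    L.cov g⁻¹ 0 0 = L.cov g 0 0 := by
  have h1 : L.cov g⁻¹ = eta n * (L.cov g)ᵀ * eta n := by
    have h2 : (eta n * (L.cov g)ᵀ * eta n) * L.cov g = 1 := by
      rw [mul_assoc, mul_assoc, ← mul_assoc (L.cov g)ᵀ, L.cov_isometry, eta_mul_eta]
    calc L.cov g⁻¹ = ((eta n * (L.cov g)ᵀ * eta n) * L.cov g) * L.cov g⁻¹ := by rw [h2, one_mul]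
      _ = _ := by rw [mul_assoc, L.cov_mul_inv, mul_one]
  rw [h1, eta, Matrix.mul_diagonal, Matrix.diagonal_mul]
  simp [sgn]

/-! ### `SO⁰(d,1)` -/

theorem mulVec_basePt {n : ℕ} (g : Matrix (Idx n) (Idx n) ℝ) (i : Idx n) :
    (g *ᵥ basePt n) i = g i 0 := by
  simp [basePt]

theorem isCompact_entry_le (n : ℕ) (C : ℝ) :
    IsCompact {g : Matrix (Idx n) (Idx n) ℝ | ∀ i j, |g i j| ≤ C} := by
  have : {g : Matrix (Idx n) (Idx n) ℝ | ∀ i j, |g i j| ≤ C} =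
      Set.univ.pi fun _ => Set.univ.pi fun _ => Set.Icc (-C) C := by
    ext g
    exact ⟨fun h i _ j _ => abs_le.mp (h i j), fun h i j => abs_le.mpr (h i trivial j trivial)⟩
  rw [this]
  exact isCompact_univ_pi fun _ => isCompact_univ_pi fun _ => isCompact_Icc

theorem soGroup_finite (n : ℕ) (Γ : Subgroup (soGroup n).G) (hΓ : DiscreteTopology Γ) (C : ℝ) :
    {γ : Γ | (soGroup n).cov γ 0 0 ≤ C}.Finite := by
  have hpos : ∀ g : (soGroup n).G, 0 ≤ (soGroup n).cov g 0 0 := by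
    intro g
    have h := (g.2.2 _ (basePt_mem n)).2
    rw [mulVec_basePt] at h
    exact h.le
  refine finite_of_discrete_of_isCompact (soGroup n).cov ?_ Γ _ (isCompact_entry_le n (1 + C)) _ ?_
  · exact Topology.IsInducing.subtypeVal.comp Topology.IsInducing.subtypeVal
  · intro γ hγ
    refine ⟨fun i j => ?_, fun i j => ?_⟩
    · exact (isometry_entry_le ((soGroup n).cov_isometry _) (hpos _) i j).trans
        (add_le_add_right hγ 1)
    · refine (isometry_entry_le ((soGroup n).cov_isometry _) (hpos _) i j).trans ?_
      rw [HypGroup.cov_inv_zero_zero]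
      exact add_le_add_right hγ 1

/-! ### The Lipschitz group -/

/-- A Lipschitz element of the Clifford algebra: it acts on the vectors by an isometry of known
determinant and time orientation. -/
def IsLipschitz {n : ℕ} (x : Cl n) (A : Matrix (Idx n) (Idx n) ℝ) (k : ℕ) (c : ℝ) : Prop :=
  (∀ v, x * vec n v = vec n (A *ᵥ v) * x) ∧ x * star x = algebraMap ℝ _ c ∧
    x ∈ CliffordAlgebra.evenOdd (quad n) (k : ZMod 2) ∧ Aᵀ * eta n * A = eta n ∧
    A.det = (-1) ^ k ∧ ∀ y ∈ hyperboloid n, 0 < c * (-1) ^ k * (A *ᵥ y) 0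

theorem IsLipschitz.one {n : ℕ} : IsLipschitz (1 : Cl n) 1 0 1 := by
  refine ⟨fun v => by simp, by simp, ?_, by simp, by simp, fun y hy => by simpa using hy.2⟩
  exact SetLike.one_mem_graded (A := CliffordAlgebra.evenOdd (quad n))

theorem IsLipschitz.mul {n : ℕ} {x y : Cl n} {A B : Matrix (Idx n) (Idx n) ℝ} {k l : ℕ} {c d : ℝ}
    (hx : IsLipschitz x A k c) (hy : IsLipschitz y B l d) :
    IsLipschitz (x * y) (A * B) (k + l) (c * d) := by
  obtain ⟨h1, h2, h3, h4, h5, h6⟩ := hx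
  obtain ⟨g1, g2, g3, g4, g5, g6⟩ := hy
  refine ⟨fun v => ?_, ?_, ?_, ?_, ?_, fun z hz => ?_⟩
  · rw [mul_assoc, g1, ← mul_assoc, h1, mul_assoc, Matrix.mulVec_mulVec]
  · rw [star_mul, mul_assoc, ← mul_assoc y, g2, ← mul_assoc, ← Algebra.commutes, mul_assoc, h2,
      ← map_mul, mul_comm]
  · push_cast
    exact SetLike.mul_mem_graded h3 g3
  · rw [Matrix.transpose_mul]
    calc Bᵀ * Aᵀ * eta n * (A * B) = Bᵀ * (Aᵀ * eta n * A) * B := by simp only [mul_assoc]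
      _ = eta n := by rw [h4, g4]
  · rw [Matrix.det_mul, h5, g5, pow_add]
  · have hz1 : form n (B *ᵥ z) (B *ᵥ z) = 1 := by rw [form_mulVec_mulVec g4]; exact hz.1
    have hz2 := g6 z hz
    rw [← Matrix.mulVec_mulVec]
    have e : c * d * (-1) ^ (k + l) * (A *ᵥ B *ᵥ z) 0 =
      (d * (-1) ^ l) * (c * (-1) ^ k * (A *ᵥ B *ᵥ z) 0) := by ring
    rw [e]
    -- Either B z lies on the upper sheet, or -(B z) does; in the second case both signs d(-1)^l and
    -- (A B z)₀ are reversed.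
    rcases lt_or_ge 0 ((B *ᵥ z) 0) with h | h
    · have hd : 0 < d * (-1) ^ l := by
        by_contra hneg
        nlinarith
      exact mul_pos hd (h6 _ ⟨hz1, h⟩)
    · have hd : d * (-1) ^ l < 0 := by
        by_contra hneg
        nlinarith
      have hz0 : 0 < (-(B *ᵥ z)) 0 := by
        rw [Pi.neg_apply]
        rcases h.lt_or_eq with h | h
        · linarith
        · rw [h, mul_zero] at hz2; exact absurd hz2 (lt_irrefl 0)
      have := h6 (-(B *ᵥ z)) ⟨by
        rw [← neg_one_smul ℝ, form_smul_left, form_smul_right, hz1]; norm_num, hz0⟩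
      rw [Matrix.mulVec_neg, Pi.neg_apply] at this
      nlinarith

theorem vec_mul_vec (n : ℕ) (v w : Idx n → ℝ) :
    vec n w * vec n v = -(vec n v * vec n w) + algebraMap ℝ _ (2 * form n v w) := by
  have h := CliffordAlgebra.ι_mul_ι_add_swap (Q := quad n) v w
  rw [QuadraticMap.polar, quad_eq_form, quad_eq_form, quad_eq_form, form_add_self] at h
  have e : form n v v + 2 * form n v w + form n w w - form n v v - form n w w = 2 * form n v w := by
    ring
  rw [e] at h
  rw [← h]; abel

theorem vec_mul_self (n : ℕ) (v : Idx n → ℝ) : vec n v * vec n v = algebraMap ℝ _ (form n v v) := by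
  rw [CliffordAlgebra.ι_sq_scalar, quad_eq_form]

/-- Write x = (t, x'), w = (a, w') and S = x'·w', W = w'·w'. The expression equals t(a² + W) - 2Sa.
Cauchy–Schwarz gives S² ≤ (t² - 1)W, and 4a²W ≤ (a² + W)² then gives |2Sa| < t(a² + W). -/
theorem reflection_orientation {n : ℕ} (w : Idx n → ℝ) (hw : form n w w ≠ 0) (x : Idx n → ℝ)
    (hx : x ∈ hyperboloid n) : 0 < 2 * form n x w * w 0 - form n w w * x 0 := by
  obtain ⟨hx1, hx0⟩ := hx
  rw [form_eq] at *
  rw [form_eq] at *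
  set X := ∑ i ∈ Finset.univ.erase 0, x i * x i with hX
  set Wq := ∑ i ∈ Finset.univ.erase 0, w i * w i with hW
  set S := ∑ i ∈ Finset.univ.erase 0, x i * w i with hS
  have hCS : S ^ 2 ≤ X * Wq := by
    have := Finset.sum_mul_sq_le_sq_mul_sq (Finset.univ.erase 0) x w
    simpa [hX, hW, hS, sq] using this
  have hW0 : 0 ≤ Wq := Finset.sum_nonneg fun i _ => mul_self_nonneg _
  generalize x 0 = t at *
  generalize w 0 = a at *
  have hXt : X = t ^ 2 - 1 := by linarith
  rw [hXt] at hCS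
  have hpos : 0 < a ^ 2 + Wq := by
    rcases (add_nonneg (sq_nonneg a) hW0).lt_or_eq with h | h
    · exact h
    · exfalso; apply hw
      have h1 : a ^ 2 = 0 := by nlinarith [sq_nonneg a]
      have h2 : Wq = 0 := by nlinarith [sq_nonneg a]
      have h3 : a = 0 := by simpa using h1
      rw [h2, h3]; ring
  have key : (2 * S * a) ^ 2 < (t * (a ^ 2 + Wq)) ^ 2 := by
    have h1 : (2 * S * a) ^ 2 ≤ 4 * ((t ^ 2 - 1) * Wq) * a ^ 2 := by nlinarith [sq_nonneg a]
    have h2 : (t * (a ^ 2 + Wq)) ^ 2 = t ^ 2 * (a ^ 2 - Wq) ^ 2 + 4 * t ^ 2 * a ^ 2 * Wq := by ring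
    have h3 : 0 ≤ Wq * a ^ 2 := mul_nonneg hW0 (sq_nonneg a)
    rcases h3.lt_or_eq with h | h
    · nlinarith [mul_nonneg (sq_nonneg t) (sq_nonneg (a ^ 2 - Wq))]
    · have h4 : 4 * ((t ^ 2 - 1) * Wq) * a ^ 2 = 0 := by
        rw [mul_assoc, mul_assoc (t ^ 2 - 1), ← h]; ring
      have : 0 < (t * (a ^ 2 + Wq)) ^ 2 := by positivity
      linarith
  have := (abs_lt.mp (abs_lt_of_sq_lt_sq key (by positivity))).2
  nlinarith

/-- The relation wv = -vw + 2⟨v,w⟩ shows that conjugation by w is the negative of the reflection in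
w^⊥. Here c(-1)^k = ⟨w,w⟩, so the last clause says that the sheets are kept or exchanged according
to the sign of ⟨w,w⟩. -/
theorem IsLipschitz.vec {n : ℕ} (w : Idx n → ℝ) (hw : form n w w ≠ 0) :
    ∃ A, IsLipschitz (vec n w) A 1 (-form n w w) := by
  set q := form n w w with hq
  -- UR is the rank-one map v ↦ (2⟨v,w⟩/q) w.
  set U : Matrix (Idx n) Unit ℝ := Matrix.replicateCol Unit ((2 / q) • w)
  set R : Matrix Unit (Idx n) ℝ := Matrix.replicateRow Unit (eta n *ᵥ w)
  have hA : ∀ v, (U * R - 1) *ᵥ v = (2 * form n v w / q) • w - v := by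
    intro v
    rw [Matrix.sub_mulVec, Matrix.one_mulVec]
    congr 1
    ext i
    have : form n v w = ∑ j, (eta n *ᵥ w) j * v j := by
      rw [form, dotProduct]; exact Finset.sum_congr rfl fun j _ => mul_comm _ _
    have hR : R *ᵥ v = fun _ => form n v w := by
      ext; rw [this]; rfl
    rw [← Matrix.mulVec_mulVec, hR]
    simp only [U, Matrix.mulVec, dotProduct, Matrix.replicateCol_apply, Finset.univ_unique,
      Finset.sum_singleton, Pi.smul_apply, smul_eq_mul]
    ring
  have hform : ∀ v v', form n ((U * R - 1) *ᵥ v) ((U * R - 1) *ᵥ v') = form n v v' := by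
    intro v v'
    rw [hA, hA, sub_eq_add_neg, sub_eq_add_neg, ← neg_one_smul ℝ v, ← neg_one_smul ℝ v']
    simp only [form_add_left, form_add_right, form_smul_left, form_smul_right, ← hq,
      form_comm n w]
    field_simp
    ring
  refine ⟨U * R - 1, fun v => ?_, ?_, ?_, ?_, ?_, fun y hy => ?_⟩
  · rw [hA, map_sub, map_smul, sub_mul, smul_mul_assoc, vec_mul_self, vec_mul_vec, ← hq,
      Algebra.algebraMap_eq_smul_one, Algebra.algebraMap_eq_smul_one, smul_smul,
      div_mul_cancel₀ _ hw]
    abel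
  · rw [CliffordAlgebra.star_ι, mul_neg, vec_mul_self, map_neg]
  · exact CliffordAlgebra.ι_mem_evenOdd_one _ _
  · ext i j
    have := hform (Pi.single i 1) (Pi.single j 1)
    unfold form at this
    rw [← Matrix.vecMul_transpose, ← Matrix.dotProduct_mulVec, Matrix.mulVec_mulVec,
      Matrix.mulVec_mulVec] at this
    simpa [mul_assoc] using this
  · have h1 : U * R - 1 = -(1 - U * R) := by abel
    have h2 : (R * U) = Matrix.of fun _ _ => 2 := by
      ext i j
      have : form n w w = ∑ j, (eta n *ᵥ w) j * w j := by
        rw [form, dotProduct]; exact Finset.sum_congr rfl fun j _ => mul_comm _ _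
      simp only [Matrix.mul_apply, U, R, Matrix.replicateCol_apply, Matrix.replicateRow_apply,
        Pi.smul_apply, smul_eq_mul, Matrix.of_apply]
      have h3 : ∑ x, (eta n *ᵥ w) x * (2 / q * w x) = 2 / q * ∑ j, (eta n *ᵥ w) j * w j := by
        rw [Finset.mul_sum]; exact Finset.sum_congr rfl fun j _ => by ring
      rw [h3, ← this, ← hq, div_mul_cancel₀ _ hw]
    -- The dimension 2n + 2 is even, so the overall sign disappears, and det(1 - UR) = det(1 - RU) =
    -- 1 - 2 for the 1 × 1 matrix RU.
    rw [h1, Matrix.det_neg, Matrix.det_one_sub_mul_comm, h2, Matrix.det_unique]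
    simp only [Matrix.one_apply_eq, Matrix.sub_apply, Matrix.of_apply, Fintype.card_fin, pow_one]
    have : Even (2 * n + 1 + 1) := ⟨n + 1, by ring⟩
    rw [this.neg_one_pow]; norm_num
  · rw [hA, Pi.sub_apply, Pi.smul_apply, smul_eq_mul]
    have := reflection_orientation w hw y hy
    rw [← hq] at this
    have e : -q * (-1) ^ 1 * (2 * form n y w / q * w 0 - y 0) =
      2 * form n y w * w 0 - q * y 0 := by field_simp
    rw [e]; exact this

theorem exists_isLipschitz {n : ℕ} (u : (Cl n)ˣ) (hu : u ∈ lipschitzGroup (quad n)) :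
    ∃ A k c, IsLipschitz (u : Cl n) A k c := by
  have hv : ∀ (u : (Cl n)ˣ) (w : Idx n → ℝ), vec n w = u → form n w w ≠ 0 := by
    intro u w hw h0
    have h1 := vec_mul_self n w
    rw [h0, map_zero, hw] at h1
    exact (u * u).ne_zero (by simp at h1)
  unfold lipschitzGroup at hu
  induction hu using Subgroup.closure_induction'' with
  | mem x hx =>
    obtain ⟨w, hw⟩ := hx
    obtain ⟨A, hA⟩ := IsLipschitz.vec w (hv x w hw)
    exact ⟨A, _, _, by rw [← hw]; exact hA⟩
  | inv_mem x hx =>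
    obtain ⟨w, hw⟩ := hx
    have h0 := hv x w hw
    have hinv : ((x⁻¹ : (Cl n)ˣ) : Cl n) = vec n ((form n w w)⁻¹ • w) := by
      refine Units.inv_eq_of_mul_eq_one_right ?_
      rw [← hw, map_smul, mul_smul_comm, vec_mul_self, Algebra.algebraMap_eq_smul_one, smul_smul,
        inv_mul_cancel₀ h0, one_smul]
    have h1 : form n ((form n w w)⁻¹ • w) ((form n w w)⁻¹ • w) ≠ 0 := by
      rw [form_smul_left, form_smul_right, inv_mul_cancel₀ h0, mul_one]
      exact inv_ne_zero h0
    obtain ⟨A, hA⟩ := IsLipschitz.vec _ h1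
    exact ⟨A, _, _, by rw [hinv]; exact hA⟩
  | one => exact ⟨_, _, _, IsLipschitz.one⟩
  | mul x y hx hy ihx ihy =>
    obtain ⟨A, k, c, h⟩ := ihx
    obtain ⟨B, l, d, h'⟩ := ihy
    exact ⟨_, _, _, h.mul h'⟩

/-- An element of the spin group has norm c = 1. It is also even and non-zero, so it cannot be odd,
which makes the number k of reflections even; both signs in `IsLipschitz` are then +1. -/
theorem spinCov_det_and_orientation (n : ℕ) (x : spinGroup (quad n)) :
    (spinCov n x).det = 1 ∧ ∀ y ∈ hyperboloid n, spinCov n x *ᵥ y ∈ hyperboloid n := by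
  obtain ⟨⟨⟨u, hu, hux⟩, hunit⟩, heven⟩ := x.2
  have hux' : (u : Cl n) = x := hux
  obtain ⟨A, k, c, h1, h2, h3, h4, h5, h6⟩ := exists_isLipschitz u hu
  rw [hux'] at h1 h2 h3
  have hA : spinCov n x = A := by
    have : ∀ v, spinCov n x *ᵥ v = A *ᵥ v := fun v => by
      rw [spinCov_mulVec]; exact spinAct_eq n x v _ (h1 v)
    ext i j
    have := congrFun (this (Pi.single j 1)) i
    simpa using this
  have hc : c = 1 := by
    have h : (x : Cl n) * star (x : Cl n) = 1 := spinGroup.coe_mul_star_self x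
    rw [h2, ← map_one (algebraMap ℝ (Cl n))] at h
    exact (algebraMap ℝ (Cl n)).injective h
  have hk : (-1 : ℝ) ^ k = 1 := by
    rcases Nat.even_or_odd k with hk | hk
    · exact hk.neg_one_pow
    · exfalso
      have hk1 : (k : ZMod 2) = 1 := by
        exact (ZMod.natCast_eq_one_iff_odd (n := k)).mpr hk
      rw [hk1] at h3
      have h0 : (x : Cl n) ∈ CliffordAlgebra.evenOdd (quad n) 0 := heven
      have := Submodule.disjoint_def.mp (CliffordAlgebra.evenOdd_isCompl (quad n)).disjoint _ h0 h3
      exact (hux' ▸ u.ne_zero) this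
  refine ⟨by rw [hA, h5, hk], fun y hy => ⟨?_, ?_⟩⟩
  · rw [form_mulVec_mulVec (spinCov_isometry n x)]; exact hy.1
  · have := h6 y hy
    rw [hc, hk, one_mul, one_mul] at this
    rwa [hA]

/-! ### A euclidean structure on the Clifford algebra -/

instance Cl_finite (n : ℕ) : Module.Finite ℝ (Cl n) := by
  have := Module.Finite.of_basis ((Pi.basisFun ℝ (Idx n)).ExteriorAlgebra)
  exact Module.Finite.equiv (CliffordAlgebra.equivExterior (quad n)).symm

/-- The basis vectors of `ℝ^{d+1}` in the Clifford algebra. -/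
abbrev gen (n : ℕ) (i : Idx n) : Cl n := vec n (Pi.single i 1)

theorem form_single_single (n : ℕ) (i j : Idx n) :
    form n (Pi.single i 1) (Pi.single j 1) = if i = j then sgn n i else 0 := by
  by_cases h : i = j
  · subst h; simp [form, eta]
  · simp [form, eta, h, Ne.symm h]

theorem gen_mul_self (n : ℕ) (i : Idx n) : gen n i * gen n i = sgn n i • (1 : Cl n) := by
  rw [vec_mul_self, form_single_single, if_pos rfl, Algebra.algebraMap_eq_smul_one]

theorem gen_mul_gen (n : ℕ) {i j : Idx n} (h : i ≠ j) : gen n i * gen n j = -(gen n j * gen n i) := by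
  rw [vec_mul_vec, form_single_single, if_neg h.symm]
  simp

/-- There is a positive definite symmetric form on the Clifford algebra for which the left
multiplications by the basis vectors are isometric. -/
theorem exists_invariant_form (n : ℕ) {ι : Type*} [Fintype ι] (b : Basis ι ℝ (Cl n)) :
    ∃ B : Cl n →ₗ[ℝ] Cl n →ₗ[ℝ] ℝ, (∀ x, ∑ i, b.repr x i ^ 2 ≤ B x x) ∧
      ∀ i x y, B (gen n i * x) (gen n i * y) = B x y := by
  classical
  have key : ∀ S : Finset (Idx n), ∃ B : Cl n →ₗ[ℝ] Cl n →ₗ[ℝ] ℝ,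
      (∀ x, ∑ i, b.repr x i ^ 2 ≤ B x x) ∧
      ∀ i ∈ S, ∀ x y, B (gen n i * x) (gen n i * y) = B x y := by
    intro S
    induction S using Finset.induction_on with
    | empty =>
      refine ⟨∑ i, (LinearMap.mul ℝ ℝ).compl₁₂ (b.coord i) (b.coord i), fun x => ?_, by simp⟩
      simp [sq]
    | insert a S ha ih =>
      obtain ⟨B, hB, hS⟩ := ih
      -- Averaging over one more generator e_a: since e_a² = ±1 the new form is e_a-invariant, and
      -- since e_a anticommutes with the earlier generators their invariance survives. Adding the
      -- second term only increases B x x.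
      refine ⟨B + B.compl₁₂ (LinearMap.mulLeft ℝ (gen n a)) (LinearMap.mulLeft ℝ (gen n a)),
        fun x => ?_, fun i hi x y => ?_⟩
      · have h1 := hB x
        have h2 := (Finset.sum_nonneg fun i _ => sq_nonneg (b.repr (gen n a * x) i)).trans
          (hB (gen n a * x))
        simp only [LinearMap.add_apply, LinearMap.compl₁₂_apply, LinearMap.mulLeft_apply]
        linarith
      · simp only [LinearMap.add_apply, LinearMap.compl₁₂_apply, LinearMap.mulLeft_apply]
        rcases Finset.mem_insert.mp hi with rfl | hi
        · have hs : sgn n i * sgn n i = 1 := by unfold sgn; split_ifs <;> norm_num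
          rw [← mul_assoc, ← mul_assoc, gen_mul_self, smul_mul_assoc, smul_mul_assoc, one_mul,
            one_mul, map_smul, map_smul, LinearMap.smul_apply, smul_smul, hs, one_smul, add_comm]
        · have hia : a ≠ i := by rintro rfl; exact ha hi
          rw [hS i hi, ← mul_assoc, ← mul_assoc, gen_mul_gen n hia, neg_mul, neg_mul, map_neg,
            map_neg, LinearMap.neg_apply, neg_neg, mul_assoc, mul_assoc, hS i hi]
  obtain ⟨B, hB, hS⟩ := key Finset.univ
  exact ⟨B, hB, fun i => hS i (Finset.mem_univ i)⟩

theorem gen_zero_mul_self (n : ℕ) : gen n 0 * gen n 0 = 1 := by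
  rw [gen_mul_self]; simp [sgn]

/-- Left multiplication by x has adjoint left multiplication by e_0 x^rev e_0. Because e_0² = 1 this
candidate reverses products as an adjoint does, so it suffices to check x = e_i, whose adjoint is
e_i⁻¹ = ±e_i = e_0 e_i e_0. -/
theorem invariant_form_adjoint {n : ℕ} {B : Cl n →ₗ[ℝ] Cl n →ₗ[ℝ] ℝ}
    (hB : ∀ i x y, B (gen n i * x) (gen n i * y) = B x y) (x : Cl n) :
    ∀ y z, B (x * y) z = B y (gen n 0 * CliffordAlgebra.reverse x * gen n 0 * z) := by
  have h0 := gen_zero_mul_self n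
  induction x using CliffordAlgebra.induction with
  | algebraMap r =>
    intro y z
    rw [CliffordAlgebra.reverse.commutes, Algebra.algebraMap_eq_smul_one, mul_smul_comm, mul_one,
      smul_mul_assoc, smul_mul_assoc, smul_mul_assoc, h0, one_mul, one_mul, map_smul, map_smul,
      LinearMap.smul_apply]
  | ι v =>
    intro y z
    rw [CliffordAlgebra.reverse_ι]
    have h1 : ∀ i, B (gen n i * y) z = B y (gen n 0 * gen n i * gen n 0 * z) := by
      intro i
      have hs : sgn n i * sgn n i = 1 := by unfold sgn; split_ifs <;> norm_num
      have h2 : gen n 0 * gen n i * gen n 0 = sgn n i • gen n i := by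
        by_cases hi : i = 0
        · subst hi; rw [h0, one_mul]; simp [sgn]
        · rw [gen_mul_gen n (Ne.symm hi), neg_mul, mul_assoc, h0, mul_one]; simp [sgn, hi]
      have h3 := hB i (gen n i * y) z
      rw [← mul_assoc, gen_mul_self, smul_mul_assoc, one_mul, map_smul, LinearMap.smul_apply] at h3
      rw [← h3, h2, smul_mul_assoc, map_smul]
    have h4 : ((B.compl₁₂ (LinearMap.mulRight ℝ y ∘ₗ vec n) LinearMap.id).flip z) =
        B y ∘ₗ LinearMap.mulRight ℝ z ∘ₗ LinearMap.mulRight ℝ (gen n 0) ∘ₗ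
          LinearMap.mulLeft ℝ (gen n 0) ∘ₗ vec n := by
      refine LinearMap.pi_ext' fun i => LinearMap.ext_ring ?_
      simpa using h1 i
    exact LinearMap.congr_fun h4 v
  | mul a b ha hb =>
    intro y z
    rw [mul_assoc, ha, hb, CliffordAlgebra.reverse.map_mul]
    congr 1
    calc gen n 0 * CliffordAlgebra.reverse b * gen n 0 *
          (gen n 0 * CliffordAlgebra.reverse a * gen n 0 * z)
        = gen n 0 * CliffordAlgebra.reverse b * (gen n 0 * gen n 0) * CliffordAlgebra.reverse a *
          gen n 0 * z := by simp only [mul_assoc]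
      _ = _ := by rw [h0, mul_one]; simp only [mul_assoc]
  | add a b ha hb =>
    intro y z
    rw [add_mul, map_add, LinearMap.add_apply, ha, hb, ← map_add]
    congr 1
    rw [map_add]; noncomm_ring

theorem vec_eq_sum (n : ℕ) (y : Idx n → ℝ) : vec n y = ∑ i, y i • gen n i := by
  conv_lhs => rw [← Finset.univ_sum_single y]
  rw [map_sum]
  refine Finset.sum_congr rfl fun i _ => ?_
  rw [← map_smul, ← Pi.single_smul, smul_eq_mul, mul_one]

/-- For x in the spin group x^rev = x⁻¹, so B(x, x) = B(1, e_0 x⁻¹ e_0 x), and x⁻¹ e_0 x is a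
vector, the first column of the covering matrix of x⁻¹. The size of x is thus controlled by its
image in SO⁰(d,1): the covering is proper. -/
theorem spinGroup_form_self {n : ℕ} {B : Cl n →ₗ[ℝ] Cl n →ₗ[ℝ] ℝ}
    (hB : ∀ i x y, B (gen n i * x) (gen n i * y) = B x y) (x : spinGroup (quad n)) :
    B x x = ∑ i, spinCov n x⁻¹ i 0 * B 1 (gen n 0 * gen n i) := by
  have heven : CliffordAlgebra.involute (x : Cl n) = x := spinGroup.involute_eq x.2
  have hrev : CliffordAlgebra.reverse (x : Cl n) = star (x : Cl n) := by
    rw [CliffordAlgebra.star_def, heven]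
  have hstar : star (x : Cl n) = ((x⁻¹ : spinGroup (quad n)) : Cl n) := rfl
  have h1 := invariant_form_adjoint hB (x : Cl n) 1 x
  rw [mul_one] at h1
  rw [h1, hrev, hstar]
  have h2 : ((x⁻¹ : spinGroup (quad n)) : Cl n) * gen n 0 * x = vec n (spinCov n x⁻¹ *ᵥ basePt n) := by
    rw [spinCov_mulVec, vec_spinAct, inv_inv]; rfl
  rw [mul_assoc (gen n 0), mul_assoc (gen n 0), h2, vec_eq_sum, Finset.mul_sum, map_sum]
  refine Finset.sum_congr rfl fun i _ => ?_
  rw [mul_smul_comm, map_smul, mulVec_basePt, smul_eq_mul]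

/-! ### `Spin(d,1)` -/

theorem spinCov_zero_zero_nonneg (n : ℕ) (x : spinGroup (quad n)) : 0 ≤ spinCov n x 0 0 := by
  have h := ((spinCov_det_and_orientation n x).2 _ (basePt_mem n)).2
  rw [mulVec_basePt] at h
  exact h.le

theorem spinGroup_coord_bounded (n : ℕ) {ι : Type*} [Fintype ι] (b : Basis ι ℝ (Cl n)) (C : ℝ) :
    ∃ R, ∀ x : spinGroup (quad n), spinCov n x 0 0 ≤ C → ∀ i, |b.repr (x : Cl n) i| ≤ R := by
  obtain ⟨B, hB, hinv⟩ := exists_invariant_form n b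
  -- If u² ≤ S then |u| ≤ 1 + S.
  refine ⟨1 + ∑ i, (1 + C) * |B 1 (gen n 0 * gen n i)|, fun x hx i => ?_⟩
  have h1 : b.repr (x : Cl n) i ^ 2 ≤ ∑ i, (1 + C) * |B 1 (gen n 0 * gen n i)| := by
    refine (Finset.single_le_sum (f := fun i => b.repr (x : Cl n) i ^ 2)
      (fun j _ => sq_nonneg _) (Finset.mem_univ i)).trans ?_
    refine (hB x).trans ?_
    rw [spinGroup_form_self hinv]
    refine Finset.sum_le_sum fun j _ => ?_
    refine (le_abs_self _).trans ?_
    rw [abs_mul]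
    refine mul_le_mul_of_nonneg_right ?_ (abs_nonneg _)
    refine (isometry_entry_le (spinCov_isometry n _) (spinCov_zero_zero_nonneg n _) j 0).trans ?_
    have := (spinGrp n).cov_inv_zero_zero x
    change spinCov n x⁻¹ 0 0 = spinCov n x 0 0 at this
    rw [this]
    linarith
  have h2 : 0 ≤ ∑ i, (1 + C) * |B 1 (gen n 0 * gen n i)| := (sq_nonneg _).trans h1
  refine abs_le_of_sq_le_sq (h1.trans ?_) (by linarith)
  nlinarith

theorem spinGrp_continuous_cov (n : ℕ) : Continuous (spinGrp n).cov := by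
  let _ : TopologicalSpace (Cl n) := moduleTopology ℝ (Cl n)
  have : IsModuleTopology ℝ (Cl n) := ⟨rfl⟩
  have : IsTopologicalRing (Cl n) := IsModuleTopology.isTopologicalRing ℝ (Cl n)
  -- A linear left inverse of `vec` reads the matrix entries off from x e_j x⁻¹, where x⁻¹ = star x
  -- depends linearly on x.
  obtain ⟨ℓ, hℓ⟩ := LinearMap.exists_leftInverse_of_injective (vec n)
    (LinearMap.ker_eq_bot.mpr (vec_injective n))
  have hval : Continuous fun x : (spinGrp n).G => (x.1 : Cl n) := continuous_induced_dom
  let st : Cl n →ₗ[ℝ] Cl n :=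
    CliffordAlgebra.reverse ∘ₗ (CliffordAlgebra.involute (Q := quad n)).toLinearMap
  have hst : Continuous st := IsModuleTopology.continuous_of_linearMap st
  have hl : Continuous ℓ := IsModuleTopology.continuous_of_linearMap ℓ
  refine continuous_matrix fun i j => ?_
  have h : ∀ x : spinGroup (quad n), spinCov n x i j = ℓ (x.1 * gen n j * st x.1) i := by
    intro x
    have h1 : (x.1 : Cl n) * gen n j * st x.1 = vec n (spinCov n x *ᵥ Pi.single j 1) := by
      rw [spinCov_mulVec, vec_spinAct]; rfl
    have h2 := LinearMap.congr_fun hℓ (spinCov n x *ᵥ Pi.single j 1)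
    rw [h1]
    refine Eq.trans ?_ (congrFun h2 i).symm
    simp
  refine Continuous.congr ?_ fun x => (h x).symm
  exact (continuous_apply i).comp
    (hl.comp ((hval.mul continuous_const).mul (hst.comp hval)))

theorem spinGrp_finite (n : ℕ) (Γ : Subgroup (spinGrp n).G) (hΓ : DiscreteTopology Γ) (C : ℝ) :
    {γ : Γ | (spinGrp n).cov γ 0 0 ≤ C}.Finite := by
  let _ : TopologicalSpace (Cl n) := moduleTopology ℝ (Cl n)
  have : IsModuleTopology ℝ (Cl n) := ⟨rfl⟩
  have : IsTopologicalRing (Cl n) := IsModuleTopology.isTopologicalRing ℝ (Cl n)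
  let b := Module.finBasis ℝ (Cl n)
  have hb1 : Continuous b.equivFun.toLinearMap := IsModuleTopology.continuous_of_linearMap _
  have hb2 : Continuous b.equivFun.symm.toLinearMap := IsModuleTopology.continuous_of_linearMap _
  have : T2Space (Cl n) := T2Space.of_injective_continuous b.equivFun.injective hb1
  obtain ⟨R, hR⟩ := spinGroup_coord_bounded n b C
  have hK : IsCompact (b.equivFun.symm.toLinearMap '' (Set.univ.pi fun _ => Set.Icc (-R) R)) :=
    (isCompact_univ_pi fun _ => isCompact_Icc).image hb2
  have hmem : ∀ x : spinGroup (quad n), spinCov n x 0 0 ≤ C →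
      (x : Cl n) ∈ b.equivFun.symm.toLinearMap '' (Set.univ.pi fun _ => Set.Icc (-R) R) := by
    intro x hx
    refine ⟨b.equivFun x, fun i _ => abs_le.mp (hR x hx i), ?_⟩
    exact b.equivFun.symm_apply_apply _
  refine finite_of_discrete_of_isCompact (G := (spinGrp n).G) (spinGroup (quad n)).subtype ?_ Γ _ hK _ ?_
  · exact ⟨rfl⟩
  · intro γ hγ
    refine ⟨hmem _ hγ, hmem _ ?_⟩
    have := (spinGrp n).cov_inv_zero_zero γ
    exact this.le.trans hγ

/-- Let w be y + e_0 scaled to ⟨w,w⟩ = 1, which is possible as ⟨y + e_0, y + e_0⟩ = 2 + 2y₀ > 0.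
Conjugation by w exchanges e_0 and y, and conjugation by e_0 fixes e_0; the even element w e_0
therefore takes e_0 to y. -/
theorem spinGrp_transitive (n : ℕ) (y : Idx n → ℝ) (hy : y ∈ hyperboloid n) :
    ∃ x : spinGroup (quad n), spinCov n x *ᵥ basePt n = y := by
  obtain ⟨hy1, hy0⟩ := hy
  set N : ℝ := 2 + 2 * y 0 with hN
  have hNpos : 0 < N := by linarith
  set s : ℝ := (Real.sqrt N)⁻¹ with hs
  have hs2 : s * s = N⁻¹ := by
    rw [hs, ← mul_inv, Real.mul_self_sqrt hNpos.le]
  set w : Idx n → ℝ := s • (y + basePt n) with hw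
  have hqw : form n w w = 1 := by
    rw [hw, form_smul_left, form_smul_right, form_add_self, hy1, form_comm, form_basePt_left,
      form_basePt_left, ← mul_assoc, hs2]
    simp only [basePt, Pi.single_eq_same]
    rw [hN]; field_simp; ring
  have hw2 : vec n w * vec n w = 1 := by rw [vec_mul_self, hqw, map_one]
  have he2 := gen_zero_mul_self n
  have hu : ∀ v : Idx n → ℝ, vec n v * vec n v = 1 →
      ∃ u ∈ lipschitzGroup (quad n), (u : Cl n) = vec n v := fun v hv =>
    ⟨⟨vec n v, vec n v, hv, hv⟩, Subgroup.subset_closure ⟨v, rfl⟩, rfl⟩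
  obtain ⟨u1, hu1, h1⟩ := hu w hw2
  obtain ⟨u2, hu2, h2⟩ := hu _ he2
  have hstar : star (vec n w * gen n 0) = gen n 0 * vec n w := by
    simp [CliffordAlgebra.star_def]
  have hmem : vec n w * gen n 0 ∈ spinGroup (quad n) := by
    refine ⟨⟨⟨u1 * u2, mul_mem hu1 hu2, ?_⟩, ?_⟩, ?_⟩
    · simp [h1, h2]
    · refine ⟨?_, ?_⟩
      · rw [hstar]
        calc gen n 0 * vec n w * (vec n w * gen n 0)
            = gen n 0 * (vec n w * vec n w) * gen n 0 := by simp only [mul_assoc]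
          _ = 1 := by rw [hw2, mul_one, he2]
      · rw [hstar]
        calc vec n w * gen n 0 * (gen n 0 * vec n w)
            = vec n w * (gen n 0 * gen n 0) * vec n w := by simp only [mul_assoc]
          _ = 1 := by rw [he2, mul_one, hw2]
    · exact CliffordAlgebra.ι_mul_ι_mem_evenOdd_zero (quad n) _ _
  refine ⟨⟨_, hmem⟩, ?_⟩
  rw [spinCov_mulVec]
  refine spinAct_eq n _ _ _ ?_
  change vec n w * gen n 0 * gen n 0 = vec n y * (vec n w * gen n 0)
  have hyy : vec n y * vec n y = 1 := by rw [vec_mul_self, hy1, map_one]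
  rw [mul_assoc, he2, mul_one, hw, map_smul, map_add, smul_mul_assoc, mul_smul_comm, add_mul,
    mul_add, ← mul_assoc, hyy, one_mul]
  change _ = s • (gen n 0 + vec n y * (gen n 0 * gen n 0))
  rw [he2, mul_one, add_comm]
  rfl

theorem spinGrp_isProper (n : ℕ) : (spinGrp n).IsProper where
  det_cov g := (spinCov_det_and_orientation n g).1
  mulVec_mem g := (spinCov_det_and_orientation n g).2
  transitive := spinGrp_transitive n
  continuous_cov := spinGrp_continuous_cov n
  finite := spinGrp_finite n

theorem soGroup_isProper (n : ℕ) : (soGroup n).IsProper where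
  det_cov g := g.1.2
  mulVec_mem g := g.2.2
  transitive x hx := by
    obtain ⟨y, hy⟩ := spinGrp_transitive n x hx
    exact ⟨⟨⟨spinCov n y, (spinCov_det_and_orientation n y).1⟩, spinCov_isometry n y,
      (spinCov_det_and_orientation n y).2⟩, hy⟩
  continuous_cov := continuous_subtype_val.comp continuous_subtype_val
  finite := soGroup_finite n

/-! ### The hyperbolic distance -/

theorem one_le_form {n : ℕ} {x y : Idx n → ℝ} (hx : x ∈ hyperboloid n) (hy : y ∈ hyperboloid n) :
    1 ≤ form n x y := by
  obtain ⟨hx1, hx0⟩ := hx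
  obtain ⟨hy1, hy0⟩ := hy
  rw [form_eq] at *
  have hCS := Finset.sum_mul_sq_le_sq_mul_sq (Finset.univ.erase (0 : Idx n)) x y
  simp only [sq] at hCS
  set S := ∑ i ∈ Finset.univ.erase 0, x i * y i
  set X := ∑ i ∈ Finset.univ.erase 0, x i * x i with hX
  set Y := ∑ i ∈ Finset.univ.erase 0, y i * y i with hY
  have hX0 : 0 ≤ X := Finset.sum_nonneg fun i _ => mul_self_nonneg _
  have hY0 : 0 ≤ Y := Finset.sum_nonneg fun i _ => mul_self_nonneg _
  generalize x 0 = a at *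
  generalize y 0 = b at *
  have ha : 1 ≤ a := by nlinarith
  have hb : 1 ≤ b := by nlinarith
  have hab : 0 ≤ a * b - 1 := by nlinarith
  have : S ≤ a * b - 1 := by
    refine le_of_abs_le (abs_le_of_sq_le_sq ?_ hab)
    have e1 : X = a * a - 1 := by linarith
    have e2 : Y = b * b - 1 := by linarith
    rw [e1, e2] at hCS
    nlinarith [sq_nonneg (a - b)]
  linarith

theorem cosh_hdist {n : ℕ} {x y : Idx n → ℝ} (hx : x ∈ hyperboloid n) (hy : y ∈ hyperboloid n) :
    Real.cosh (hdist n x y) = form n x y := Real.cosh_arcosh (one_le_form hx hy)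

theorem hdist_nonneg {n : ℕ} {x y : Idx n → ℝ} (hx : x ∈ hyperboloid n) (hy : y ∈ hyperboloid n) :
    0 ≤ hdist n x y := Real.arcosh_nonneg (one_le_form hx hy)

theorem hdist_comm (n : ℕ) (x y : Idx n → ℝ) : hdist n x y = hdist n y x := by
  rw [hdist, form_comm, hdist]

theorem hdist_self {n : ℕ} {x : Idx n → ℝ} (hx : x ∈ hyperboloid n) : hdist n x x = 0 := by
  rw [hdist, hx.1]; exact Real.arcosh_zero

/-- The form is negative semidefinite on the orthogonal complement of a timelike vector, by
Cauchy–Schwarz for the space coordinates. -/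
theorem form_self_nonpos {n : ℕ} {y v : Idx n → ℝ} (hy : y ∈ hyperboloid n)
    (hv : form n v y = 0) : form n v v ≤ 0 := by
  obtain ⟨hy1, hy0⟩ := hy
  rw [form_eq] at *
  have hCS := Finset.sum_mul_sq_le_sq_mul_sq (Finset.univ.erase (0 : Idx n)) v y
  simp only [sq] at hCS
  set S := ∑ i ∈ Finset.univ.erase 0, v i * y i
  set V := ∑ i ∈ Finset.univ.erase 0, v i * v i
  set Y := ∑ i ∈ Finset.univ.erase 0, y i * y i
  have hV0 : 0 ≤ V := Finset.sum_nonneg fun i _ => mul_self_nonneg _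
  generalize v 0 = a at *
  generalize y 0 = b at *
  have e1 : S = a * b := by linarith
  have e2 : Y = b * b - 1 := by linarith
  rw [e1, e2] at hCS
  by_contra hneg
  nlinarith [mul_pos hy0 hy0]

theorem form_sq_le {n : ℕ} {y v w : Idx n → ℝ} (hy : y ∈ hyperboloid n)
    (hv : form n v y = 0) (hw : form n w y = 0) :
    form n v w ^ 2 ≤ form n v v * form n w w := by
  have h : ∀ t : ℝ, 0 ≤ (-form n w w) * (t * t) + (-2 * form n v w) * t + (-form n v v) := by
    intro t
    have := form_self_nonpos hy (v := v + t • w) (by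
      rw [form_add_left, form_smul_left, hv, hw]; ring)
    rw [form_add_self, form_smul_left, form_smul_right, form_smul_right] at this
    linarith
  have := discrim_le_zero h
  rw [discrim] at this
  nlinarith

/-- Split x and z along y. With a, b the distances to y, the parts orthogonal to y have lengths sinh
a and sinh b, so Cauchy–Schwarz on y^⊥ gives ⟨x,z⟩ ≤ cosh a cosh b + sinh a sinh b = cosh(a + b). -/
theorem hdist_triangle {n : ℕ} {x y z : Idx n → ℝ} (hx : x ∈ hyperboloid n)
    (hy : y ∈ hyperboloid n) (hz : z ∈ hyperboloid n) :
    hdist n x z ≤ hdist n x y + hdist n y z := by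
  have ha := hdist_nonneg hx hy
  have hb := hdist_nonneg hy hz
  have hc := hdist_nonneg hx hz
  rw [← abs_of_nonneg hc, ← abs_of_nonneg (add_nonneg ha hb), ← Real.cosh_le_cosh,
    Real.cosh_add]
  have e1 := cosh_hdist hx hy
  have e2 := cosh_hdist hy hz
  have e3 := cosh_hdist hx hz
  have hs1 := Real.cosh_sq (hdist n x y)
  have hs2 := Real.cosh_sq (hdist n y z)
  have p1 := Real.sinh_nonneg_iff.mpr ha
  have p2 := Real.sinh_nonneg_iff.mpr hb
  generalize hdist n x y = a at *
  generalize hdist n y z = b at *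
  rw [e3]
  set p := form n x y with hp
  set r := form n y z with hr
  have hzy : form n z y = r := form_comm _ _ _
  have hv : form n (x + (-p) • y) y = 0 := by
    rw [form_add_left, form_smul_left, hy.1]; ring
  have hw : form n (z + (-r) • y) y = 0 := by
    rw [form_add_left, form_smul_left, hy.1, hzy]; ring
  have h := form_sq_le hy hv hw
  simp only [form_add_left, form_add_right, form_smul_left, form_smul_right, hx.1, hy.1, hz.1,
    form_comm n y x, form_comm n z y, ← hr, ← hp] at h
  have h2 : (form n x z - p * r) ^ 2 ≤ (Real.sinh a * Real.sinh b) ^ 2 := by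
    have e4 : Real.sinh a ^ 2 = p ^ 2 - 1 := by rw [← e1]; linarith
    have e5 : Real.sinh b ^ 2 = r ^ 2 - 1 := by rw [← e2]; linarith
    rw [mul_pow, e4, e5]
    nlinarith
  have h3 := (abs_le.mp (abs_le_of_sq_le_sq h2 (mul_nonneg p1 p2))).2
  rw [e1, e2]
  linarith

/-- A point at distance `N` from the base point on the geodesic to `y`. -/
theorem exists_between {n : ℕ} {y : Idx n → ℝ} (hy : y ∈ hyperboloid n) (N : ℝ) (hN : 0 ≤ N)
    (h : hdist n (basePt n) y ≤ N + 1) :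
    ∃ z ∈ hyperboloid n, hdist n (basePt n) z ≤ N ∧ hdist n z y ≤ 1 := by
  have hb := basePt_mem n
  rcases le_or_gt (hdist n (basePt n) y) N with h1 | h1
  · exact ⟨y, hy, h1, by rw [hdist_self hy]; norm_num⟩
  have e1 := cosh_hdist hb hy
  set t := hdist n (basePt n) y with ht
  have hs : 0 < Real.sinh t := Real.sinh_pos_iff.mpr (by linarith)
  have hs2 := Real.cosh_sq t
  have hN2 := Real.cosh_sq N
  -- The point of the geodesic at distance N is (sinh N / sinh t) y + (sinh(t - N) / sinh t) e_0;
  -- the second coefficient equals cosh N - q cosh t.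
  set q := Real.sinh N / Real.sinh t with hq
  have hqs : q * Real.sinh t = Real.sinh N := div_mul_cancel₀ _ hs.ne'
  set z : Idx n → ℝ := q • y + (Real.cosh N - q * Real.cosh t) • basePt n with hz
  have hyb : form n y (basePt n) = Real.cosh t := by rw [form_comm, e1]
  have hz1 : form n z z = 1 := by
    rw [hz]
    simp only [form_add_left, form_add_right, form_smul_left, form_smul_right, hy.1, hb.1, hyb, ← e1]
    have : q ^ 2 * (Real.cosh t ^ 2 - 1) = Real.cosh N ^ 2 - 1 := by
      rw [hs2, hN2, add_sub_cancel_right, add_sub_cancel_right, ← mul_pow, hqs]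
    linear_combination -this
  have hbz : form n (basePt n) z = Real.cosh N := by
    rw [hz, form_add_right, form_smul_right, form_smul_right, ← e1, hb.1]; ring
  have hz0 : 0 < z 0 := by
    rw [← form_basePt_left n z, hbz]; exact Real.cosh_pos N
  refine ⟨z, ⟨hz1, hz0⟩, ?_, ?_⟩
  · rw [hdist, hbz, Real.arcosh_cosh hN]
  · have : form n z y = Real.cosh (t - N) := by
      rw [hz, form_add_left, form_smul_left, form_smul_left, ← e1, hy.1, Real.cosh_sub, ← hqs]
      have : Real.sinh t ^ 2 = Real.cosh t ^ 2 - 1 := by linarith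
      linear_combination q * this
    rw [hdist, this, Real.arcosh_cosh (by linarith)]
    linarith

/-! ### Discrete cocompact groups acting on hyperbolic space: words and translation lengths -/

namespace HypGroup

variable {n : ℕ} {L : HypGroup n}

theorem hdist_cov (L : HypGroup n) (g : L.G) (x y : Idx n → ℝ) :
    hdist n (L.cov g *ᵥ x) (L.cov g *ᵥ y) = hdist n x y := by
  rw [hdist, form_mulVec_mulVec (L.cov_isometry g), hdist]

theorem cov_mul_mulVec (L : HypGroup n) (g h : L.G) (x : Idx n → ℝ) :
    L.cov (g * h) *ᵥ x = L.cov g *ᵥ L.cov h *ᵥ x := by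
  rw [map_mul, Matrix.mulVec_mulVec]

/-- The images of the sets {g : g₀₀ < k} form an increasing open cover of the compact quotient Γ\G,
so one of them is everything. As g₀₀ is the hyperbolic cosine of the displacement of the base point,
this bounds the distance from the base point to every orbit. -/
theorem IsProper.exists_close (hL : L.IsProper) (Γ : Subgroup L.G)
    (hΓ : CompactSpace (MulAction.orbitRel.Quotient Γ L.G)) :
    ∃ D : ℝ, ∀ x ∈ hyperboloid n, ∃ γ : Γ, hdist n (basePt n) (L.cov γ *ᵥ x) ≤ D := by
  have hcont : ∀ γ : L.G, Continuous fun g => L.cov (γ * g) 0 0 := by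
    intro γ
    have : (fun g => L.cov (γ * g) 0 0) = fun g => (L.cov γ * L.cov g) 0 0 := by
      funext g; rw [map_mul]
    rw [this]
    exact (continuous_const.matrix_mul hL.continuous_cov).matrix_elem 0 0
  let q : L.G → MulAction.orbitRel.Quotient Γ L.G := Quotient.mk _
  let V : ℕ → Set (MulAction.orbitRel.Quotient Γ L.G) := fun k =>
    q '' {g | L.cov g 0 0 < k}
  have hV : ∀ k, IsOpen (V k) := by
    intro k
    refine isOpen_coinduced.mpr ?_
    have : q ⁻¹' V k = ⋃ γ : Γ, {g | L.cov (γ * g) 0 0 < k} := by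
      ext g
      simp only [Set.mem_preimage, Set.mem_iUnion, V, Set.mem_image, Set.mem_ofPred_eq]
      constructor
      · rintro ⟨h, hh, he⟩
        obtain ⟨γ, hγ⟩ := MulAction.orbitRel_apply.mp (Quotient.exact he)
        refine ⟨γ, ?_⟩
        change (γ : L.G) * g = h at hγ
        rw [hγ]; exact hh
      · rintro ⟨γ, hγ⟩
        refine ⟨γ * g, hγ, Quotient.sound ?_⟩
        exact MulAction.orbitRel_apply.mpr ⟨γ, rfl⟩
    change IsOpen (q ⁻¹' V k)
    rw [this]
    exact isOpen_iUnion fun γ => isOpen_lt (hcont γ) continuous_const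
  have hcover : (Set.univ : Set (MulAction.orbitRel.Quotient Γ L.G)) ⊆ ⋃ k, V k := by
    intro p _
    obtain ⟨g, rfl⟩ := Quotient.exists_rep p
    obtain ⟨k, hk⟩ := exists_nat_gt (L.cov g 0 0)
    exact Set.mem_iUnion.mpr ⟨k, g, hk, rfl⟩
  have hmono : Monotone V := fun k l hkl => Set.image_mono fun g hg =>
    lt_of_lt_of_le (show L.cov g 0 0 < k from hg) (by exact_mod_cast hkl)
  obtain ⟨k, hk⟩ := isCompact_univ.elim_directed_cover V hV hcover hmono.directed_le
  refine ⟨Real.arcosh (k + 1), fun x hx => ?_⟩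
  obtain ⟨g, hg⟩ := hL.transitive x hx
  obtain ⟨h, hh, he⟩ := hk (Set.mem_univ (q g))
  obtain ⟨γ, hγ⟩ := MulAction.orbitRel_apply.mp (Quotient.exact he)
  change (γ : L.G) * g = h at hγ
  refine ⟨γ, ?_⟩
  have hmem := hL.mulVec_mem γ x hx
  have e : form n (basePt n) (L.cov γ *ᵥ x) = L.cov h 0 0 := by
    rw [form_basePt_left, ← hg, ← cov_mul_mulVec, hγ, mulVec_basePt]
  have h1 := one_le_form (basePt_mem n) hmem
  rw [hdist]
  refine (Real.arcosh_le_arcosh (by linarith) (by positivity)).mpr ?_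
  rw [e]
  have : L.cov h 0 0 < k := hh
  linarith

theorem length_nonneg (hL : L.IsProper) (g : L.G) : 0 ≤ L.length g :=
  Real.iInf_nonneg fun x => hdist_nonneg x.2 (hL.mulVec_mem g _ x.2)

theorem exists_hdist_lt (L : HypGroup n) (g : L.G) {r : ℝ} (h : L.length g < r) :
    ∃ x ∈ hyperboloid n, hdist n x (L.cov g *ᵥ x) < r := by
  have : Nonempty (hyperboloid n) := ⟨⟨_, basePt_mem n⟩⟩
  obtain ⟨x, hx⟩ := exists_lt_of_ciInf_lt h
  exact ⟨x.1, x.2, hx⟩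

theorem IsProper.finite_displacement (hL : L.IsProper) {Γ : Subgroup L.G} (hΓ : DiscreteTopology Γ) (R : ℝ) :
    {γ : Γ | hdist n (basePt n) (L.cov γ *ᵥ basePt n) ≤ R}.Finite := by
  refine (hL.finite Γ hΓ (Real.cosh R)).subset fun γ hγ => ?_
  have hb := basePt_mem n
  have h0 := hdist_nonneg hb (hL.mulVec_mem γ _ hb)
  have h1 := cosh_hdist hb (hL.mulVec_mem γ _ hb)
  rw [form_basePt_left, mulVec_basePt] at h1
  change L.cov γ 0 0 ≤ _
  rw [← h1, Real.cosh_le_cosh, abs_of_nonneg h0]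
  exact (show _ ≤ R from hγ).trans (le_abs_self R)

/-- Walk from y to the base point in steps of length at most 1 and choose near each stop an orbit
point at distance at most D. Consecutive orbit points are at distance at most 2D + 1, so the
elements linking them, the letters of the word, come from a fixed set, finite when Γ is discrete. -/
theorem IsProper.exists_word (hL : L.IsProper) {Γ : Subgroup L.G} {D : ℝ}
    (hD : ∀ x ∈ hyperboloid n, ∃ γ : Γ, hdist n (basePt n) (L.cov γ *ᵥ x) ≤ D) (N : ℕ) : ∀ y ∈ hyperboloid n, hdist n (basePt n) y ≤ N → ∀ γ : Γ,
    hdist n y (L.cov γ *ᵥ basePt n) ≤ D → ∃ w : List Γ,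
      (∀ t ∈ w, hdist n (basePt n) (L.cov t *ᵥ basePt n) ≤ 2 * D + 1) ∧ w.prod = γ ∧
        w.length ≤ N + 1 := by
  have hb := basePt_mem n
  have hD0 : 0 ≤ D := by
    obtain ⟨γ, hγ⟩ := hD _ hb
    exact (hdist_nonneg hb (hL.mulVec_mem γ _ hb)).trans hγ
  induction N with
  | zero =>
    intro y hy h0 γ hγ
    refine ⟨[γ], ?_, by simp, by simp⟩
    intro t ht
    rw [List.mem_singleton] at ht
    subst ht
    have := hdist_triangle hb hy (hL.mulVec_mem t _ hb)
    push_cast at h0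
    linarith
  | succ N ih =>
    intro y hy h0 γ hγ
    push_cast at h0
    obtain ⟨z, hz, hz1, hz2⟩ := exists_between hy N (Nat.cast_nonneg N) h0
    obtain ⟨δ, hδ⟩ := hD z hz
    have hδ' : hdist n z (L.cov (δ⁻¹ : Γ) *ᵥ basePt n) ≤ D := by
      rw [← L.hdist_cov δ, ← cov_mul_mulVec, Subgroup.coe_inv, mul_inv_cancel, map_one,
        Matrix.one_mulVec, hdist_comm]
      exact hδ
    obtain ⟨w, hw1, hw2, hw3⟩ := ih z hz hz1 δ⁻¹ hδ'
    refine ⟨w ++ [δ * γ], ?_, ?_, ?_⟩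
    · intro t ht
      rw [List.mem_append, List.mem_singleton] at ht
      rcases ht with ht | rfl
      · exact hw1 t ht
      · have e : hdist n (basePt n) (L.cov ((δ * γ : Γ) : L.G) *ᵥ basePt n) =
            hdist n (L.cov (δ⁻¹ : Γ) *ᵥ basePt n) (L.cov γ *ᵥ basePt n) := by
          rw [← L.hdist_cov (δ : L.G) (L.cov ((δ⁻¹ : Γ) : L.G) *ᵥ basePt n), ← cov_mul_mulVec,
            ← cov_mul_mulVec, Subgroup.coe_inv, mul_inv_cancel, map_one, Matrix.one_mulVec, Subgroup.coe_mul]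
        rw [e]
        have m1 := hL.mulVec_mem (δ⁻¹ : Γ) _ hb
        have m2 := hL.mulVec_mem γ _ hb
        have t1 := hdist_triangle m1 hz m2
        have t2 := hdist_triangle hz hy m2
        rw [hdist_comm n _ z] at t1
        linarith
    · rw [List.prod_append, hw2, List.prod_singleton, inv_mul_cancel_left]
    · rw [List.length_append, List.length_singleton]; omega

/-- The infimum defining the length is only approached, hence r. Conjugation by δ moves the nearly
optimal point into the ball of radius D. -/
theorem IsProper.exists_conj_close (hL : L.IsProper) {Γ : Subgroup L.G} {D : ℝ}
    (hD : ∀ x ∈ hyperboloid n, ∃ γ : Γ, hdist n (basePt n) (L.cov γ *ᵥ x) ≤ D)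
    (γ : Γ) {r : ℝ} (h : L.length γ < r) :
    ∃ δ : Γ, ∃ x ∈ hyperboloid n, hdist n (basePt n) x ≤ D ∧
      hdist n x (L.cov (δ * γ * δ⁻¹ : Γ) *ᵥ x) < r := by
  obtain ⟨x, hx, hx1⟩ := L.exists_hdist_lt γ h
  obtain ⟨δ, hδ⟩ := hD x hx
  refine ⟨δ, L.cov δ *ᵥ x, hL.mulVec_mem _ _ hx, hδ, ?_⟩
  have e : ((δ * γ * δ⁻¹ : Γ) : L.G) * δ = δ * γ := by
    rw [← Subgroup.coe_mul, inv_mul_cancel_right, Subgroup.coe_mul]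
  rw [← cov_mul_mulVec, e, cov_mul_mulVec, hdist_cov]
  exact hx1

/-- A conjugacy class of translation length `l` has a representative that is a product of at most
`l + B` elements of a fixed finite set. -/
theorem IsProper.exists_conj_word (hL : L.IsProper) (Γ : Subgroup L.G)
    (hΓ : DiscreteTopology Γ) (hc : CompactSpace (MulAction.orbitRel.Quotient Γ L.G)) :
    ∃ (T : Finset Γ) (B : ℝ), ∀ γ : Γ, ∃ (δ : Γ) (w : List Γ), (∀ t ∈ w, t ∈ T) ∧
      w.prod = δ * γ * δ⁻¹ ∧ (w.length : ℝ) ≤ L.length γ + B := by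
  obtain ⟨D, hD⟩ := hL.exists_close Γ hc
  -- A suitable conjugate moves the base point by at most 2D + l + 1; rounding up to an integer
  -- costs less than 1, and the word has one letter more than there are steps.
  refine ⟨(hL.finite_displacement hΓ (2 * D + 1)).toFinset, 2 * D + 3, fun γ => ?_⟩
  have hb := basePt_mem n
  obtain ⟨δ, x, hx, hx1, hx2⟩ := hL.exists_conj_close hD γ (lt_add_one (L.length γ))
  set γ' := δ * γ * δ⁻¹ with hγ'
  have hy := hL.mulVec_mem γ' _ hb
  have h1 : hdist n (basePt n) (L.cov γ' *ᵥ basePt n) ≤ 2 * D + L.length γ + 1 := by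
    have m := hL.mulVec_mem γ' _ hx
    have t1 := hdist_triangle hb hx hy
    have t2 := hdist_triangle hx m hy
    have t3 := L.hdist_cov γ' x (basePt n)
    rw [hdist_comm n x (basePt n)] at t3
    linarith
  obtain ⟨ε, hε⟩ := hD _ hb
  have hD0 : 0 ≤ D := (hdist_nonneg hb (hL.mulVec_mem ε _ hb)).trans hε
  have hl := length_nonneg hL (γ : L.G)
  obtain ⟨w, hw1, hw2, hw3⟩ := hL.exists_word hD ⌈2 * D + L.length γ + 1⌉₊ _ hy
    (h1.trans (Nat.le_ceil _)) γ' (by rw [hdist_self hy]; exact hD0)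
  refine ⟨δ, w, fun t ht => ?_, hw2, ?_⟩
  · rw [Set.Finite.mem_toFinset]; exact hw1 t ht
  · have h2 : (w.length : ℝ) ≤ (⌈2 * D + L.length γ + 1⌉₊ : ℝ) + 1 := by exact_mod_cast hw3
    have h3 := Nat.ceil_lt_add_one (show 0 ≤ 2 * D + L.length γ + 1 by linarith)
    linarith

/-- The translation lengths of the non-trivial elements are bounded below. -/
theorem IsProper.exists_le_length (hL : L.IsProper) (Γ : Subgroup L.G)
    (hΓ : DiscreteTopology Γ) (hc : CompactSpace (MulAction.orbitRel.Quotient Γ L.G))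
    (ht : ∀ γ : Γ, γ ≠ 1 → ∀ k : ℕ, 0 < k → γ ^ k ≠ 1) :
    ∃ ε > 0, ∀ γ : Γ, γ ≠ 1 → ε ≤ L.length γ := by
  obtain ⟨D, hD⟩ := hL.exists_close Γ hc
  have hfin := hL.finite_displacement hΓ (2 * D + 1)
  set F := hfin.toFinset.card
  -- F is the number of elements moving the base point by at most 2D + 1. If γ had length below 1/(F
  -- + 1), the powers 0, …, F of a conjugate would move x by at most 1, hence the base point by at
  -- most 2D + 1. Two of these F + 1 powers would coincide, giving torsion.
  refine ⟨1 / (F + 1), by positivity, fun γ hγ => ?_⟩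
  by_contra! hlt
  have hb := basePt_mem n
  obtain ⟨δ, x, hx, hx1, hx2⟩ := hL.exists_conj_close hD γ hlt
  set γ' := δ * γ * δ⁻¹ with hγ'
  have hpow : ∀ m : ℕ, hdist n x (L.cov (γ' ^ m : Γ) *ᵥ x) ≤ m * (1 / (F + 1)) := by
    intro m
    induction m with
    | zero => simp [hdist_self hx]
    | succ m ih =>
      have m1 := hL.mulVec_mem (γ' ^ m : Γ) _ hx
      have m2 := hL.mulVec_mem (γ' ^ (m + 1) : Γ) _ hx
      have t := hdist_triangle hx m1 m2
      have e : hdist n (L.cov (γ' ^ m : Γ) *ᵥ x) (L.cov (γ' ^ (m + 1) : Γ) *ᵥ x) =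
          hdist n x (L.cov γ' *ᵥ x) := by
        rw [pow_succ, Subgroup.coe_mul, cov_mul_mulVec, hdist_cov]
      rw [Nat.cast_succ]
      linarith
  have hmaps : ∀ m : Fin (F + 1), γ' ^ (m : ℕ) ∈ hfin.toFinset := by
    intro m
    rw [Set.Finite.mem_toFinset]
    have m1 := hL.mulVec_mem (γ' ^ (m : ℕ) : Γ) _ hx
    have m2 := hL.mulVec_mem (γ' ^ (m : ℕ) : Γ) _ hb
    have t1 := hdist_triangle hb hx m2
    have t2 := hdist_triangle hx m1 m2
    have t3 := L.hdist_cov (γ' ^ (m : ℕ) : Γ) x (basePt n)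
    rw [hdist_comm n x (basePt n)] at t3
    have hm : (m : ℝ) * (1 / (F + 1)) ≤ 1 := by
      rw [mul_one_div, div_le_one (by positivity)]
      exact_mod_cast m.2.le
    have := hpow m
    change hdist n (basePt n) (L.cov (γ' ^ (m : ℕ) : Γ) *ᵥ basePt n) ≤ 2 * D + 1
    linarith
  obtain ⟨i, -, j, -, hij, he⟩ := Finset.exists_ne_map_eq_of_card_lt_of_maps_to
    (s := (Finset.univ : Finset (Fin (F + 1)))) (t := hfin.toFinset)
    (by rw [Finset.card_fin]; exact Nat.lt_succ_self _) (f := fun m => γ' ^ (m : ℕ))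
    (fun m _ => hmaps m)
  have hγ'1 : γ' ≠ 1 := by
    intro h
    rw [hγ', conj_eq_one_iff] at h
    exact hγ h
  have key : ∀ i j : Fin (F + 1), i < j → γ' ^ (i : ℕ) = γ' ^ (j : ℕ) → False := by
    intro i j hij he
    have hij' : (i : ℕ) < j := hij
    refine ht γ' hγ'1 ((j : ℕ) - i) (by omega) ?_
    have : γ' ^ (j : ℕ) = γ' ^ ((j : ℕ) - i) * γ' ^ (i : ℕ) := by
      rw [← pow_add]; congr 1; omega
    rw [← he] at this
    exact (mul_eq_right.mp this.symm)
  rcases lt_or_gt_of_ne hij with h | h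
  · exact key i j h he
  · exact key j i h he.symm

end HypGroup

/-! ### Representatives of prime classes -/

theorem PrimeClass.elt_ne_one {Γ : Type} [Group Γ] (c : PrimeClass Γ) : c.elt ≠ 1 := by
  intro h
  have h1 : ConjClasses.mk c.elt = c.1 := (ConjClasses.exists_rep c.1).choose_spec
  rw [h] at h1
  exact c.2.1 (by rw [← h1]; rfl)

theorem PrimeClass.eq_of_isConj {Γ : Type} [Group Γ] {c d : PrimeClass Γ}
    (h : IsConj c.elt d.elt) : c = d := by
  have h1 : ConjClasses.mk c.elt = c.1 := (ConjClasses.exists_rep c.1).choose_spec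
  have h2 : ConjClasses.mk d.elt = d.1 := (ConjClasses.exists_rep d.1).choose_spec
  apply Subtype.ext
  rw [← h1, ← h2]
  exact ConjClasses.mk_eq_mk_iff_isConj.mpr h

/-! ### Absolutely convergent products -/

section AbsConv

variable {ι κ : Type} {f : ι → ℂ}

theorem AbsConvProd.multipliable (h : AbsConvProd f) : Multipliable f := by
  have := multipliable_one_add_of_summable (f := fun i => f i - 1) h
  simpa using this

theorem AbsConvProd.tprod_ne_zero (h : AbsConvProd f) (h0 : ∀ i, f i ≠ 0) : ∏' i, f i ≠ 0 := by
  have := tprod_one_add_ne_zero_of_summable (f := fun i => f i - 1) (by simpa using h0) h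
  simpa using this

theorem AbsConvProd.comp_injective (h : AbsConvProd f) {e : κ → ι} (he : Function.Injective e) :
    AbsConvProd fun k => f (e k) :=
  Summable.comp_injective (f := fun i => ‖f i - 1‖) h he

/-- From e^S - 1 ≤ S e^S, where the exponential is bounded because each S i is at most the total
sum. -/
theorem summable_exp_sub_one {S : ι → ℝ} (hS : Summable S) (h0 : ∀ i, 0 ≤ S i) :
    Summable fun i => Real.exp (S i) - 1 := by
  refine Summable.of_nonneg_of_le (fun i => ?_) (fun i => ?_) (hS.mul_right (Real.exp (∑' i, S i)))
  · have := Real.one_le_exp (h0 i)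
    linarith
  · have h1 : Real.exp (S i) - 1 ≤ S i * Real.exp (S i) := by
      have h2 := Real.add_one_le_exp (-S i)
      have h3 : Real.exp (-S i) * Real.exp (S i) = 1 := by rw [← Real.exp_add]; simp
      nlinarith [Real.exp_pos (S i)]
    refine h1.trans (mul_le_mul_of_nonneg_left ?_ (h0 i))
    exact Real.exp_le_exp.mpr (hS.le_tsum i fun j _ => h0 j)

theorem norm_prod_sub_one_le {β : Type} [Fintype β] (f : β → ℂ) :
    ‖∏ b, f b - 1‖ ≤ Real.exp (∑ b, ‖f b - 1‖) - 1 := by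
  have := Finset.norm_prod_one_add_sub_one_le Finset.univ fun b => f b - 1
  simpa using this

/-- Products of finite blocks of factors. -/
theorem AbsConvProd.of_block {β : ι → Type} [∀ i, Fintype (β i)] {f : ∀ i, β i → ℂ}
    (h : Summable fun i => ∑ b, ‖f i b - 1‖) : AbsConvProd fun i => ∏ b, f i b :=
  Summable.of_nonneg_of_le (fun _ => norm_nonneg _) (fun _ => norm_prod_sub_one_le _)
    (summable_exp_sub_one h fun _ => Finset.sum_nonneg fun _ _ => norm_nonneg _)

theorem AbsConvProd.hasProd_prod {f : ι × κ → ℂ} (h : AbsConvProd f) :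
    HasProd (fun i => ∏' k, f (i, k)) (∏' p, f p) :=
  h.multipliable.hasProd.prod_fiberwise fun i =>
    (h.comp_injective (e := fun k => (i, k)) (Prod.mk_right_injective i)).multipliable.hasProd

end AbsConv

/-! ### The local product formula -/

section Local

/-- The monomial `b ^ α`. -/
def monom {κ : Type} (b : κ → ℂ) (α : κ →₀ ℕ) : ℂ := α.prod fun i m => b i ^ m

theorem monom_single {κ : Type} (b : κ → ℂ) (a : κ) : monom b (Finsupp.single a 1) = b a := by
  rw [monom, Finsupp.prod_single_index (h := fun i m => b i ^ m) (pow_zero _), pow_one]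

variable {κ : Type} [Fintype κ]

/-- A finite partial sum is contained in the expansion of ∏_i (1 + q + ⋯ + q^{N-1}), which is at
most (1 - q)^{-|κ|}. -/
theorem summable_prod_pow {q : ℝ} (hq : 0 ≤ q) (hq1 : q < 1) :
    Summable fun α : κ →₀ ℕ => q ^ α.degree := by
  classical
  refine summable_of_sum_le (c := ∏ _i : κ, (1 - q)⁻¹) (fun α => pow_nonneg hq _) fun s => ?_
  obtain ⟨N, hN⟩ : ∃ N : ℕ, ∀ α ∈ s, ∀ i, α i < N := by
    refine ⟨s.sup (fun α => Finset.univ.sup fun i => α i) + 1, fun α hα i => ?_⟩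
    have h1 := Finset.le_sup (f := fun i => α i) (Finset.mem_univ i)
    have h2 := Finset.le_sup (f := fun α : κ →₀ ℕ => Finset.univ.sup fun i => α i) hα
    exact Nat.lt_succ_of_le (h1.trans h2)
  have h1 : ∑ α ∈ s, q ^ α.degree = ∑ p ∈ s.image (DFunLike.coe : (κ →₀ ℕ) → κ → ℕ), ∏ i, q ^ p i := by
    rw [Finset.sum_image (fun a _ b _ h => DFunLike.coe_injective h)]
    refine Finset.sum_congr rfl fun α _ => ?_
    rw [Finset.prod_pow_eq_pow_sum, Finsupp.degree_eq_sum]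
  have h2 : s.image (DFunLike.coe : (κ →₀ ℕ) → κ → ℕ) ⊆ Fintype.piFinset fun _ => Finset.range N := by
    intro p hp
    obtain ⟨α, hα, rfl⟩ := Finset.mem_image.mp hp
    exact Fintype.mem_piFinset.mpr fun i => Finset.mem_range.mpr (hN α hα i)
  rw [h1]
  refine (Finset.sum_le_sum_of_subset_of_nonneg h2 fun p _ _ =>
    Finset.prod_nonneg fun i _ => pow_nonneg hq _).trans ?_
  rw [← Finset.prod_univ_sum]
  refine Finset.prod_le_prod (fun i _ => Finset.sum_nonneg fun j _ => pow_nonneg hq _) fun i _ => ?_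
  rw [← tsum_geometric_of_lt_one hq hq1]
  exact (summable_geometric_of_lt_one hq hq1).sum_le_tsum _ fun j _ => pow_nonneg hq _

theorem monom_eq (b : κ → ℂ) (α : κ →₀ ℕ) : monom b α = ∏ i, b i ^ α i :=
  Finsupp.prod_fintype _ _ fun _ => pow_zero _

theorem norm_monom_le {b : κ → ℂ} {q : ℝ} (hb : ∀ i, ‖b i‖ ≤ q) (α : κ →₀ ℕ) :
    ‖monom b α‖ ≤ q ^ α.degree := by
  rw [monom_eq, norm_prod, Finsupp.degree_eq_sum, ← Finset.prod_pow_eq_pow_sum]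
  refine Finset.prod_le_prod (fun i _ => norm_nonneg _) fun i _ => ?_
  rw [norm_pow]
  exact pow_le_pow_left₀ (norm_nonneg _) (hb i) _

theorem monom_add (b : κ → ℂ) (α β : κ →₀ ℕ) : monom b (α + β) = monom b α * monom b β := by
  simp only [monom_eq, Finsupp.add_apply, pow_add, Finset.prod_mul_distrib]

variable {g : ℂ → ℂ} {K r q : ℝ} {b : κ → ℂ}

theorem summable_norm_sub_one (hg : ∀ x, ‖x‖ ≤ r → ‖g x - 1‖ ≤ K * ‖x‖) (hK : 0 ≤ K)
    (hq : 0 ≤ q) (hq1 : q < 1) (hb : ∀ i, ‖b i‖ ≤ q) {y : ℂ} (hy : ‖y‖ ≤ r) :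
    AbsConvProd fun α : κ →₀ ℕ => g (y * monom b α) := by
  refine Summable.of_nonneg_of_le (fun _ => norm_nonneg _) (fun α => ?_)
    ((summable_prod_pow hq hq1).mul_left (K * ‖y‖))
  have h1 := norm_monom_le hb α
  have h2 : ‖y * monom b α‖ ≤ ‖y‖ * q ^ α.degree := by
    rw [norm_mul]; exact mul_le_mul_of_nonneg_left h1 (norm_nonneg _)
  have h3 : ‖y‖ * q ^ α.degree ≤ r :=
    (mul_le_of_le_one_right (norm_nonneg _) (pow_le_one₀ hq hq1.le)).trans hy
  refine (hg _ (h2.trans h3)).trans ?_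
  rw [mul_assoc]
  exact mul_le_mul_of_nonneg_left h2 hK

theorem norm_mul_monom_le (hq : 0 ≤ q) (hq1 : q < 1) (hb : ∀ i, ‖b i‖ ≤ q) {y : ℂ}
    (hy : ‖y‖ ≤ r) (α : κ →₀ ℕ) : ‖y * monom b α‖ ≤ r := by
  rw [norm_mul]
  refine (mul_le_of_le_one_right (norm_nonneg _) ?_).trans hy
  exact (norm_monom_le hb α).trans (pow_le_one₀ hq hq1.le)

/-- The product of the `g (y b^α)` over the `α` supported in `S`. -/
def partialProd [DecidableEq κ] (g : ℂ → ℂ) (b : κ → ℂ) (S : Finset κ) (y : ℂ) : ℂ :=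
  ∏' α : κ →₀ ℕ, if α.support ⊆ S then g (y * monom b α) else 1

variable [DecidableEq κ]

theorem absConv_partial (hg : ∀ x, ‖x‖ ≤ r → ‖g x - 1‖ ≤ K * ‖x‖) (hK : 0 ≤ K)
    (hq : 0 ≤ q) (hq1 : q < 1) (hb : ∀ i, ‖b i‖ ≤ q) {y : ℂ} (hy : ‖y‖ ≤ r) (S : Finset κ) :
    AbsConvProd fun α : κ →₀ ℕ => if α.support ⊆ S then g (y * monom b α) else 1 := by
  refine Summable.of_nonneg_of_le (fun _ => norm_nonneg _) (fun α => ?_)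
    (summable_norm_sub_one hg hK hq hq1 hb hy)
  dsimp only
  split_ifs
  · exact le_rfl
  · simp

theorem partialProd_ne_zero (hg : ∀ x, ‖x‖ ≤ r → ‖g x - 1‖ ≤ K * ‖x‖)
    (hg0 : ∀ x, ‖x‖ ≤ r → g x ≠ 0) (hK : 0 ≤ K)
    (hq : 0 ≤ q) (hq1 : q < 1) (hb : ∀ i, ‖b i‖ ≤ q) {y : ℂ} (hy : ‖y‖ ≤ r) (S : Finset κ) :
    partialProd g b S y ≠ 0 := by
  refine (absConv_partial hg hK hq hq1 hb hy S).tprod_ne_zero fun α => ?_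
  split_ifs
  · exact hg0 _ (norm_mul_monom_le hq hq1 hb hy α)
  · exact one_ne_zero

/-- Split the multi-indices supported in S ∪ {a} by whether α_a = 0. Those with α_a > 0 are β + δ_a
with β again supported in S ∪ {a}, and b^α = b_a b^β. This is the multiplicative form of 1/(1 - b_a)
= 1 + b_a/(1 - b_a). -/
theorem partialProd_insert (hg : ∀ x, ‖x‖ ≤ r → ‖g x - 1‖ ≤ K * ‖x‖) (hK : 0 ≤ K)
    (hq : 0 ≤ q) (hq1 : q < 1) (hb : ∀ i, ‖b i‖ ≤ q) {y : ℂ} (hy : ‖y‖ ≤ r) {S : Finset κ}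
    {a : κ} (ha : a ∉ S) :
    partialProd g b (insert a S) y =
      partialProd g b S y * partialProd g b (insert a S) (y * b a) := by
  set h : (κ →₀ ℕ) → ℂ := fun α =>
    if α.support ⊆ insert a S ∧ α a ≠ 0 then g (y * monom b α) else 1 with hh
  have habs := summable_norm_sub_one hg hK hq hq1 hb hy
  have hh' : AbsConvProd h := by
    refine Summable.of_nonneg_of_le (fun _ => norm_nonneg _) (fun α => ?_) habs
    simp only [hh]
    split_ifs
    · exact le_rfl
    · simp
  have h1 : (fun α : κ →₀ ℕ => if α.support ⊆ insert a S then g (y * monom b α) else 1) =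
      fun α => (if α.support ⊆ S then g (y * monom b α) else 1) * h α := by
    funext α
    simp only [hh]
    by_cases h1 : α a = 0
    · have : α.support ⊆ insert a S ↔ α.support ⊆ S := by
        rw [Finset.subset_insert_iff_of_notMem]
        simpa using h1
      simp [h1, this]
    · have h2 : ¬ α.support ⊆ S := fun hs => ha (hs (by simpa using h1))
      simp [h1, h2]
  have h2 : ∏' α, h α = partialProd g b (insert a S) (y * b a) := by
    have hinj : Function.Injective fun α : κ →₀ ℕ => α + Finsupp.single a 1 :=
      add_left_injective _
    rw [partialProd, ← hinj.tprod_eq]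
    · refine tprod_congr fun α => ?_
      have e1 : (α + Finsupp.single a 1).support ⊆ insert a S ↔ α.support ⊆ insert a S := by
        constructor
        · intro hs i hi
          refine hs ?_
          rw [Finsupp.mem_support_iff] at hi ⊢
          rw [Finsupp.add_apply]; omega
        · intro hs
          refine Finsupp.support_add.trans (Finset.union_subset hs ?_)
          exact Finsupp.support_single_subset.trans (by simp)
      simp only [hh, e1, monom_add, monom_single b a]
      have e2 : (α + Finsupp.single a 1 : κ →₀ ℕ) a ≠ 0 := by simp
      simp only [e2, ne_eq, not_false_eq_true, and_true]
      rw [mul_comm (monom b α), mul_assoc]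
    · intro α hα
      rw [Function.mem_mulSupport] at hα
      have h3 : α a ≠ 0 := by
        intro h3
        exact hα (by simp [hh, h3])
      refine ⟨α - Finsupp.single a 1, ?_⟩
      refine tsub_add_cancel_of_le ?_
      rw [Finsupp.single_le_iff]
      omega
  rw [← h2, partialProd, partialProd, h1]
  exact (absConv_partial hg hK hq hq1 hb hy S).multipliable.tprod_mul hh'.multipliable

/-- Induction on S, pairing I with I ∪ {a}. By `partialProd_insert` the quotient of the two partial
products over S ∪ {a}, at y b^I and at y b^I b_a, is the partial product over S at y b^I. Only α = 0
is left for S = ∅. Non-vanishing is needed for the cancellation. -/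
theorem prod_powerset_partialProd (hg : ∀ x, ‖x‖ ≤ r → ‖g x - 1‖ ≤ K * ‖x‖)
    (hg0 : ∀ x, ‖x‖ ≤ r → g x ≠ 0) (hK : 0 ≤ K)
    (hq : 0 ≤ q) (hq1 : q < 1) (hb : ∀ i, ‖b i‖ ≤ q) {y : ℂ} (hy : ‖y‖ ≤ r) (S : Finset κ) :
    ∏ I ∈ S.powerset, partialProd g b S (y * ∏ i ∈ I, b i) ^ ((-1 : ℤ) ^ I.card) = g y := by
  have hI : ∀ I : Finset κ, ‖y * ∏ i ∈ I, b i‖ ≤ r := by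
    intro I
    rw [norm_mul, norm_prod]
    refine (mul_le_of_le_one_right (norm_nonneg _) ?_).trans hy
    exact Finset.prod_le_one (fun i _ => norm_nonneg _) fun i _ => (hb i).trans hq1.le
  induction S using Finset.induction_on with
  | empty =>
    simp only [Finset.powerset_empty, Finset.prod_singleton, Finset.prod_empty, mul_one,
      Finset.card_empty, pow_zero, zpow_one]
    rw [partialProd, tprod_eq_mulSingle 0]
    · simp [monom]
    · intro α hα
      simp [hα]
  | insert a S ha ih =>
    rw [Finset.prod_powerset_insert ha, ← Finset.prod_mul_distrib, ← ih]
    refine Finset.prod_congr rfl fun I hIS => ?_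
    have haI : a ∉ I := fun h => ha (Finset.mem_powerset.mp hIS h)
    rw [Finset.card_insert_of_notMem haI, pow_succ, mul_neg_one, zpow_neg,
      Finset.prod_insert haI, partialProd_insert hg hK hq hq1 hb (hI I) ha, mul_comm (b a),
      ← mul_assoc, mul_zpow, mul_assoc, mul_inv_cancel₀, mul_one]
    refine zpow_ne_zero _ (partialProd_ne_zero hg hg0 hK hq hq1 hb ?_ _)
    rw [norm_mul]
    exact (mul_le_of_le_one_right (norm_nonneg _) ((hb a).trans hq1.le)).trans (hI I)

/-- The product of the `g (y b^α)` over all `α`. -/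
def fullProd (g : ℂ → ℂ) (b : κ → ℂ) (y : ℂ) : ℂ := ∏' α : κ →₀ ℕ, g (y * monom b α)

/-- The local form of the expression of the Ruelle zeta function by Selberg zeta functions. -/
theorem prod_fullProd (hg : ∀ x, ‖x‖ ≤ r → ‖g x - 1‖ ≤ K * ‖x‖)
    (hg0 : ∀ x, ‖x‖ ≤ r → g x ≠ 0) (hK : 0 ≤ K)
    (hq : 0 ≤ q) (hq1 : q < 1) (hb : ∀ i, ‖b i‖ ≤ q) {y : ℂ} (hy : ‖y‖ ≤ r) :
    ∏ I : Finset κ, fullProd g b (y * ∏ i ∈ I, b i) ^ ((-1 : ℤ) ^ I.card) = g y := by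
  have := prod_powerset_partialProd hg hg0 hK hq hq1 hb hy Finset.univ
  simpa [partialProd, fullProd] using this

end Local

/-! ### Multi-indices sorted by degree -/

section Degree

variable {κ : Type} [Fintype κ]

instance finite_degree (k : ℕ) : Finite {α : κ →₀ ℕ // α.degree = k} :=
  Set.Finite.to_subtype ((Finsupp.finite_of_degree_le k).subset fun α (hα : α.degree = k) => hα.le)

instance fintype_degree (k : ℕ) : Fintype {α : κ →₀ ℕ // α.degree = k} := Fintype.ofFinite _

/-- The multi-indices, sorted by degree. -/
def degreeEquiv (κ : Type) : (Σ k : ℕ, {α : κ →₀ ℕ // α.degree = k}) ≃ (κ →₀ ℕ) :=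
  Equiv.sigmaFiberEquiv Finsupp.degree

theorem tprod_degree {f : (κ →₀ ℕ) → ℂ} (hf : AbsConvProd f) :
    HasProd (fun k : ℕ => ∏ α : {α : κ →₀ ℕ // α.degree = k}, f α.1) (∏' α, f α) := by
  have h1 := (hf.comp_injective (degreeEquiv κ).injective)
  have h2 := h1.multipliable.hasProd.sigma (fun k => hasProd_fintype
    (fun α : {α : κ →₀ ℕ // α.degree = k} => f ((degreeEquiv κ) ⟨k, α⟩)))
  rw [(degreeEquiv κ).tprod_eq f] at h2
  exact h2

theorem summable_card_degree (κ : Type) [Fintype κ] {q : ℝ} (hq : 0 ≤ q) (hq1 : q < 1) :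
    Summable fun k : ℕ => (Fintype.card {α : κ →₀ ℕ // α.degree = k} : ℝ) * q ^ k := by
  have h := (degreeEquiv κ).summable_iff.mpr (summable_prod_pow (κ := κ) hq hq1)
  have h2 := h.sigma
  refine h2.congr fun k => ?_
  rw [tsum_fintype]
  have : ∀ α : {α : κ →₀ ℕ // α.degree = k},
      ((fun α : κ →₀ ℕ => q ^ α.degree) ∘ degreeEquiv κ) ⟨k, α⟩ = q ^ k := fun α => by
    have : degreeEquiv κ ⟨k, α⟩ = α.1 := rfl
    rw [Function.comp_apply, this, α.2]
  rw [Finset.sum_congr rfl fun α _ => this α, Finset.sum_const, Finset.card_univ, nsmul_eq_mul]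

end Degree

/-! ### Growth of the representation and of the number of prime classes -/

theorem exists_det_one_sub_bound (ι : Type) [Fintype ι] [DecidableEq ι] :
    ∃ K r : ℝ, 0 ≤ K ∧ 0 < r ∧ ∀ X : ι → ι → ℂ, ‖X‖ ≤ r →
      ‖(1 - Matrix.of X).det - 1‖ ≤ K * ‖X‖ ∧ (1 - Matrix.of X).det ≠ 0 := by
  have hd : Differentiable ℂ fun X : ι → ι → ℂ => (1 - Matrix.of X).det := by
    simp only [Matrix.det_apply, Matrix.sub_apply, Matrix.of_apply]
    fun_prop
  obtain ⟨K, hK0, hK⟩ := (hd 0).isBigO_sub.exists_nonneg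
  have hK' := hK.bound
  simp only [sub_zero] at hK'
  have h0 : (1 - Matrix.of (0 : ι → ι → ℂ)).det = 1 := by
    rw [Matrix.of_zero, sub_zero, Matrix.det_one]
  rw [h0] at hK'
  obtain ⟨r, hr, h⟩ := Metric.eventually_nhds_iff_ball.mp hK'
  -- The second bound on the radius forces K‖X‖ < 1, so the determinant stays away from 0.
  refine ⟨K, min (r / 2) (1 / (2 * (K + 1))), hK0, by positivity, fun X hX => ?_⟩
  have h1 : ‖(1 - Matrix.of X).det - 1‖ ≤ K * ‖X‖ := by
    refine h X ?_
    rw [mem_ball_zero_iff]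
    have := hX.trans (min_le_left _ _)
    linarith
  refine ⟨h1, fun h2 => ?_⟩
  rw [h2, zero_sub, norm_neg, norm_one] at h1
  have h3 := hX.trans (min_le_right _ _)
  rw [le_div_iff₀ (by positivity)] at h3
  nlinarith [norm_nonneg X]

theorem norm_matrix_mul_le {ι : Type} [Fintype ι] (X Y : Matrix ι ι ℂ) :
    ‖(fun i j => (X * Y) i j : ι → ι → ℂ)‖ ≤
      Fintype.card ι * ‖(fun i j => X i j : ι → ι → ℂ)‖ * ‖(fun i j => Y i j : ι → ι → ℂ)‖ := by
  have hentry : ∀ (Z : ι → ι → ℂ) i j, ‖Z i j‖ ≤ ‖Z‖ := fun Z i j =>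
    (norm_le_pi_norm (Z i) j).trans (norm_le_pi_norm Z i)
  have h0 : 0 ≤ (Fintype.card ι : ℝ) * ‖(fun i j => X i j : ι → ι → ℂ)‖ *
      ‖(fun i j => Y i j : ι → ι → ℂ)‖ := by positivity
  refine (pi_norm_le_iff_of_nonneg h0).mpr fun i => (pi_norm_le_iff_of_nonneg h0).mpr fun j => ?_
  rw [Matrix.mul_apply]
  refine (norm_sum_le _ _).trans ?_
  rw [mul_assoc, ← nsmul_eq_mul, ← Finset.card_univ, ← Finset.sum_const]
  refine Finset.sum_le_sum fun k _ => ?_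
  rw [norm_mul]
  exact mul_le_mul (hentry _ i k) (hentry _ k j) (norm_nonneg _) (norm_nonneg _)

/-- The maximum norm on matrices is submultiplicative up to the factor |ι|, which is absorbed in Q.
A sum over T in place of a maximum also covers T = ∅. -/
theorem exists_word_norm_le {Γ : Type} [Group Γ] {V : Type u} [AddCommGroup V] [Module ℂ V]
    (χ : Representation ℂ Γ V) {ι : Type} [Fintype ι] [DecidableEq ι] (b : Basis ι ℂ V)
    (T : Finset Γ) :
    ∃ Q : ℝ, 1 ≤ Q ∧ ∀ w : List Γ, (∀ t ∈ w, t ∈ T) →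
      ‖(fun i j => LinearMap.toMatrix b b (χ w.prod) i j : ι → ι → ℂ)‖ ≤ Q ^ w.length := by
  set N : Γ → ℝ := fun γ => ‖(fun i j => LinearMap.toMatrix b b (χ γ) i j : ι → ι → ℂ)‖ with hN
  have hN0 : ∀ γ, 0 ≤ N γ := fun _ => norm_nonneg _
  refine ⟨1 + ∑ t ∈ T, Fintype.card ι * N t, ?_, fun w => ?_⟩
  · have : 0 ≤ ∑ t ∈ T, Fintype.card ι * N t :=
      Finset.sum_nonneg fun t _ => mul_nonneg (Nat.cast_nonneg _) (hN0 t)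
    linarith
  change _ → N w.prod ≤ _
  induction w with
  | nil =>
    intro _
    rw [List.prod_nil, List.length_nil, pow_zero]
    simp only [hN, map_one, LinearMap.toMatrix_one]
    refine (pi_norm_le_iff_of_nonneg zero_le_one).mpr fun i =>
      (pi_norm_le_iff_of_nonneg zero_le_one).mpr fun j => ?_
    rw [Matrix.one_apply]
    split_ifs <;> simp
  | cons t w ih =>
    intro hw
    have h1 := ih fun x hx => hw x (List.mem_cons_of_mem _ hx)
    have h2 : N (t :: w).prod ≤ Fintype.card ι * N t * N w.prod := by
      simp only [hN, List.prod_cons, map_mul, LinearMap.toMatrix_mul]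
      exact norm_matrix_mul_le _ _
    refine h2.trans ?_
    rw [List.length_cons, pow_succ']
    refine mul_le_mul ?_ h1 (hN0 _) ?_
    · have := Finset.single_le_sum (f := fun t => Fintype.card ι * N t)
        (fun t _ => mul_nonneg (Nat.cast_nonneg _) (hN0 t)) (hw t List.mem_cons_self)
      linarith
    · have : 0 ≤ ∑ t ∈ T, Fintype.card ι * N t :=
        Finset.sum_nonneg fun t _ => mul_nonneg (Nat.cast_nonneg _) (hN0 t)
      linarith

theorem det_id_sub_smul_conj {Γ : Type} [Group Γ] {V : Type u} [AddCommGroup V] [Module ℂ V]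
    (χ : Representation ℂ Γ V) (w : ℂ) (γ δ : Γ) :
    LinearMap.det (LinearMap.id - w • χ (δ * γ * δ⁻¹)) =
      LinearMap.det (LinearMap.id - w • χ γ) := by
  have h1 : χ δ * χ δ⁻¹ = 1 := by rw [← map_mul, mul_inv_cancel, map_one]
  have h2 : LinearMap.id - w • χ (δ * γ * δ⁻¹) = χ δ * (LinearMap.id - w • χ γ) * χ δ⁻¹ := by
    change 1 - _ = χ δ * (1 - _) * χ δ⁻¹
    rw [mul_sub, sub_mul, mul_one, h1, map_mul, map_mul, mul_smul_comm, smul_mul_assoc]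
  rw [h2, map_mul, map_mul, mul_right_comm, ← map_mul, h1, map_one, one_mul]

/-- There are |T|^N words of length N. With e^a = 2(|T| + 1) they contribute (|T| / (2|T| + 2))^N, a
geometric term of ratio below 1/2. -/
theorem summable_words {T : Type} [Fintype T] :
    ∃ a : ℝ, 0 ≤ a ∧ Summable fun p : Σ N : ℕ, (Fin N → T) => Real.exp (-a * p.1) := by
  set q : ℝ := 2 * (Fintype.card T + 1) with hq
  have hq0 : 0 < q := by positivity
  refine ⟨Real.log q, Real.log_nonneg ?_, ?_⟩
  · have : (0 : ℝ) ≤ Fintype.card T := Nat.cast_nonneg _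
    linarith
  · rw [summable_sigma_of_nonneg fun _ => (Real.exp_pos _).le]
    refine ⟨fun N => (hasSum_fintype _).summable, ?_⟩
    have h1 : ∀ N : ℕ, ∑' _y : Fin N → T, Real.exp (-Real.log q * N) =
        (Fintype.card T / q) ^ N := by
      intro N
      rw [tsum_fintype, Finset.sum_const, Finset.card_univ, Fintype.card_fun, Fintype.card_fin,
        nsmul_eq_mul, mul_comm (-Real.log q), Real.exp_nat_mul, Real.exp_neg, Real.exp_log hq0,
        div_eq_mul_inv, mul_pow, Nat.cast_pow]
    simp only [h1]
    refine summable_geometric_of_lt_one (by positivity) ?_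
    rw [div_lt_one hq0]
    have : (0 : ℝ) ≤ Fintype.card T := Nat.cast_nonneg _
    linarith

namespace HypGroup

variable {n : ℕ} {L : HypGroup n}

/-- The series `∑ exp (-a l(γ))` over the prime classes converges for large `a`. -/
theorem IsProper.exists_summable_length (hL : L.IsProper) (Γ : Subgroup L.G)
    (hΓ : DiscreteTopology Γ) (hc : CompactSpace (MulAction.orbitRel.Quotient Γ L.G)) :
    ∃ a : ℝ, Summable fun c : PrimeClass Γ => Real.exp (-a * L.length c.elt) := by
  obtain ⟨T, B, h⟩ := hL.exists_conj_word Γ hΓ hc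
  choose δ w hw hprod hlen using fun c : PrimeClass Γ => h c.elt
  obtain ⟨a, ha, hsum⟩ := summable_words (T := T)
  refine ⟨a, ?_⟩
  set F : PrimeClass Γ → Σ N : ℕ, (Fin N → T) := fun c =>
    ⟨(w c).length, fun i => ⟨(w c).get i, hw c _ (List.get_mem _ _)⟩⟩ with hF
  have hword : ∀ c, w c = List.ofFn fun i => ((F c).2 i : Γ) := fun c =>
    (List.ofFn_get (w c)).symm
  -- The product of the word is conjugate to the representative, so the word determines the class.
  have hinj : Function.Injective F := by
    intro c d hcd
    have h1 : w c = w d := by rw [hword c, hword d, hcd]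
    have h2 : IsConj c.elt (w c).prod := isConj_iff.mpr ⟨δ c, (hprod c).symm⟩
    have h3 : IsConj d.elt (w d).prod := isConj_iff.mpr ⟨δ d, (hprod d).symm⟩
    rw [h1] at h2
    exact PrimeClass.eq_of_isConj (h2.trans h3.symm)
  refine Summable.of_nonneg_of_le (fun _ => (Real.exp_pos _).le) (fun c => ?_)
    ((hsum.comp_injective hinj).mul_left (Real.exp (a * B)))
  rw [Function.comp_apply, ← Real.exp_add, Real.exp_le_exp]
  have := mul_le_mul_of_nonneg_left (hlen c) ha
  change _ ≤ a * B + -a * ((w c).length : ℝ)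
  linarith

/-- The determinants of `Id - w χ(γ)` for small `w`. -/
theorem IsProper.exists_det_bound (hL : L.IsProper) (Γ : Subgroup L.G)
    (hΓ : DiscreteTopology Γ) (hc : CompactSpace (MulAction.orbitRel.Quotient Γ L.G))
    {V : Type u} [AddCommGroup V] [Module ℂ V] [FiniteDimensional ℂ V]
    (χ : Representation ℂ Γ V) :
    ∃ κ K r : ℝ, 0 ≤ K ∧ 0 < r ∧ ∀ (γ : Γ) (w : ℂ), ‖w‖ * Real.exp (κ * L.length γ) ≤ r →
      ‖LinearMap.det (LinearMap.id - w • χ γ) - 1‖ ≤ K * (‖w‖ * Real.exp (κ * L.length γ)) ∧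
      LinearMap.det (LinearMap.id - w • χ γ) ≠ 0 := by
  obtain ⟨T, B, h⟩ := hL.exists_conj_word Γ hΓ hc
  have b := finBasis ℂ V
  obtain ⟨Q, hQ, hword⟩ := exists_word_norm_le χ b T
  obtain ⟨K, r, hK, hr, hdet⟩ := exists_det_one_sub_bound (Fin (finrank ℂ V))
  have hQ0 : 0 < Q := one_pos.trans_le hQ
  have hQB : 0 < Q ^ B := Real.rpow_pos_of_pos hQ0 B
  -- The determinant depends only on the conjugacy class, so γ may be replaced by a word of length
  -- at most l + B. The bound Q^{l+B} splits into e^{κl} with κ = log Q and a factor Q^B absorbed in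
  -- the constants.
  refine ⟨Real.log Q, K * Q ^ B, r / Q ^ B, by positivity, by positivity, fun γ w hw => ?_⟩
  obtain ⟨δ, v, hv, hprod, hlen⟩ := h γ
  rw [← det_id_sub_smul_conj χ w γ δ, ← hprod]
  set X : Fin (finrank ℂ V) → Fin (finrank ℂ V) → ℂ :=
    fun i j => LinearMap.toMatrix b b (χ v.prod) i j with hX
  have h1 : LinearMap.det (LinearMap.id - w • χ v.prod) = (1 - Matrix.of (w • X)).det := by
    rw [← LinearMap.det_toMatrix b, map_sub, LinearMap.toMatrix_id, map_smul]
    rfl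
  have h2 : ‖w • X‖ ≤ ‖w‖ * Real.exp (Real.log Q * L.length γ) * Q ^ B := by
    rw [norm_smul, mul_assoc]
    refine mul_le_mul_of_nonneg_left ((hword v hv).trans ?_) (norm_nonneg _)
    rw [← Real.rpow_def_of_pos hQ0, ← Real.rpow_add hQ0, ← Real.rpow_natCast]
    exact Real.rpow_le_rpow_of_exponent_le hQ hlen
  have h3 : ‖w • X‖ ≤ r := h2.trans ((le_div_iff₀ hQB).mp hw)
  obtain ⟨h4, h5⟩ := hdet _ h3
  rw [h1]
  refine ⟨h4.trans ?_, h5⟩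
  have := mul_le_mul_of_nonneg_left h2 hK
  linarith

end HypGroup

/-! ### The Euler factors -/

theorem hasProd_fullProd {κ ι : Type} [Fintype κ] [Fintype ι] {g : ℂ → ℂ} {K r q : ℝ} {b : κ → ℂ}
    (hg : ∀ x, ‖x‖ ≤ r → ‖g x - 1‖ ≤ K * ‖x‖) (hK : 0 ≤ K)
    (hq : 0 ≤ q) (hq1 : q < 1) (hb : ∀ i, ‖b i‖ ≤ q) {y : ι → ℂ} (hy : ∀ i, ‖y i‖ ≤ r) :
    HasProd (fun k : ℕ => ∏ α : {α : κ →₀ ℕ // α.degree = k}, ∏ i, g (y i * monom b α.1))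
      (∏ i, fullProd g b (y i)) := by
  classical
  have h : ∀ i ∈ (Finset.univ : Finset ι), HasProd
      (fun k : ℕ => ∏ α : {α : κ →₀ ℕ // α.degree = k}, g (y i * monom b α.1))
      (fullProd g b (y i)) :=
    fun i _ => tprod_degree (f := fun α => g (y i * monom b α)) (summable_norm_sub_one hg hK hq hq1 hb (hy i))
  have h2 := hasProd_prod h
  have h3 : (fun k : ℕ => ∏ α : {α : κ →₀ ℕ // α.degree = k}, ∏ i, g (y i * monom b α.1)) =
      fun k : ℕ => ∏ i, ∏ α : {α : κ →₀ ℕ // α.degree = k}, g (y i * monom b α.1) :=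
    funext fun k => Finset.prod_comm
  rw [h3]
  exact h2

section Combinatorics

variable {κ : Type} [Fintype κ] [DecidableEq κ]

/-- As |κ| is even, I and its complement have cardinalities of the same parity, so complementation
preserves the signs; the subsets are then grouped by cardinality. -/
theorem prod_powersetCard_zpow {n : ℕ} (hκ : Fintype.card κ = 2 * n) (F : Finset κ → ℂ) :
    ∏ p : Fin (2 * n + 1), (∏ I : Set.powersetCard κ p, F (I.1)ᶜ) ^ ((-1 : ℤ) ^ (p : ℕ)) =
      ∏ I : Finset κ, F I ^ ((-1 : ℤ) ^ I.card) := by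
  have h1 : ∏ I : Finset κ, F I ^ ((-1 : ℤ) ^ I.card) =
      ∏ I : Finset κ, F Iᶜ ^ ((-1 : ℤ) ^ I.card) := by
    refine (Fintype.prod_equiv (compl_involutive.toPerm (compl : Finset κ → Finset κ)) _ _
      fun I => ?_).symm
    change _ = F Iᶜ ^ ((-1 : ℤ) ^ (Iᶜ).card)
    have h2 : I.card + Iᶜ.card = 2 * n := by rw [Finset.card_add_card_compl, hκ]
    have h3 : (-1 : ℤ) ^ I.card * (-1 : ℤ) ^ Iᶜ.card = 1 := by
      rw [← pow_add, h2]; simp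
    have h4 : (-1 : ℤ) ^ I.card = (-1 : ℤ) ^ Iᶜ.card := by
      rcases neg_one_pow_eq_or ℤ I.card with h | h <;> rw [h] at h3 ⊢ <;> linarith
    rw [h4]
  rw [h1, ← Finset.powerset_univ, Finset.prod_powerset, Finset.card_univ, hκ,
    Finset.prod_range]
  refine Finset.prod_congr rfl fun p _ => ?_
  rw [← Finset.prod_zpow]
  rw [Finset.prod_subtype (p := fun I => I ∈ Set.powersetCard κ p) _ (fun I => by
    simp [Finset.mem_powersetCard])]
  refine Finset.prod_congr rfl fun I _ => ?_
  rw [Set.powersetCard.card_eq I]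

end Combinatorics

variable {n : ℕ} {L : HypGroup n} {Γ : Subgroup L.G}
  {V : Type u} [AddCommGroup V] [Module ℂ V]

/-- `det (Id - x χ(γ))`. -/
def charDet (χ : Representation ℂ Γ V) (c : PrimeClass Γ) (x : ℂ) : ℂ :=
  LinearMap.det (LinearMap.id - x • χ c.elt)

/-- All operators are diagonalizable with eigenvalues, indexed by `ι`, of absolute value one. -/
def HasUnitEigenbases {M : Type} [Group M] {W : Type*} [AddCommGroup W] [Module ℂ W] (ι : Type)
    (τ : Representation ℂ M W) : Prop :=
  ∀ m, ∃ η : ι → ℂ, HasEigenbasis (τ m) η ∧ ∀ i, ‖η i‖ = 1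

theorem UnitaryIrrep.hasUnitEigenbases {M : Type} [Group M] [TopologicalSpace M]
    (τ : UnitaryIrrep.{v} M) : HasUnitEigenbases (Fin (finrank ℂ τ.V)) τ.rep := fun m =>
  exists_eigenbasis_of_isometry (τ.rep m) (τ.norm_rep m)

theorem HasUnitEigenbases.tprod {M : Type} [Group M] {W : Type*} [AddCommGroup W] [Module ℂ W]
    {W' : Type*} [AddCommGroup W'] [Module ℂ W'] {ι ι' : Type}
    {τ : Representation ℂ M W} {τ' : Representation ℂ M W'} (h : HasUnitEigenbases ι τ)
    (h' : HasUnitEigenbases ι' τ') : HasUnitEigenbases (ι × ι') (τ.tprod τ') := fun m => by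
  obtain ⟨η, h1, h2⟩ := h m
  obtain ⟨η', h1', h2'⟩ := h' m
  refine ⟨_, h1.tensor h1', fun i => ?_⟩
  rw [norm_mul, h2, h2', one_mul]

section Factors

variable {W : Type v} [AddCommGroup W] [Module ℂ W] {ι : Type} [Fintype ι]
  [FiniteDimensional ℂ V]

theorem ruelleFactor_eq (χ : Representation ℂ Γ V) (τ : Representation ℂ L.M W) (s : ℂ)
    (c : PrimeClass Γ) {η : ι → ℂ} (hη : HasEigenbasis (τ (L.mPart c.elt)) η) :
    ruelleFactor χ τ s c = ∏ i, charDet χ c (Complex.exp (-s * L.length c.elt) * η i) := by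
  rw [ruelleFactor, Nat.add_sub_cancel, pow_mul, neg_one_sq, one_pow, zpow_one,
    det_id_sub_smul_map _ hη]
  rfl

theorem selbergFactor_eq [FiniteDimensional ℂ W] (χ : Representation ℂ Γ V)
    (τ : Representation ℂ L.M W) (s : ℂ) (c : PrimeClass Γ) {η : ι → ℂ}
    (hη : HasEigenbasis (τ (L.mPart c.elt)) η) {b : Mid n → ℂ}
    (hb : HasEigenbasis (L.AdC (L.mPart c.elt) (L.length c.elt) (-1)) b) (k : ℕ) :
    selbergFactor χ τ s c k = ∏ α : {α : Mid n →₀ ℕ // α.degree = k}, ∏ i, charDet χ c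
      (Complex.exp (-(s + rho n) * L.length c.elt) * η i * monom b α.1) := by
  rw [selbergFactor, det_id_sub_smul_map _ (hb.symPow k)]
  refine Finset.prod_congr rfl fun α _ => ?_
  rw [det_id_sub_smul_map _ hη]
  refine Finset.prod_congr rfl fun i _ => ?_
  rw [charDet, mul_right_comm]
  rfl

end Factors

theorem norm_exp_neg_mul (z : ℂ) (l : ℝ) : ‖Complex.exp (-z * l)‖ = Real.exp (-z.re * l) := by
  rw [Complex.norm_exp]
  congr 1
  simp

/-- The bounds that make the zeta functions converge. -/
structure ZetaBound (χ : Representation ℂ Γ V) (ε K κ A : ℝ) : Prop where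
  pos : 0 < ε
  nonneg : 0 ≤ K
  le_length : ∀ c : PrimeClass Γ, ε ≤ L.length c.elt
  summable : Summable fun c : PrimeClass Γ => Real.exp (-(A - κ) * L.length c.elt)
  bound : ∀ (c : PrimeClass Γ) (x : ℂ), ‖x‖ ≤ Real.exp (-A * L.length c.elt) →
    ‖charDet χ c x - 1‖ ≤ K * Real.exp (κ * L.length c.elt) * ‖x‖
  ne_zero : ∀ (c : PrimeClass Γ) (x : ℂ), ‖x‖ ≤ Real.exp (-A * L.length c.elt) →
    charDet χ c x ≠ 0

theorem HypGroup.IsProper.exists_zetaBound (hL : L.IsProper)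
    (hΓ : DiscreteTopology Γ) (hc : CompactSpace (MulAction.orbitRel.Quotient Γ L.G))
    (ht : ∀ γ : Γ, γ ≠ 1 → ∀ k : ℕ, 0 < k → γ ^ k ≠ 1) [FiniteDimensional ℂ V]
    (χ : Representation ℂ Γ V) : ∃ ε K κ A : ℝ, ZetaBound χ ε K κ A := by
  obtain ⟨ε, hε, hlen⟩ := hL.exists_le_length Γ hΓ hc ht
  obtain ⟨a, ha⟩ := hL.exists_summable_length Γ hΓ hc
  obtain ⟨κ, K, r, hK, hr, h⟩ := hL.exists_det_bound Γ hΓ hc χ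
  have hlen' : ∀ c : PrimeClass Γ, ε ≤ L.length c.elt := fun c => hlen _ c.elt_ne_one
  -- B ≥ a gives summability. B ≥ 0 and Bε ≥ -log r give e^{-Bl} ≤ r whenever l ≥ ε, which puts x in
  -- the range of the determinant bound when A = κ + B.
  set B := max (max a 0) (-Real.log r / ε) with hB
  have hsmall : ∀ (c : PrimeClass Γ) (x : ℂ), ‖x‖ ≤ Real.exp (-(κ + B) * L.length c.elt) →
      ‖x‖ * Real.exp (κ * L.length c.elt) ≤ r := by
    intro c x hx
    refine (mul_le_mul_of_nonneg_right hx (Real.exp_pos _).le).trans ?_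
    rw [← Real.exp_add]
    refine (Real.le_log_iff_exp_le hr).mp ?_
    have h1 : 0 ≤ B := (le_max_right _ _).trans (le_max_left _ _)
    have h2 : -Real.log r ≤ B * ε := (div_le_iff₀ hε).mp (le_max_right _ _)
    have h3 := mul_le_mul_of_nonneg_left (hlen' c) h1
    linarith
  refine ⟨ε, K, κ, κ + B, hε, hK, hlen', ?_, fun c x hx => ?_, fun c x hx => ?_⟩
  · refine Summable.of_nonneg_of_le (fun _ => (Real.exp_pos _).le) (fun c => ?_) ha
    rw [Real.exp_le_exp]
    have h1 : a ≤ B := (le_max_left _ _).trans (le_max_left _ _)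
    have h3 := mul_le_mul_of_nonneg_right h1 (hε.le.trans (hlen' c))
    linarith
  · have := (h c.elt x (hsmall c x hx)).1
    refine this.trans (le_of_eq ?_)
    ring
  · exact (h c.elt x (hsmall c x hx)).2

/-! ### Absolute convergence and non-vanishing of the Euler products -/

namespace ZetaBound

variable {χ : Representation ℂ Γ V} {ε K κ A : ℝ}
  {W : Type v} [AddCommGroup W] [Module ℂ W] {τ : Representation ℂ L.M W}
  {ι : Type} [Fintype ι]

theorem length_nonneg (hχ : ZetaBound χ ε K κ A) (c : PrimeClass Γ) : 0 ≤ L.length c.elt :=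
  hχ.pos.le.trans (hχ.le_length c)

theorem norm_exp_mul_le (hχ : ZetaBound χ ε K κ A) (c : PrimeClass Γ) {z : ℂ} (hz : A ≤ z.re)
    {η : ℂ} (hη : ‖η‖ = 1) :
    ‖Complex.exp (-z * L.length c.elt) * η‖ ≤ Real.exp (-A * L.length c.elt) := by
  rw [norm_mul, hη, mul_one, norm_exp_neg_mul, Real.exp_le_exp]
  have := mul_le_mul_of_nonneg_right hz (hχ.length_nonneg c)
  linarith

theorem absConvProd_ruelleFactor (hχ : ZetaBound χ ε K κ A) [FiniteDimensional ℂ V]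
    (hτ : HasUnitEigenbases ι τ) {s : ℂ} (hs : A ≤ s.re) :
    AbsConvProd (ruelleFactor χ τ s) := by
  choose η hη hη1 using hτ
  have h : AbsConvProd fun c : PrimeClass Γ => ∏ i, charDet χ c
      (Complex.exp (-s * L.length c.elt) * η (L.mPart c.elt) i) := by
    refine AbsConvProd.of_block (Summable.of_nonneg_of_le
      (fun _ => Finset.sum_nonneg fun _ _ => norm_nonneg _) (fun c => ?_)
      ((hχ.summable.mul_left K).mul_left (Fintype.card ι : ℝ)))
    rw [← nsmul_eq_mul, ← Finset.card_univ, ← Finset.sum_const]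
    refine Finset.sum_le_sum fun i _ => ?_
    have h1 := hχ.norm_exp_mul_le c hs (hη1 (L.mPart c.elt) i)
    refine (hχ.bound c _ h1).trans ?_
    rw [mul_assoc]
    refine mul_le_mul_of_nonneg_left ?_ hχ.nonneg
    refine (mul_le_mul_of_nonneg_left h1 (Real.exp_pos _).le).trans (le_of_eq ?_)
    rw [← Real.exp_add]; congr 1; ring
  refine h.congr fun c => ?_
  rw [ruelleFactor_eq χ τ s c (hη (L.mPart c.elt))]

theorem norm_mul_monom_le (hχ : ZetaBound χ ε K κ A) (c : PrimeClass Γ) {z : ℂ} (hz : A ≤ z.re)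
    {η : ℂ} (hη : ‖η‖ = 1) {b : Mid n → ℂ} (hb : ∀ i, ‖b i‖ = Real.exp (-L.length c.elt))
    (α : Mid n →₀ ℕ) :
    ‖Complex.exp (-z * L.length c.elt) * η * monom b α‖ ≤
      Real.exp (-A * L.length c.elt) * Real.exp (-ε) ^ α.degree := by
  rw [norm_mul]
  refine mul_le_mul (hχ.norm_exp_mul_le c hz hη) (Hyp.norm_monom_le (fun i => ?_) α)
    (norm_nonneg _) (Real.exp_pos _).le
  rw [hb, Real.exp_le_exp]
  exact neg_le_neg (hχ.le_length c)

theorem exp_lt_one (hχ : ZetaBound χ ε K κ A) : Real.exp (-ε) < 1 :=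
  Real.exp_lt_one_iff.mpr (neg_lt_zero.mpr hχ.pos)

theorem norm_mul_monom_le' (hχ : ZetaBound χ ε K κ A) (c : PrimeClass Γ) {z : ℂ} (hz : A ≤ z.re)
    {η : ℂ} (hη : ‖η‖ = 1) {b : Mid n → ℂ} (hb : ∀ i, ‖b i‖ = Real.exp (-L.length c.elt))
    (α : Mid n →₀ ℕ) :
    ‖Complex.exp (-z * L.length c.elt) * η * monom b α‖ ≤ Real.exp (-A * L.length c.elt) :=
  (hχ.norm_mul_monom_le c hz hη hb α).trans (mul_le_of_le_one_right (Real.exp_pos _).le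
    (pow_le_one₀ (Real.exp_pos _).le hχ.exp_lt_one.le))

section Selberg

variable [FiniteDimensional ℂ V] [FiniteDimensional ℂ W]

/-- Each determinant of degree k differs from 1 by at most K e^{-(A-κ)l} e^{-εk}. The lower bound ε
for the lengths decouples k from the class, so the double series is dominated by a product of two
convergent ones; the number of monomials of degree k is harmless by `summable_card_degree`. -/
theorem absConvProd_selbergFactor (hχ : ZetaBound χ ε K κ A) (hL : ∀ g, (L.cov g).det = 1)
    (hτ : HasUnitEigenbases ι τ) {s : ℂ} (hs : A ≤ (s + rho n).re) :
    AbsConvProd fun q : PrimeClass Γ × ℕ => selbergFactor χ τ s q.1 q.2 := by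
  choose η hη hη1 using hτ
  choose ω hω hω1 hneg hpos using fun c : PrimeClass Γ =>
    L.exists_eigenvalues_AdC (L.mPart c.elt) (L.length c.elt) (hL _)
  have hb : ∀ c i, ‖(Real.exp (-L.length (PrimeClass.elt c : Γ)) : ℂ) * ω c i‖ =
      Real.exp (-L.length c.elt) := fun c i => by
    rw [norm_mul, hω, mul_one, Complex.norm_real, Real.norm_of_nonneg (Real.exp_pos _).le]
  have h : AbsConvProd fun q : PrimeClass Γ × ℕ =>
      ∏ p : {α : Mid n →₀ ℕ // α.degree = q.2} × ι, charDet χ q.1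
        (Complex.exp (-(s + rho n) * L.length q.1.elt) * η (L.mPart q.1.elt) p.2 *
          monom (fun i => Real.exp (-L.length q.1.elt) * ω q.1 i) p.1.1) := by
    have hsum := (hχ.summable.mul_left K).mul_of_nonneg
      ((summable_card_degree (Mid n) (Real.exp_pos (-ε)).le hχ.exp_lt_one).mul_right
        (Fintype.card ι : ℝ)) (fun _ => mul_nonneg hχ.nonneg (Real.exp_pos _).le)
        (fun _ => by positivity)
    refine AbsConvProd.of_block (Summable.of_nonneg_of_le
      (fun _ => Finset.sum_nonneg fun _ _ => norm_nonneg _) (fun q => ?_) hsum)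
    have hterm : ∀ p : {α : Mid n →₀ ℕ // α.degree = q.2} × ι, ‖charDet χ q.1
        (Complex.exp (-(s + rho n) * L.length q.1.elt) * η (L.mPart q.1.elt) p.2 *
          monom (fun i => Real.exp (-L.length q.1.elt) * ω q.1 i) p.1.1) - 1‖ ≤
        K * Real.exp (-(A - κ) * L.length q.1.elt) * Real.exp (-ε) ^ q.2 := by
      intro p
      refine (hχ.bound q.1 _ (hχ.norm_mul_monom_le' q.1 hs (hη1 _ p.2) (hb q.1) p.1.1)).trans ?_
      have h1 := hχ.norm_mul_monom_le q.1 hs (hη1 (L.mPart q.1.elt) p.2) (hb q.1) p.1.1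
      rw [p.1.2] at h1
      rw [mul_assoc K, mul_assoc K]
      refine mul_le_mul_of_nonneg_left ?_ hχ.nonneg
      refine (mul_le_mul_of_nonneg_left h1 (Real.exp_pos _).le).trans (le_of_eq ?_)
      rw [← mul_assoc, ← Real.exp_add]; congr 2; ring
    refine (Finset.sum_le_sum fun p _ => hterm p).trans (le_of_eq ?_)
    rw [Finset.sum_const, Finset.card_univ, Fintype.card_prod, nsmul_eq_mul, Nat.cast_mul]
    ring
  refine h.congr fun q => ?_
  dsimp only
  rw [selbergFactor_eq χ τ s q.1 (hη (L.mPart q.1.elt)) (hneg q.1), Fintype.prod_prod_type]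

/-- The product over `k` of the factors of the Selberg zeta function. -/
theorem hasProd_selbergFactor (hχ : ZetaBound χ ε K κ A) {s : ℂ} (hs : A ≤ (s + rho n).re)
    (c : PrimeClass Γ) {η : ι → ℂ}
    (hη : HasEigenbasis (τ (L.mPart c.elt)) η) (hη1 : ∀ i, ‖η i‖ = 1) {b : Mid n → ℂ}
    (hb : HasEigenbasis (L.AdC (L.mPart c.elt) (L.length c.elt) (-1)) b)
    (hb1 : ∀ i, ‖b i‖ = Real.exp (-L.length c.elt)) :
    HasProd (fun k => selbergFactor χ τ s c k) (∏ i, fullProd (charDet χ c) b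
      (Complex.exp (-(s + rho n) * L.length c.elt) * η i)) := by
  have hb2 : ∀ i, ‖b i‖ ≤ Real.exp (-ε) := fun i => by
    rw [hb1, Real.exp_le_exp]
    exact neg_le_neg (hχ.le_length c)
  have h := hasProd_fullProd (hχ.bound c) (mul_nonneg hχ.nonneg (Real.exp_pos _).le)
    (Real.exp_pos _).le hχ.exp_lt_one hb2 fun i => hχ.norm_exp_mul_le c hs (hη1 i)
  have h2 : (fun k => selbergFactor χ τ s c k) = _ :=
    funext fun k => selbergFactor_eq χ τ s c hη hb k
  rw [h2]
  exact h

theorem selbergFactor_ne_zero (hχ : ZetaBound χ ε K κ A) (hL : ∀ g, (L.cov g).det = 1)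
    (hτ : HasUnitEigenbases ι τ) {s : ℂ} (hs : A ≤ (s + rho n).re) (c : PrimeClass Γ) (k : ℕ) :
    selbergFactor χ τ s c k ≠ 0 := by
  obtain ⟨η, hη, hη1⟩ := hτ (L.mPart c.elt)
  obtain ⟨ω, hω, -, hneg, -⟩ :=
    L.exists_eigenvalues_AdC (L.mPart c.elt) (L.length c.elt) (hL _)
  have hb : ∀ i, ‖(Real.exp (-L.length c.elt) : ℂ) * ω i‖ = Real.exp (-L.length c.elt) :=
    fun i => by
    rw [norm_mul, hω, mul_one, Complex.norm_real, Real.norm_of_nonneg (Real.exp_pos _).le]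
  rw [selbergFactor_eq χ τ s c hη hneg]
  exact Finset.prod_ne_zero_iff.mpr fun α _ => Finset.prod_ne_zero_iff.mpr fun i _ =>
    hχ.ne_zero c _ (hχ.norm_mul_monom_le' c hs (hη1 i) hb α.1)

/-- Absolute convergence over the pairs (c, k) identifies the iterated product that defines Z with a
product over pairs, which does not vanish since no factor does. -/
theorem hasProd_selbergZ (hχ : ZetaBound χ ε K κ A) (hL : ∀ g, (L.cov g).det = 1)
    (hτ : HasUnitEigenbases ι τ) {s : ℂ} (hs : A ≤ (s + rho n).re) :
    HasProd (fun c : PrimeClass Γ => ∏' k, selbergFactor χ τ s c k) (selbergZ χ τ s) ∧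
      selbergZ χ τ s ≠ 0 := by
  have h := hχ.absConvProd_selbergFactor hL hτ hs
  have h1 := h.hasProd_prod
  have h2 : selbergZ χ τ s = ∏' q : PrimeClass Γ × ℕ, selbergFactor χ τ s q.1 q.2 :=
    h1.tprod_eq
  rw [h2]
  exact ⟨h1, h.tprod_ne_zero fun q => hχ.selbergFactor_ne_zero hL hτ hs q.1 q.2⟩

end Selberg

end ZetaBound

/-! ### The identity of Euler products -/

/-- The decomposition and the wedge basis diagonalize the same operator on Λ^p 𝔫, so both lists of
eigenvalues agree with multiplicity. Through this step alone does the decomposition enter, which is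
why any D will do. -/
theorem MADecomp.prod_eigenvalues {n : ℕ} {L : HypGroup n} {p : ℕ} (D : MADecomp.{w} L p) (m : L.M)
    (t : ℝ) {β : Mid n → ℂ} (hβ : HasEigenbasis (L.AdC m t 1) β) {ι : D.J → Type}
    [∀ j, Fintype (ι j)] {η : ∀ j, ι j → ℂ} (hη : ∀ j, HasEigenbasis ((D.psi j).rep m) (η j))
    (Q : ℂ → ℂ) :
    ∏ j, ∏ i, Q (Complex.exp (D.lam j * t) * η j i) =
      ∏ I : Set.powersetCard (Mid n) p, Q (∏ i ∈ (I : Finset (Mid n)), β i) := by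
  have h1 := HasEigenbasis.pi fun j => (hη j).smul (Complex.exp (D.lam j * t))
  have h2 : HasEigenbasis (exteriorPower.map p (L.AdC m t 1))
      (fun q : Σ j, ι j => Complex.exp (D.lam q.1 * t) * η q.1 q.2) := by
    refine h1.conj D.iso.symm fun v => ?_
    rw [LinearEquiv.symm_apply_eq]
    funext j
    have := D.equivariant m t (D.iso.symm v) j
    rw [LinearEquiv.apply_symm_apply] at this
    exact this.symm
  rw [← HasEigenbasis.prod_eq h2 (hβ.exteriorPower p) Q, Fintype.prod_sigma]

variable {n : ℕ} {L : HypGroup n} {Γ : Subgroup L.G}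
  {V : Type u} [AddCommGroup V] [Module ℂ V] [FiniteDimensional ℂ V]
  {χ : Representation ℂ Γ V} {ε K κ A : ℝ}

namespace ZetaBound

/-- The exponent of the shifted Selberg function is s + 2ρ - λ. The values e^{λl}η run over ∏_{i∈I}
b_i⁻¹, and multiplying by e^{-2ρl} = ∏ b_i leaves the product over the complement of I. -/
theorem prod_tprod_selbergFactor (hχ : ZetaBound χ ε K κ A)
    {W : Type v} [AddCommGroup W] [Module ℂ W] [FiniteDimensional ℂ W]
    {τ : Representation ℂ L.M W} {s : ℂ}
    {p : ℕ} (D : MADecomp.{w} L p)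
    (hD : ∀ j, A ≤ (s + rho n - D.lam j + rho n).re) (c : PrimeClass Γ)
    {ι : Type} [Fintype ι] {μ : ι → ℂ} (hμ : HasEigenbasis (τ (L.mPart c.elt)) μ)
    (hμ1 : ∀ i, ‖μ i‖ = 1) {b : Mid n → ℂ}
    (hb : HasEigenbasis (L.AdC (L.mPart c.elt) (L.length c.elt) (-1)) b)
    (hb' : HasEigenbasis (L.AdC (L.mPart c.elt) (L.length c.elt) 1) fun i => (b i)⁻¹)
    (hb1 : ∀ i, ‖b i‖ = Real.exp (-L.length c.elt))
    (hb2 : ∏ i, b i = Complex.exp (-(2 * rho n) * L.length c.elt)) :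
    ∏ j, ∏' k, selbergFactor χ ((D.psi j).rep.tprod τ) (s + rho n - D.lam j) c k =
      ∏ I : Set.powersetCard (Mid n) p, ∏ i, fullProd (charDet χ c) b
        (Complex.exp (-s * L.length c.elt) * μ i * ∏ i ∈ (I.1)ᶜ, b i) := by
  choose η hη hη1 using fun j => (D.psi j).hasUnitEigenbases (L.mPart c.elt)
  have h1 : ∀ j, ∏' k, selbergFactor χ ((D.psi j).rep.tprod τ) (s + rho n - D.lam j) c k =
      ∏ i, ∏ i', fullProd (charDet χ c) b
        (Complex.exp (-(s + rho n - D.lam j + rho n) * L.length c.elt) * (η j i * μ i')) := by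
    intro j
    rw [← Fintype.prod_prod_type']
    refine (hχ.hasProd_selbergFactor (hD j) c ((hη j).tensor hμ) (fun i => ?_) hb hb1).tprod_eq
    rw [norm_mul, hη1, hμ1, one_mul]
  set Q : ℂ → ℂ := fun x => ∏ i', fullProd (charDet χ c) b
    (Complex.exp (-s * L.length c.elt) * μ i' *
      (Complex.exp (-(2 * rho n) * L.length c.elt) * x)) with hQ
  have h2 : ∀ j i, ∏ i', fullProd (charDet χ c) b
      (Complex.exp (-(s + rho n - D.lam j + rho n) * L.length c.elt) * (η j i * μ i')) =
      Q (Complex.exp (D.lam j * L.length c.elt) * η j i) := by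
    intro j i
    refine Finset.prod_congr rfl fun i' _ => ?_
    congr 1
    have : Complex.exp (-(s + rho n - D.lam j + rho n) * L.length c.elt) =
        Complex.exp (-s * L.length c.elt) * Complex.exp (-(2 * rho n) * L.length c.elt) *
          Complex.exp (D.lam j * L.length c.elt) := by
      rw [← Complex.exp_add, ← Complex.exp_add]; congr 1; ring
    rw [this]; ring
  simp only [h1, h2]
  rw [D.prod_eigenvalues (L.mPart c.elt) (L.length c.elt) hb' hη Q]
  refine Finset.prod_congr rfl fun I _ => Finset.prod_congr rfl fun i' _ => ?_
  congr 2
  rw [← hb2, ← Finset.prod_compl_mul_prod (I : Finset (Mid n)) b, Finset.prod_inv_distrib,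
    mul_assoc, mul_inv_cancel₀, mul_one]
  refine Finset.prod_ne_zero_iff.mpr fun i _ => ?_
  rw [← norm_ne_zero_iff, hb1]
  exact (Real.exp_pos _).ne'

theorem ruelleFactor_eq_prod (hχ : ZetaBound χ ε K κ A) (hL : ∀ g, (L.cov g).det = 1)
    {W : Type v} [AddCommGroup W] [Module ℂ W] [FiniteDimensional ℂ W]
    {τ : Representation ℂ L.M W} {ι : Type} [Fintype ι] (hτ : HasUnitEigenbases ι τ)
    {s : ℂ} (hs : A ≤ s.re) (D : (p : Fin (2 * n + 1)) → MADecomp.{w} L p)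
    (hD : ∀ p, ∀ j, A ≤ (s + rho n - (D p).lam j + rho n).re) (c : PrimeClass Γ) :
    ruelleFactor χ τ s c = ∏ p : Fin (2 * n + 1), (∏ j, ∏' k,
      selbergFactor χ (((D p).psi j).rep.tprod τ) (s + rho n - (D p).lam j) c k) ^
        ((-1 : ℤ) ^ (p : ℕ)) := by
  obtain ⟨μ, hμ, hμ1⟩ := hτ (L.mPart c.elt)
  obtain ⟨ω, hω, hω1, hb, hb'⟩ :=
    L.exists_eigenvalues_AdC (L.mPart c.elt) (L.length c.elt) (hL _)
  set b : Mid n → ℂ := fun i => Real.exp (-L.length c.elt) * ω i with hbdef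
  have hb1 : ∀ i, ‖b i‖ = Real.exp (-L.length c.elt) := fun i => by
    rw [norm_mul, hω, mul_one, Complex.norm_real, Real.norm_of_nonneg (Real.exp_pos _).le]
  -- There are 2n = 2ρ eigenvalues, each e^{-l} times some ω i, and the ω i have product 1.
  have hb2 : ∏ i, b i = Complex.exp (-(2 * rho n) * L.length c.elt) := by
    rw [hbdef, Finset.prod_mul_distrib, hω1, mul_one, Finset.prod_const, Finset.card_univ, card_Mid,
      rho_eq, Complex.ofReal_exp, ← Complex.exp_nat_mul]
    congr 1
    push_cast
    ring
  have hb3 : ∀ i, ‖b i‖ ≤ Real.exp (-ε) := fun i => by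
    rw [hb1, Real.exp_le_exp]
    exact neg_le_neg (hχ.le_length c)
  have h1 : ∀ p : Fin (2 * n + 1), ∏ j, ∏' k,
      selbergFactor χ (((D p).psi j).rep.tprod τ) (s + rho n - (D p).lam j) c k = _ :=
    fun p => hχ.prod_tprod_selbergFactor (D p) (hD p) c hμ hμ1 hb hb' hb1 hb2
  simp only [h1]
  rw [prod_powersetCard_zpow (card_Mid n) fun I => ∏ i, fullProd (charDet χ c) b
        (Complex.exp (-s * L.length c.elt) * μ i * ∏ i ∈ I, b i), ruelleFactor_eq χ τ s c hμ]
  simp only [← Finset.prod_zpow]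
  rw [Finset.prod_comm]
  refine Finset.prod_congr rfl fun i _ => ?_
  exact (prod_fullProd (hχ.bound c) (hχ.ne_zero c) (mul_nonneg hχ.nonneg (Real.exp_pos _).le)
    (Real.exp_pos _).le hχ.exp_lt_one hb3 (hχ.norm_exp_mul_le c hs (hμ1 i))).symm

/-- For odd p the product is inverted, which requires its limit to be non-zero. -/
theorem hasProd_zetaP (hχ : ZetaBound χ ε K κ A) (hL : ∀ g, (L.cov g).det = 1)
    {W : Type v} [AddCommGroup W] [Module ℂ W] [FiniteDimensional ℂ W]
    {τ : Representation ℂ L.M W} {ι : Type} [Fintype ι] (hτ : HasUnitEigenbases ι τ)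
    {s : ℂ} {p : ℕ} (D : MADecomp.{w} L p)
    (hD : ∀ j, A ≤ (s + rho n - D.lam j + rho n).re) :
    HasProd (fun c : PrimeClass Γ => (∏ j, ∏' k,
      selbergFactor χ ((D.psi j).rep.tprod τ) (s + rho n - D.lam j) c k) ^ ((-1 : ℤ) ^ p))
      (zetaP χ τ D s ^ ((-1 : ℤ) ^ p)) := by
  have h := fun j =>
    hχ.hasProd_selbergZ hL (((D.psi j).hasUnitEigenbases).tprod hτ) (hD j)
  have h1 : HasProd _ (zetaP χ τ D s) := hasProd_prod fun j _ => (h j).1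
  have h2 : zetaP χ τ D s ≠ 0 := Finset.prod_ne_zero_iff.mpr fun j _ => (h j).2
  rcases neg_one_pow_eq_or ℤ p with hp | hp <;> rw [hp]
  · simpa only [zpow_one] using h1
  · simpa only [zpow_neg_one] using h1.inv₀ h2

/-- The expression of the Ruelle zeta function by Selberg zeta functions on a half-plane. -/
theorem ruelleR_eq (hχ : ZetaBound χ ε K κ A) (hL : ∀ g, (L.cov g).det = 1)
    {W : Type v} [AddCommGroup W] [Module ℂ W] [FiniteDimensional ℂ W]
    {τ : Representation ℂ L.M W} {ι : Type} [Fintype ι] (hτ : HasUnitEigenbases ι τ)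
    {s : ℂ} (hs : A ≤ s.re) (D : (p : Fin (2 * n + 1)) → MADecomp.{w} L p)
    (hD : ∀ p, ∀ j, A ≤ (s + rho n - (D p).lam j + rho n).re) :
    ruelleR χ τ s = ∏ p : Fin (2 * n + 1), zetaP χ τ (D p) s ^ ((-1 : ℤ) ^ (p : ℕ)) := by
  rw [ruelleR, tprod_congr (hχ.ruelleFactor_eq_prod hL hτ hs D hD)]
  exact (hasProd_prod fun p _ => hχ.hasProd_zetaP hL hτ (D p) (hD p)).tprod_eq

end ZetaBound

theorem exists_half_plane {J : Type*} [Finite J] (A ρ : ℝ) (lam : J → ℂ) :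
    ∃ c : ℝ, A ≤ c ∧ ∀ s : ℂ, c < s.re → ∀ j, A ≤ (s + ρ - lam j + ρ).re := by
  obtain ⟨B, hB⟩ := (Set.finite_range fun j => (lam j).re).bddAbove
  refine ⟨max A (A + B - 2 * ρ), le_max_left _ _, fun s hs j => ?_⟩
  have h1 := hB ⟨j, rfl⟩
  have h2 := (le_max_right A (A + B - 2 * ρ)).trans_lt hs
  simp only [Complex.add_re, Complex.sub_re, Complex.ofReal_re] at h1 ⊢
  linarith

/-! ### Meromorphic continuation -/

/-- A meromorphic function on the plane that vanishes on a half-plane vanishes identically. -/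
theorem eventuallyEq_zero_of_half_plane {f : ℂ → ℂ} (hf : Meromorphic f) {c : ℝ}
    (h : ∀ s : ℂ, c < s.re → f s = 0) : f =ᶠ[Filter.codiscrete ℂ] 0 := by
  -- The points near which f vanishes identically on a punctured neighbourhood form a clopen set; it
  -- meets the half-plane, so it is all of ℂ.
  have hclopen : IsClopen {u : (Set.univ : Set ℂ) | meromorphicOrderAt f u = ⊤} :=
    MeromorphicOn.isClopen_setOfPred_meromorphicOrderAt_eq_top fun x _ => hf x
  have hz : (⟨((c + 1 : ℝ) : ℂ), trivial⟩ : (Set.univ : Set ℂ)) ∈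
      {u : (Set.univ : Set ℂ) | meromorphicOrderAt f u = ⊤} := by
    rw [Set.mem_ofPred_eq, meromorphicOrderAt_eq_top_iff]
    refine Filter.Eventually.filter_mono nhdsWithin_le_nhds ?_
    have : IsOpen {s : ℂ | c < s.re} := isOpen_lt continuous_const Complex.continuous_re
    filter_upwards [this.mem_nhds (show c < ((c + 1 : ℝ) : ℂ).re by
      rw [Complex.ofReal_re]; linarith)] with s hs
    exact h s hs
  have : PreconnectedSpace (Set.univ : Set ℂ) := Subtype.preconnectedSpace isPreconnected_univ
  have huniv := hclopen.eq_univ ⟨_, hz⟩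
  rw [Filter.EventuallyEq, Filter.Eventually, mem_codiscrete]
  intro x
  rw [Filter.disjoint_principal_right, compl_compl]
  have hx : (⟨x, trivial⟩ : (Set.univ : Set ℂ)) ∈
      {u : (Set.univ : Set ℂ) | meromorphicOrderAt f u = ⊤} := huniv ▸ Set.mem_univ _
  exact meromorphicOrderAt_eq_top_iff.mp hx

theorem eventuallyEq_of_half_plane {f g : ℂ → ℂ} (hf : Meromorphic f) (hg : Meromorphic g) {c : ℝ}
    (h : ∀ s : ℂ, c < s.re → f s = g s) : f =ᶠ[Filter.codiscrete ℂ] g := by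
  have := eventuallyEq_zero_of_half_plane (f := fun s => f s - g s) (hf.sub hg) (c := c)
    fun s hs => sub_eq_zero.mpr (h s hs)
  filter_upwards [this] with s hs
  exact sub_eq_zero.mp hs

theorem meromorphic_prod_zpow {P : Type*} [Fintype P] {J : P → Type*} [∀ p, Fintype (J p)]
    {Z : ∀ p, J p → ℂ → ℂ} (hZ : ∀ p j, Meromorphic (Z p j)) (ρ : ℂ) (lam : ∀ p, J p → ℂ)
    (e : P → ℤ) : Meromorphic fun s => ∏ p, (∏ j, Z p j (s + ρ - lam p j)) ^ e p := by
  intro x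
  refine MeromorphicAt.fun_prod fun p _ => MeromorphicAt.fun_zpow
    (MeromorphicAt.fun_prod fun j _ => ?_) _
  exact (hZ p j (x + ρ - lam p j)).comp_analyticAt (g := fun s => s + ρ - lam p j) (by fun_prop)

/-- Continuation of an identity of products from a half-plane. -/
theorem eventuallyEq_prod_zpow {P : Type*} [Fintype P] {J : P → Type*} [∀ p, Fintype (J p)]
    {R R₀ : ℂ → ℂ} {Z Z₀ : ∀ p, J p → ℂ → ℂ} (ρ : ℝ) (lam : ∀ p, J p → ℂ) (e : P → ℤ)
    (hR : Meromorphic R) (hR₀ : ∃ b : ℝ, ∀ s : ℂ, b < s.re → R s = R₀ s)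
    (hZ : ∀ p j, Meromorphic (Z p j) ∧ ∃ b : ℝ, ∀ s : ℂ, b < s.re → Z p j s = Z₀ p j s)
    (h : ∃ c : ℝ, ∀ s : ℂ, c < s.re → R₀ s = ∏ p, (∏ j, Z₀ p j (s + ρ - lam p j)) ^ e p) :
    R =ᶠ[Filter.codiscrete ℂ] fun s => ∏ p, (∏ j, Z p j (s + ρ - lam p j)) ^ e p := by
  obtain ⟨b, hb⟩ := hR₀
  obtain ⟨c, hc⟩ := h
  choose hZ1 b' hb' using hZ
  obtain ⟨B, hB⟩ := (Set.finite_range fun q : Σ p, J p =>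
    b' q.1 q.2 - ρ + (lam q.1 q.2).re).bddAbove
  refine eventuallyEq_of_half_plane hR (meromorphic_prod_zpow hZ1 ρ lam e)
    (c := max b (max c B)) fun s hs => ?_
  have h1 : b < s.re := (le_max_left _ _).trans_lt hs
  have h2 : c < s.re := ((le_max_left _ _).trans (le_max_right _ _)).trans_lt hs
  have h3 : B < s.re := ((le_max_right _ _).trans (le_max_right _ _)).trans_lt hs
  rw [hb s h1, hc s h2]
  refine Finset.prod_congr rfl fun p _ => ?_
  congr 1
  refine Finset.prod_congr rfl fun j _ => (hb' p j _ ?_).symm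
  have h4 := hB ⟨⟨p, j⟩, rfl⟩
  simp only [Complex.add_re, Complex.sub_re, Complex.ofReal_re] at h4 ⊢
  linarith

/-! ### Compound matrices -/

section Compound

variable {ι : Type*} [LinearOrder ι]

/-- The matrix of the `p`-minors of a matrix. -/
def compound (p : ℕ) (A : Matrix ι ι ℂ) :
    Matrix (Set.powersetCard ι p) (Set.powersetCard ι p) ℂ :=
  Matrix.of fun I J => (A.submatrix (Set.powersetCard.ofFinEmbEquiv.symm I)
    (Set.powersetCard.ofFinEmbEquiv.symm J)).det

theorem compound_conjTranspose (p : ℕ) (A : Matrix ι ι ℂ) :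
    (compound p A)ᴴ = compound p Aᴴ := by
  ext I J
  rw [Matrix.conjTranspose_apply, compound, compound, Matrix.of_apply, Matrix.of_apply,
    ← Matrix.det_conjTranspose, Matrix.conjTranspose_submatrix]

theorem compound_smul (p : ℕ) (c : ℂ) (A : Matrix ι ι ℂ) :
    compound p (c • A) = c ^ p • compound p A := by
  ext I J
  rw [Matrix.smul_apply, compound, compound, Matrix.of_apply, Matrix.of_apply,
    show (c • A).submatrix _ _ = c • A.submatrix _ _ from rfl, Matrix.det_smul, Fintype.card_fin, smul_eq_mul]

theorem continuous_compound (p : ℕ) {X : Type*} [TopologicalSpace X] {A : X → Matrix ι ι ℂ}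
    (hA : Continuous A) : Continuous fun x => compound p (A x) :=
  continuous_matrix fun _ _ => (hA.matrix_submatrix _ _).matrix_det

variable [Fintype ι] [DecidableEq ι] {V : Type*} [AddCommGroup V] [Module ℂ V]

theorem toMatrix_exteriorPower_map (p : ℕ) (b : Basis ι ℂ V) (f : Module.End ℂ V) :
    LinearMap.toMatrix (b.exteriorPower p) (b.exteriorPower p) (exteriorPower.map p f) =
      compound p (LinearMap.toMatrix b b f) := by
  ext I J
  rw [LinearMap.toMatrix_apply, exteriorPower.basis_repr_apply, exteriorPower.basis_apply,
    exteriorPower.map_apply_ιMulti_family, exteriorPower.ιMulti_family,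
    exteriorPower.ιMultiDual_apply_ιMulti, compound, Matrix.of_apply, ← Matrix.det_transpose]
  congr 1
  ext i j
  rw [Matrix.submatrix_apply, LinearMap.toMatrix_apply]
  rfl

/-- The Cauchy–Binet formula, as functoriality of Λ^p. -/
theorem compound_mul (p : ℕ) (A B : Matrix ι ι ℂ) :
    compound p (A * B) = compound p A * compound p B := by
  set b := Pi.basisFun ℂ ι
  have h : ∀ A : Matrix ι ι ℂ, compound p A = LinearMap.toMatrix (b.exteriorPower p)
      (b.exteriorPower p) (exteriorPower.map p (Matrix.toLin b b A)) := fun A => by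
    rw [toMatrix_exteriorPower_map, LinearMap.toMatrix_toLin]
  rw [h, h, h, Matrix.toLin_mul b b b A B, exteriorPower.map_comp,
    LinearMap.toMatrix_comp _ (b.exteriorPower p)]

theorem compound_one (p : ℕ) : compound p (1 : Matrix ι ι ℂ) = 1 := by
  set b := Pi.basisFun ℂ ι
  rw [← LinearMap.toMatrix_one b, ← toMatrix_exteriorPower_map]
  change LinearMap.toMatrix _ _ (exteriorPower.map p LinearMap.id) = 1
  rw [exteriorPower.map_id, LinearMap.toMatrix_id]

end Compound

/-! ### Complete reducibility of unitary representations -/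

section Decomposition

variable {M : Type} [Group M]

theorem exists_invariant_of_not_irreducible {E : Type*} [AddCommGroup E] [Module ℂ E] [Nontrivial E]
    {ρ : Representation ℂ M E} (h : ¬ ρ.IsIrreducible) :
    ∃ S : Submodule ℂ E, S ≠ ⊥ ∧ S ≠ ⊤ ∧ ∀ m, ∀ x ∈ S, ρ m x ∈ S := by
  by_contra! hS
  have hne : (⊥ : Subrepresentation ρ) ≠ ⊤ := fun h0 =>
    bot_ne_top (congrArg Subrepresentation.toSubmodule h0)
  have : Nontrivial (Subrepresentation ρ) := ⟨⟨⊥, ⊤, hne⟩⟩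
  refine h ⟨fun S => ?_⟩
  by_contra! hS'
  obtain ⟨m, x, hx, hx'⟩ := hS S.toSubmodule
    (fun h0 => hS'.1 (Subrepresentation.toSubmodule_injective h0))
    (fun h0 => hS'.2 (Subrepresentation.toSubmodule_injective h0))
  exact hx' (S.apply_mem_toSubmodule m hx)

theorem mem_orthogonal_of_invariant {E : Type*} [NormedAddCommGroup E] [InnerProductSpace ℂ E]
    {ρ : Representation ℂ M E} (hn : ∀ m v, ‖ρ m v‖ = ‖v‖) {S : Submodule ℂ E}
    (hS : ∀ m, ∀ x ∈ S, ρ m x ∈ S) (m : M) (y : E) (hy : y ∈ Sᗮ) : ρ m y ∈ Sᗮ := by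
  rw [Submodule.mem_orthogonal] at hy ⊢
  intro x hx
  have h1 : ρ m (ρ m⁻¹ x) = x := by
    rw [← Module.End.mul_apply, ← map_mul, mul_inv_cancel, map_one, Module.End.one_apply]
  rw [← h1, (LinearMap.norm_map_iff_inner_map_map (ρ m)).mp (hn m)]
  exact hy _ (hS _ x hx)

variable [TopologicalSpace M]

/-- Induction on a bound for the dimension: a reducible unitary representation is the sum of a
proper invariant subspace and its orthogonal complement, both unitary of smaller dimension. -/
theorem exists_decomposition (N : ℕ) : ∀ (E : Type) [NormedAddCommGroup E] [InnerProductSpace ℂ E]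
    [FiniteDimensional ℂ E] (ρ : Representation ℂ M E), (∀ v, Continuous fun m => ρ m v) →
    (∀ m v, ‖ρ m v‖ = ‖v‖) → finrank ℂ E ≤ N →
    ∃ (J : Type) (_ : Fintype J) (psi : J → UnitaryIrrep.{0} M) (e : E ≃ₗ[ℂ] (∀ j, (psi j).V)),
      ∀ m x j, e (ρ m x) j = (psi j).rep m (e x j) := by
  induction N with
  | zero =>
    intro E _ _ _ ρ _ _ hN
    have : Subsingleton E := finrank_zero_iff.mp (Nat.le_zero.mp hN)
    exact ⟨Empty, inferInstance, Empty.elim, LinearEquiv.ofSubsingleton _ _, fun _ _ j => j.elim⟩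
  | succ N ih =>
    intro E _ _ _ ρ hc hn hN
    rcases subsingleton_or_nontrivial E with hE | hE
    · exact ⟨Empty, inferInstance, Empty.elim, LinearEquiv.ofSubsingleton _ _,
        fun _ _ j => j.elim⟩
    by_cases hirr : ρ.IsIrreducible
    · exact ⟨Unit, inferInstance, fun _ => ⟨E, ρ, hc, hn, hirr⟩,
        (LinearEquiv.funUnique Unit ℂ E).symm, fun _ _ _ => rfl⟩
    obtain ⟨S, hbot, htop, hS⟩ := exists_invariant_of_not_irreducible hirr
    have hS' := mem_orthogonal_of_invariant hn hS
    set ρ₁ := Subrepresentation.toRepresentation (ρ := ρ) ⟨S, fun m _ hv => hS m _ hv⟩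
    set ρ₂ := Subrepresentation.toRepresentation (ρ := ρ) ⟨Sᗮ, fun m _ hv => hS' m _ hv⟩
    have hS1 : finrank ℂ S < finrank ℂ E := Submodule.finrank_lt htop
    have hS2 : finrank ℂ Sᗮ < finrank ℂ E := Submodule.finrank_lt fun h =>
      hbot ((Submodule.orthogonal_eq_top_iff S).mp h)
    obtain ⟨J₁, _, psi₁, e₁, h₁⟩ := ih S ρ₁ (fun v => (hc v).subtype_mk _) (fun m v => hn m v)
      (by omega)
    obtain ⟨J₂, _, psi₂, e₂, h₂⟩ := ih Sᗮ ρ₂ (fun v => (hc v).subtype_mk _) (fun m v => hn m v)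
      (by omega)
    set f := Submodule.prodEquivOfIsCompl S Sᗮ (Submodule.isCompl_orthogonal S)
    have hf : ∀ m x, f.symm (ρ m x) = (ρ₁ m (f.symm x).1, ρ₂ m (f.symm x).2) := by
      intro m x
      rw [LinearEquiv.symm_apply_eq, Submodule.coe_prodEquivOfIsCompl']
      conv_lhs => rw [← f.apply_symm_apply x, Submodule.coe_prodEquivOfIsCompl', map_add]
      rfl
    refine ⟨J₁ ⊕ J₂, inferInstance, Sum.elim psi₁ psi₂, f.symm ≪≫ₗ (e₁.prodCongr e₂) ≪≫ₗ
      (LinearEquiv.sumPiEquivProdPi ℂ J₁ J₂ fun j => (Sum.elim psi₁ psi₂ j).V).symm, ?_⟩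
    rintro m x (j | j)
    · change e₁ (f.symm (ρ m x)).1 j = (psi₁ j).rep m (e₁ (f.symm x).1 j)
      rw [hf, h₁]
    · change e₂ (f.symm (ρ m x)).2 j = (psi₂ j).rep m (e₂ (f.symm x).2 j)
      rw [hf, h₂]

end Decomposition

/-! ### The decomposition of the exterior powers -/

namespace HypGroup

variable {n : ℕ} (L : HypGroup n)

theorem mid_one : L.mid 1 = 1 := by
  rw [mid, OneMemClass.coe_one, map_one, Matrix.submatrix_one _ Subtype.val_injective]

theorem mid_mul (m m' : L.M) : L.mid (m * m') = L.mid m * L.mid m' := by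
  ext i j
  rw [mid, Matrix.submatrix_apply, Subgroup.coe_mul, map_mul, Matrix.mul_apply, sum_idx,
    cov_M_row_zero, cov_M_row_top, if_neg j.2.1, if_neg j.2.2, mul_zero, mul_zero, zero_add,
    zero_add]
  rfl

/-- The unitary matrices of `Λ^p Ad(m)` on `Λ^p 𝔫_ℂ`. -/
def nuMatrix (p : ℕ) (m : L.M) :
    Matrix (Set.powersetCard (Mid n) p) (Set.powersetCard (Mid n) p) ℂ :=
  compound p ((L.mid m).map Complex.ofRealHom)

theorem nuMatrix_mul (p : ℕ) (m m' : L.M) :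
    L.nuMatrix p (m * m') = L.nuMatrix p m * L.nuMatrix p m' := by
  rw [nuMatrix, mid_mul, Matrix.map_mul, compound_mul]
  rfl

theorem nuMatrix_one (p : ℕ) : L.nuMatrix p 1 = 1 := by
  rw [nuMatrix, mid_one, Matrix.map_one _ (map_zero _) (map_one _), compound_one]

theorem nuMatrix_unitary (p : ℕ) (m : L.M) : (L.nuMatrix p m)ᴴ * L.nuMatrix p m = 1 := by
  have h : ((L.mid m).map Complex.ofRealHom)ᴴ = ((L.mid m)ᵀ).map Complex.ofRealHom := by
    ext i j; simp
  rw [nuMatrix, compound_conjTranspose, h, ← compound_mul, ← Matrix.map_mul, mid_transpose_mul,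
    Matrix.map_one _ (map_zero _) (map_one _), compound_one]

theorem continuous_nuMatrix (hL : Continuous L.cov) (p : ℕ) : Continuous (L.nuMatrix p) := by
  refine continuous_compound p (continuous_matrix fun i j => ?_)
  exact Complex.continuous_ofReal.comp
    ((hL.comp continuous_subtype_val).matrix_elem i.1 j.1)

/-- The representation of `M` on `Λ^p 𝔫_ℂ` in coordinates. -/
def nuRep (p : ℕ) : Representation ℂ L.M (EuclideanSpace ℂ (Set.powersetCard (Mid n) p)) where
  toFun m := Matrix.toEuclideanLin (L.nuMatrix p m)
  map_one' := by
    rw [nuMatrix_one]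
    ext v
    simp
  map_mul' m m' := by
    rw [nuMatrix_mul]
    ext v
    simp [Matrix.mulVec_mulVec]

/-- exp(tH) acts on 𝔫 by e^t, hence on Λ^p 𝔫 by the scalar e^{pt}; all λ can be taken equal to p. -/
theorem toMatrix_nu (p : ℕ) (m : L.M) (t : ℝ) :
    LinearMap.toMatrix ((rootBasisC n (one_mul 1)).exteriorPower p)
      ((rootBasisC n (one_mul 1)).exteriorPower p) (L.nu p m t) =
      Complex.exp (p * t) • L.nuMatrix p m := by
  rw [nu, toMatrix_exteriorPower_map, L.toMatrix_AdC (Or.inl rfl), compound_smul, one_mul,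
    Complex.ofReal_exp, ← Complex.exp_nat_mul]
  rfl

/-- In the coordinates of 𝔫 the group M acts by real orthogonal matrices, so it acts on Λ^p 𝔫_ℂ by
unitary compound matrices, continuous in m. Complete reducibility applies, and A acts by scalars. -/
theorem nonempty_MADecomp (hL : Continuous L.cov) (p : ℕ) : Nonempty (MADecomp.{0} L p) := by
  have hc : ∀ v, Continuous fun m => L.nuRep p m v := fun v =>
    (PiLp.continuous_toLp 2 _).comp ((L.continuous_nuMatrix hL p).matrix_mulVec continuous_const)
  obtain ⟨J, _, psi, e, he⟩ := exists_decomposition _ _ (L.nuRep p) hc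
    (fun m v => norm_toEuclideanLin (L.nuMatrix_unitary p m) v) le_rfl
  set B := (rootBasisC n (one_mul 1)).exteriorPower p
  refine ⟨⟨J, psi, fun _ => p, B.equivFun ≪≫ₗ (WithLp.linearEquiv 2 ℂ _).symm ≪≫ₗ e,
    fun m t x j => ?_⟩⟩
  have h : (WithLp.linearEquiv 2 ℂ _).symm (B.equivFun (L.nu p m t x)) =
      Complex.exp (p * t) • L.nuRep p m ((WithLp.linearEquiv 2 ℂ _).symm (B.equivFun x)) := by
    have h1 := LinearMap.toMatrix_mulVec_repr B B (L.nu p m t) x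
    rw [toMatrix_nu, Matrix.smul_mulVec] at h1
    change WithLp.toLp 2 ⇑(B.repr (L.nu p m t x)) =
      Complex.exp (p * t) • WithLp.toLp 2 (L.nuMatrix p m *ᵥ ⇑(B.repr x))
    rw [← h1]
    rfl
  simp only [LinearEquiv.trans_apply]
  rw [h, map_smul, Pi.smul_apply, he]

end HypGroup

end Hyp

end

/-! ### The theorem -/

theorem theorem6p6 (n : ℕ) (hn : 0 < n) (L : Hyp.HypGroup n)
    (hL : L = Hyp.spinGrp n ∨ L = Hyp.soGroup n)
    (Γ : Subgroup L.G) (hdiscrete : DiscreteTopology Γ)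
    (hcocompact : CompactSpace (MulAction.orbitRel.Quotient Γ L.G))
    (htorsionfree : ∀ γ : Γ, γ ≠ 1 → ∀ k : ℕ, 0 < k → γ ^ k ≠ 1)
    {V : Type u} [AddCommGroup V] [Module ℂ V] [FiniteDimensional ℂ V]
    (χ : Representation ℂ Γ V) (σ : Hyp.UnitaryIrrep.{v} L.M) :
    -- the decompositions exist
    (∀ p : Fin (2 * n + 1), Nonempty (Hyp.MADecomp.{0} L p)) ∧
    ∀ D : (p : Fin (2 * n + 1)) → Hyp.MADecomp.{w} L p,
      -- the identity on a half-plane where all the products converge absolutely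
      (∃ c : ℝ, ∀ s : ℂ, c < s.re →
        Hyp.AbsConvProd (Hyp.ruelleFactor χ σ.rep s) ∧
        (∀ p, ∀ j : (D p).J,
          Hyp.AbsConvProd (fun q : Hyp.PrimeClass Γ × ℕ =>
            Hyp.selbergFactor χ (((D p).psi j).rep.tprod σ.rep)
              (s + Hyp.rho n - (D p).lam j) q.1 q.2) ∧
          Hyp.selbergZ χ (((D p).psi j).rep.tprod σ.rep) (s + Hyp.rho n - (D p).lam j) ≠ 0) ∧
        Hyp.ruelleR χ σ.rep s =
          ∏ p : Fin (2 * n + 1), Hyp.zetaP χ σ.rep (D p) s ^ ((-1 : ℤ) ^ (p : ℕ))) ∧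
      -- the identity for meromorphic continuations
      (∀ (R : ℂ → ℂ) (Z : (p : Fin (2 * n + 1)) → (D p).J → ℂ → ℂ),
        Meromorphic R →
        (∃ b : ℝ, ∀ s : ℂ, b < s.re → R s = Hyp.ruelleR χ σ.rep s) →
        (∀ p j, Meromorphic (Z p j) ∧ ∃ b : ℝ, ∀ s : ℂ, b < s.re →
          Z p j s = Hyp.selbergZ χ (((D p).psi j).rep.tprod σ.rep) s) →
        R =ᶠ[Filter.codiscrete ℂ] fun s =>
          ∏ p : Fin (2 * n + 1),
            (∏ j : (D p).J, Z p j (s + Hyp.rho n - (D p).lam j)) ^ ((-1 : ℤ) ^ (p : ℕ))) := by 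
  have hp : L.IsProper := by
    rcases hL with rfl | rfl
    · exact Hyp.spinGrp_isProper n
    · exact Hyp.soGroup_isProper n
  refine ⟨fun p => L.nonempty_MADecomp hp.continuous_cov p, fun D => ?_⟩
  obtain ⟨ε, K, κ, A, hχ⟩ := hp.exists_zetaBound hdiscrete hcocompact htorsionfree χ
  have hσ := σ.hasUnitEigenbases
  obtain ⟨c, hAc, hc⟩ := Hyp.exists_half_plane (J := Σ p, (D p).J) A (Hyp.rho n)
    fun q => (D q.1).lam q.2
  have hD : ∀ s : ℂ, c < s.re → ∀ p, ∀ j : (D p).J,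
      A ≤ (s + Hyp.rho n - (D p).lam j + Hyp.rho n).re := fun s hs p j => hc s hs ⟨p, j⟩
  have hR : ∀ s : ℂ, c < s.re → Hyp.ruelleR χ σ.rep s =
      ∏ p : Fin (2 * n + 1), Hyp.zetaP χ σ.rep (D p) s ^ ((-1 : ℤ) ^ (p : ℕ)) := fun s hs =>
    hχ.ruelleR_eq hp.det_cov hσ (hAc.trans hs.le) D (hD s hs)
  refine ⟨⟨c, fun s hs => ⟨hχ.absConvProd_ruelleFactor hσ (hAc.trans hs.le), fun p j => ?_,
    hR s hs⟩⟩, fun R Z hRm hR' hZ => Hyp.eventuallyEq_prod_zpow (Hyp.rho n)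
      (fun p j => (D p).lam j) (fun p => (-1 : ℤ) ^ (p : ℕ)) hRm hR' hZ ⟨c, hR⟩⟩
  have hτ := (((D p).psi j).hasUnitEigenbases).tprod hσ
  exact ⟨hχ.absConvProd_selbergFactor hp.det_cov hτ (hD s hs p j),
    (hχ.hasProd_selbergZ hp.det_cov hτ (hD s hs p j)).2⟩
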